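/- Let $S$ be a complete separable metric space, and let $h_1,h_2,\ldots$ be bounded continuous functions on $S$ with $0\le h_k\le 1$ and $\bigcup_k\{x: h_k(x)>0\}=S$. Let $\mathcal M_{\{h_k\}}(S)$ be the space of Borel measures $\nu$ on $S$ with $\int_S h_k\,d\nu<\infty$ for all $k$, topologized so that $\nu_n\to\nu$ if and only if $\int f h_k\,d\nu_n\to\int f h_k\,d\nu$ for all $k$ and all bounded continuous $f$ on $S$. Let $\mathcal M_{\{h_k\}}(S\times[0,\infty))$ be the space of Borel measures $\mu$ on $S\times[0,\infty)$ with $\int_{S\times[0,K]}h_k(x)\,\mu(dx\times du)<\infty$ for all $k$ and all $K>0$, topologized so that $\mu_n\to\mu$ if and only if $\int f h_k\,d\mu_n\to\int f h_k\,d\mu$ for all $k$ and all bounded continuous $f$ on $S\times[0,\infty)$ supported in some $S\times[0,K]$. The space $\mathcal M_{\{h_k\}}(S\times[0,r])$ is identified with the set of those $\mu\in\mathcal M_{\{h_k\}}(S\times[0,\infty))$ for which $\mu(S\times(r,\infty))=0$. For a process $\Xi$ write $\mathcal F^{\Xi}_t=\sigma(\Xi(s): s\le t)$. Let $\xi$ be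 an $\mathcal M_{\{h_k\}}(S\times[0,\infty))$-valued and $\Xi$ an $\mathcal M_{\{h_k\}}(S)$-valued process, both indexed by $t\in[0,\infty)$ and defined on the same probability space. * $(\xi,\Xi)$ satisfies the conditional Poisson relation (P) if for all $t\ge0$, all $K>0$ and all bounded continuous $f\ge0$ on $S$ with $f\le c\,h_k$ for some $c>0$ and some $k$, almost surely $$E\Bigl[e^{-\int_{S\times[0,K]}f(x)\,\xi(t,dx\times du)}\Bigm|\mathcal F_t^{\Xi}\Bigr]=e^{-K\int_S(1-e^{-f})\,d\Xi(t)} .$$ * For $r>0$, $(\xi,\Xi)$ satisfies the conditional uniform-level relation (U$_r$) if for all $t\ge0$ and all bounded continuous $f\ge0$ with $f(x,u)\le c\,h_k(x)$ for some $c>0$ and some $k$, almost surely $$E\Bigl[e^{-\int_{S\times[0,r]}f(x,u)\,\xi(t,dx\times du)}\Bigm|\mathcal F_t^{\Xi}\Bigr]=e^{-\int_S F_f^r(x)\,\Xi(t,dx)},\qquad F^r_f(x)=-r\log\Bigl(\frac1r\int_0^r e^{-f(x,u)}\,du\Bigr).$$ (Taking $f(x,u)=f(x)$, one sees that (U$_r$)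 forces $\Xi(t,dx)=r^{-1}\xi(t,dx\times[0,r])$ almost surely.) For $n=1,2,\ldots$ let $\xi^n$ be a cadlag $\mathcal M_{\{h_k\}}(S\times[0,\infty))$-valued process and $\Xi^n$ a cadlag $\mathcal M_{\{h_k\}}(S)$-valued process on a common probability space (which may depend on $n$). Let $\xi$ be an $\mathcal M_{\{h_k\}}(S\times[0,\infty))$-valued process, and suppose that the finite-dimensional distributions of $\xi^n$ converge to those of $\xi$ (at all finite sets of times in $[0,\infty)$). 1. If $(\xi^n,\Xi^n)$ satisfies (P) for every $n$, then there is an $\mathcal M_{\{h_k\}}(S)$-valued process $\Xi$, defined on the probability space of $\xi$, such that the finite-dimensional distributions of $\Xi^n$ converge to those of $\Xi$ and $(\xi,\Xi)$ satisfies (P). 2. Let $r_n>0$ with $r_n\to\infty$. If, for every $n$, $\xi^n$ takes values in $\mathcal M_{\{h_k\}}(S\times[0,r_n])$ and $(\xi^n,\Xi^n)$ satisfies (U$_{r_n}$), so that $\Xi^n$ is the process $\Xi^n_{r_n}=r_n^{-1}\xi^n(\cdot,dx\times[0,r_n])$ up to modification, then there is an $\mathcal M_{\{h_k\}}(S)$-valued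 process $\Xi$, defined on the probability space of $\xi$, such that the finite-dimensional distributions of $\Xi^n$ converge to those of $\Xi$ and $(\xi,\Xi)$ satisfies (P). -/

import Mathlib

open MeasureTheory Filter Topology
open scoped NNReal ENNReal BoundedContinuousFunction

noncomputable section

/-- The part `S × [0, K]` of the space `S × [0, ∞)` of pairs (location, level). -/
def levelsUpTo (S : Type*) (K : ℝ) : Set (S × ℝ≥0) := {z | (z.2 : ℝ) ≤ K}

section Spaces

variable {S : Type*} [TopologicalSpace S] [MeasurableSpace S]

/-- `M_{h}(S)`: the Borel measures `ν` on `S` with `∫ h_k dν < ∞` for every `k`. -/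
def LocMeasure (h : ℕ → S →ᵇ ℝ) : Type _ :=
  {ν : Measure S // ∀ k, ∫⁻ x, ENNReal.ofReal (h k x) ∂ν < ∞}

/-- `M_{h}(S × [0, ∞))`: the Borel measures `μ` on `S × [0, ∞)` with
`∫_{S × [0, K]} h_k dμ < ∞` for every `k` and every `K > 0`. -/
def LevelMeasure (h : ℕ → S →ᵇ ℝ) : Type _ :=
  {μ : Measure (S × ℝ≥0) //
    ∀ (k : ℕ) (K : ℝ), 0 < K → ∫⁻ z in levelsUpTo S K, ENNReal.ofReal (h k z.1) ∂μ < ∞}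

/-- `ν_n → ν` in `M_{h}(S)` iff `∫ f h_k dν_n → ∫ f h_k dν` for all `k` and all bounded
continuous `f` on `S`. -/
instance LocMeasure.instTopologicalSpace (h : ℕ → S →ᵇ ℝ) : TopologicalSpace (LocMeasure h) :=
  TopologicalSpace.induced
    (fun (ν : LocMeasure h) (p : ℕ × (S →ᵇ ℝ)) => ∫ x, p.2 x * h p.1 x ∂ν.1) inferInstance

/-- `μ_n → μ` in `M_{h}(S × [0, ∞))` iff `∫ f h_k dμ_n → ∫ f h_k dμ` for all `k` and all bounded
continuous `f` on `S × [0, ∞)` that vanish outside some `S × [0, K]`. -/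
instance LevelMeasure.instTopologicalSpace (h : ℕ → S →ᵇ ℝ) :
    TopologicalSpace (LevelMeasure h) :=
  TopologicalSpace.induced
    (fun (μ : LevelMeasure h)
        (p : ℕ × {f : (S × ℝ≥0) →ᵇ ℝ // ∃ K : ℝ, 0 < K ∧ ∀ z, z ∉ levelsUpTo S K → f z = 0}) =>
      ∫ z, p.2.1 z * h p.1 z.1 ∂μ.1) inferInstance

instance LocMeasure.instMeasurableSpace (h : ℕ → S →ᵇ ℝ) : MeasurableSpace (LocMeasure h) :=
  borel _

instance LocMeasure.instBorelSpace (h : ℕ → S →ᵇ ℝ) : BorelSpace (LocMeasure h) := ⟨rfl⟩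

instance LevelMeasure.instMeasurableSpace (h : ℕ → S →ᵇ ℝ) : MeasurableSpace (LevelMeasure h) :=
  borel _

instance LevelMeasure.instBorelSpace (h : ℕ → S →ᵇ ℝ) : BorelSpace (LevelMeasure h) := ⟨rfl⟩

end Spaces

section Processes

/-- An `E`-valued stochastic process indexed by `[0, ∞)`: every `X t` is a random variable. -/
def IsProcess {E Ω : Type*} [MeasurableSpace E] [MeasurableSpace Ω] (X : ℝ≥0 → Ω → E) : Prop :=
  ∀ t, Measurable (X t)

/-- The paths are right continuous and have left limits in `E`. -/
def IsCadlag {E Ω : Type*} [TopologicalSpace E] (X : ℝ≥0 → Ω → E) : Prop :=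
  ∀ (ω : Ω) (t : ℝ≥0), ContinuousWithinAt (fun s => X s ω) (Set.Ici t) t ∧
    ∃ l : E, Tendsto (fun s => X s ω) (𝓝[<] t) (𝓝 l)

/-- The history `F_t = σ(X(s) : s ≤ t)`. -/
@[reducible] def history {E Ω : Type*} [MeasurableSpace E] (X : ℝ≥0 → Ω → E) (t : ℝ≥0) : MeasurableSpace Ω :=
  ⨆ s : ℝ≥0, ⨆ _ : s ≤ t, MeasurableSpace.comap (X s) inferInstance

/-- Convergence of the finite-dimensional distributions of `X n` (on `(Ω' n, P' n)`) to those of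
`X` (on `(Ω, P)`): for all times `t_1, …, t_m`, the vectors `(X n (t_1), …, X n (t_m))` converge in
distribution to `(X (t_1), …, X (t_m))` in `E^m`. -/
def FDDConverges {E : Type*} [TopologicalSpace E] {Ω' : ℕ → Type*}
    [∀ n, MeasurableSpace (Ω' n)] (P' : ∀ n, Measure (Ω' n)) (X' : ∀ n, ℝ≥0 → Ω' n → E)
    {Ω : Type*} [MeasurableSpace Ω] (P : Measure Ω) (X : ℝ≥0 → Ω → E) : Prop :=
  ∀ (m : ℕ) (t : Fin m → ℝ≥0) (F : (Fin m → E) →ᵇ ℝ),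
    Tendsto (fun n => ∫ ω, F (fun i => X' n (t i) ω) ∂(P' n)) atTop
      (𝓝 (∫ ω, F (fun i => X (t i) ω) ∂P))

end Processes

section Relations

variable {S : Type*} [TopologicalSpace S] [MeasurableSpace S] {h : ℕ → S →ᵇ ℝ}
  {Ω : Type*} [MeasurableSpace Ω]

/-- The conditional Poisson relation: for all `t ≥ 0`, `K > 0` and all bounded continuous
`f ≥ 0` on `S` dominated by a multiple of some `h_k`, almost surely
`E[exp(-∫_{S × [0, K]} f(x) ξ(t, dx × du)) | F_t^Ξ] = exp(-K ∫_S (1 - exp(-f)) dΞ(t))`. -/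
def CondPoissonRel (P : Measure Ω) (ξ : ℝ≥0 → Ω → LevelMeasure h)
    (Ξ : ℝ≥0 → Ω → LocMeasure h) : Prop :=
  ∀ (t : ℝ≥0) (K : ℝ), 0 < K → ∀ (f : S →ᵇ ℝ), (∀ x, 0 ≤ f x) →
    (∃ (k : ℕ) (c : ℝ), 0 < c ∧ ∀ x, f x ≤ c * h k x) →
    P[fun ω => Real.exp (-∫ z in levelsUpTo S K, f z.1 ∂(ξ t ω).1) | history Ξ t]
      =ᵐ[P] fun ω => Real.exp (-(K * ∫ x, (1 - Real.exp (-f x)) ∂(Ξ t ω).1))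

/-- `F_f^r(x) = -r log (r⁻¹ ∫_0^r exp(-f(x, u)) du)`. -/
def uniformExponent (r : ℝ) (f : S × ℝ≥0 → ℝ) (x : S) : ℝ :=
  -r * Real.log (r⁻¹ * ∫ u in (0 : ℝ)..r, Real.exp (-f (x, u.toNNReal)))

/-- The conditional uniform-level relation with top level `r`: for all `t ≥ 0` and all bounded
continuous `f ≥ 0` dominated by a multiple of some `h_k`, almost surely
`E[exp(-∫_{S × [0, r]} f(x, u) ξ(t, dx × du)) | F_t^Ξ] = exp(-∫_S F_f^r dΞ(t))`.
(Only the values of `f` on `S × [0, r]` matter. Taking `f(x, u) = f(x)`, for which `F_f^r = r f`,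
one sees that it forces `Ξ(t, dx) = r⁻¹ ξ(t, dx × [0, r])` almost surely.) -/
def CondUniformRel (P : Measure Ω) (r : ℝ) (ξ : ℝ≥0 → Ω → LevelMeasure h)
    (Ξ : ℝ≥0 → Ω → LocMeasure h) : Prop :=
  ∀ (t : ℝ≥0) (f : (S × ℝ≥0) →ᵇ ℝ), (∀ z, 0 ≤ f z) →
    (∃ (k : ℕ) (c : ℝ), 0 < c ∧ ∀ z, f z ≤ c * h k z.1) →
    P[fun ω => Real.exp (-∫ z in levelsUpTo S r, f z ∂(ξ t ω).1) | history Ξ t]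
      =ᵐ[P] fun ω => Real.exp (-∫ x, uniformExponent r f x ∂(Ξ t ω).1)

end Relations

end

/-! Under either relation the levels below `K` look, given the history of `Ξ'`, like a Poisson
sample with intensity `K Ξ'`. By the law of large numbers `Ξ'` is then almost the average of `ξ'`
over the levels below a large `K`, with an error independent of `n` and of the time. The average
depends continuously on `ξ'`, provided that the sharp bound `u ≤ K` is replaced by a continuous
cutoff. Convergence of `ξ'` therefore carries over to `Ξ'`.

Both relations enter only through `LevelSandwich`: integrated against a bounded nonnegative
history-measurable weight, the Laplace functional of `ξ'` with a cutoff lies between two Laplace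
functionals of `Ξ'`. For (P) the cutoff lies between the indicators of `[0, K]` and `[0, K + δ]`.
For the uniform relation `-r log (1 - a / r)` is close to `a` for large `r`, so the bounds hold once
`n` is large (`CondPoissonRel.levelSandwich`, `CondUniformRel.levelSandwich`).

The sandwich has two consequences. Expanding a square shows that the Laplace functionals of the
level average and of `Ξ'` are `L¹`-close at rate `K ^ (-1/2)`
(`LevelSandwich.integral_abs_laplace_sub_le`). Smallness of `1 - exp (-∫ f)` passes from `ξ'` to
`Ξ'`, and convergence of `ξ'` makes it uniform in `n`; this gives common compact sets for the random
measures (`LevelApproximation.exists_compact_containment`).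

The closeness survives in the limit, so the Laplace functionals of the level means of `ξ` converge
almost surely along a geometric sequence of levels. Compact containment makes their limit the
Laplace functional of a random measure `Ξ t`, a function of `ξ t`
(`LevelApproximation.exists_limit_measure`). On compact sets closeness of Laplace functionals means
closeness of any bounded continuous `F`; hence `Ξ'` and `ξ'` converge jointly
(`IsLevelLimit.tendsto_integral_mul`). The sandwich then holds for `(ξ, Ξ)`, and `δ, η → 0` turns it
into an equality tested on functions of finitely many past values, which a π-system argument extends
to the whole history.

No metrizability of the spaces of measures is used. Measurability questions are moved to `ℕ → ℝ` by
the vector of Laplace functionals of a countable separating family, which can be inverted measurably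
on σ-compact sets. -/

set_option linter.unusedSectionVars false

section

/-! ### Continuity of integrals of dominated functions -/

/-- If `i ↦ ∫ g w dμ i` is continuous for all bounded continuous `g`, then so is `i ↦ ∫ f dμ i` for
every continuous `f` with `0 ≤ f ≤ c w`. -/
theorem continuous_integral_of_le_mul {α ι : Type*} [TopologicalSpace α] [MeasurableSpace α]
    [OpensMeasurableSpace α] [TopologicalSpace ι] (μ : ι → Measure α) {w : α → ℝ}
    (hw : Continuous w) (hw0 : ∀ x, 0 ≤ w x) (hwi : ∀ i, Integrable w (μ i))
    (hg : ∀ g : α →ᵇ ℝ, Continuous fun i => ∫ x, g x * w x ∂μ i)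
    {f : α → ℝ} (hf : Continuous f) (hf0 : ∀ x, 0 ≤ f x) {c : ℝ} (hc : 0 < c)
    (hfw : ∀ x, f x ≤ c * w x) : Continuous fun i => ∫ x, f x ∂μ i := by
  have hfi : ∀ i, Integrable f (μ i) := fun i =>
    ((hwi i).const_mul c).mono' hf.aestronglyMeasurable
      (ae_of_all _ fun x => by rw [Real.norm_of_nonneg (hf0 x)]; exact hfw x)
  -- The quotient `f / w` may have no continuous extension to the zeros of `w`, so it is regularized
  -- to `f / (w + e)`. The error `f e / (w + e)` is at most `c` times `e w / (w + e)`, which is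
  -- again a bounded continuous function times `w`. Its integral is thus continuous too: being small
  -- at `i₀`, it stays small nearby.
  have hquot : ∀ (e : ℝ), 0 < e → ∀ (u : α → ℝ), Continuous u → (∀ x, 0 ≤ u x) →
      ∀ b : ℝ, 0 ≤ b → (∀ x, u x ≤ b * (w x + e)) →
      Continuous fun i => ∫ x, u x / (w x + e) * w x ∂μ i := by
    intro e he u hu hu0 b hb hub
    have hpos : ∀ x, 0 < w x + e := fun x => add_pos_of_nonneg_of_pos (hw0 x) he
    have := hg (BoundedContinuousFunction.ofNormedAddCommGroup (fun x => u x / (w x + e))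
      (hu.div (hw.add continuous_const) fun x => (hpos x).ne') b (fun x => by
        rw [Real.norm_of_nonneg (div_nonneg (hu0 x) (hpos x).le), div_le_iff₀ (hpos x)]
        exact hub x))
    simpa using this
  rw [continuous_iff_continuousAt]
  intro i₀
  have hR : Tendsto (fun n : ℕ => ∫ x, (1 / ((n : ℝ) + 1)) / (w x + 1 / ((n : ℝ) + 1)) * w x ∂μ i₀)
      atTop (𝓝 0) := by
    have h0 : Tendsto (fun n : ℕ => 1 / ((n : ℝ) + 1)) atTop (𝓝 0) :=
      tendsto_one_div_add_atTop_nhds_zero_nat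
    have := tendsto_integral_of_dominated_convergence (μ := μ i₀)
      (F := fun (n : ℕ) x => (1 / ((n : ℝ) + 1)) / (w x + 1 / ((n : ℝ) + 1)) * w x)
      (f := fun _ => (0 : ℝ)) (bound := w) (fun n => ?_) (hwi i₀) (fun n => ?_) ?_
    · simpa using this
    · have he : (0 : ℝ) < 1 / ((n : ℝ) + 1) := by positivity
      exact ((continuous_const.div (hw.add continuous_const) fun x =>
        (add_pos_of_nonneg_of_pos (hw0 x) he).ne').mul hw).aestronglyMeasurable
    · refine ae_of_all _ fun x => ?_
      have he : (0 : ℝ) < 1 / ((n : ℝ) + 1) := by positivity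
      have hpos := add_pos_of_nonneg_of_pos (hw0 x) he
      rw [Real.norm_of_nonneg (mul_nonneg (div_nonneg he.le hpos.le) (hw0 x))]
      refine mul_le_of_le_one_left (hw0 x) ?_
      rw [div_le_one hpos]
      linarith [hw0 x]
    · refine ae_of_all _ fun x => ?_
      rcases (hw0 x).eq_or_lt with hx | hx
      · simp [← hx]
      · have := (h0.div (tendsto_const_nhds.add h0) (by simpa using hx.ne' :
          w x + 0 ≠ 0)).mul_const (w x)
        simpa using this
  rw [Metric.continuousAt_iff']
  intro ε hε
  have hε' : 0 < ε / (4 * c) := by positivity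
  obtain ⟨n, hn⟩ := (hR.eventually (gt_mem_nhds hε')).exists
  set e : ℝ := 1 / ((n : ℝ) + 1) with he_def
  have he : 0 < e := by positivity
  have hpos : ∀ x, 0 < w x + e := fun x => add_pos_of_nonneg_of_pos (hw0 x) he
  have hcF := hquot e he f hf hf0 c hc.le fun x => (hfw x).trans (by nlinarith [hw0 x])
  have hcR := hquot e he (fun _ => e) continuous_const (fun _ => he.le) 1 zero_le_one
    fun x => by linarith [hw0 x]
  have hri : ∀ i, Integrable (fun x => e / (w x + e) * w x) (μ i) := fun i =>
    (hwi i).mono' ((continuous_const.div (hw.add continuous_const) fun x =>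
      (hpos x).ne').mul hw).aestronglyMeasurable (ae_of_all _ fun x => by
        rw [Real.norm_of_nonneg (mul_nonneg (div_nonneg he.le (hpos x).le) (hw0 x))]
        refine mul_le_of_le_one_left (hw0 x) ?_
        rw [div_le_one (hpos x)]
        linarith [hw0 x])
  have hFi : ∀ i, Integrable (fun x => f x / (w x + e) * w x) (μ i) := fun i =>
    (hfi i).mono' ((hf.div (hw.add continuous_const) fun x =>
      (hpos x).ne').mul hw).aestronglyMeasurable (ae_of_all _ fun x => by
        rw [Real.norm_of_nonneg (mul_nonneg (div_nonneg (hf0 x) (hpos x).le) (hw0 x)),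
          div_mul_eq_mul_div, div_le_iff₀ (hpos x)]
        nlinarith [hf0 x])
  have hdiff : ∀ i, |∫ x, f x ∂μ i - ∫ x, f x / (w x + e) * w x ∂μ i| ≤
      c * ∫ x, e / (w x + e) * w x ∂μ i := by
    intro i
    have hpt : ∀ x, f x - f x / (w x + e) * w x = f x * e / (w x + e) := fun x => by
      field_simp [(hpos x).ne']; ring
    rw [← integral_sub (hfi i) (hFi i), ← integral_const_mul]
    rw [abs_of_nonneg (integral_nonneg fun x => by
      simp only [Pi.zero_apply]
      rw [hpt]; exact div_nonneg (mul_nonneg (hf0 x) he.le) (hpos x).le)]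
    refine integral_mono ((hfi i).sub (hFi i)) ((hri i).const_mul c) fun x => ?_
    have h1 : c * (e / (w x + e) * w x) = c * w x * e / (w x + e) := by ring
    simp only [hpt, h1]
    exact div_le_div_of_nonneg_right (mul_le_mul_of_nonneg_right (hfw x) he.le) (hpos x).le
  filter_upwards [Metric.continuousAt_iff'.1 hcF.continuousAt (ε / 4) (by positivity),
    hcR.continuousAt.eventually (gt_mem_nhds hn)] with i hi1 hi2
  rw [Real.dist_eq] at hi1 ⊢
  have h1 := abs_le.1 (hdiff i)
  have h2 := abs_le.1 (hdiff i₀)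
  have h3 := abs_lt.1 hi1
  have h4 : c * ∫ x, e / (w x + e) * w x ∂μ i < ε / 4 := by
    calc _ < c * (ε / (4 * c)) := by gcongr
      _ = ε / 4 := by field_simp
  have h5 : c * ∫ x, e / (w x + e) * w x ∂μ i₀ < ε / 4 := by
    calc _ < c * (ε / (4 * c)) := by gcongr
      _ = ε / 4 := by field_simp
  rw [abs_lt]
  constructor <;> linarith

/-! ### Integrals of functions dominated by a weight. -/

section Integrals

variable {S : Type*} [TopologicalSpace S] [MeasurableSpace S]

/-- Continuous functions `f` with `0 ≤ f ≤ c h_k` for some `c > 0` and some `k`. -/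
structure Dominated (h : ℕ → S →ᵇ ℝ) (f : S → ℝ) : Prop where
  continuous : Continuous f
  nonneg : ∀ x, 0 ≤ f x
  le : ∃ (k : ℕ) (c : ℝ), 0 < c ∧ ∀ x, f x ≤ c * h k x

variable {h : ℕ → S →ᵇ ℝ}

theorem Dominated.of_le {f g : S → ℝ} (hf : Dominated h f) (hg : Continuous g)
    (hg0 : ∀ x, 0 ≤ g x) {c : ℝ} (hc : 0 < c) (hgf : ∀ x, g x ≤ c * f x) : Dominated h g := by
  obtain ⟨k, b, hb, hle⟩ := hf.le
  exact ⟨hg, hg0, k, c * b, by positivity, fun x => (hgf x).trans (by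
    rw [mul_assoc]; exact mul_le_mul_of_nonneg_left (hle x) hc.le)⟩

theorem Dominated.const_mul {f : S → ℝ} (hf : Dominated h f) {c : ℝ} (hc : 0 ≤ c) :
    Dominated h fun x => c * f x :=
  hf.of_le (continuous_const.mul hf.continuous) (fun x => mul_nonneg hc (hf.nonneg x))
    (c := c + 1) (by positivity) fun x => by nlinarith [hf.nonneg x]

theorem Dominated.one_sub_exp_neg {f : S → ℝ} (hf : Dominated h f) :
    Dominated h fun x => 1 - Real.exp (-f x) :=
  hf.of_le (continuous_const.sub (Real.continuous_exp.comp hf.continuous.neg))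
    (fun x => by have := hf.nonneg x; simp [this]) one_pos
    fun x => by linarith [Real.add_one_le_exp (-f x)]

theorem integrable_of_lintegral_ofReal_lt_top {α : Type*} [MeasurableSpace α] {μ : Measure α}
    {f : α → ℝ} (hf : AEStronglyMeasurable f μ) (hf0 : ∀ x, 0 ≤ f x)
    (hi : ∫⁻ x, ENNReal.ofReal (f x) ∂μ < ∞) : Integrable f μ :=
  ⟨hf, (hasFiniteIntegral_iff_ofReal (ae_of_all _ hf0)).2 hi⟩

variable [OpensMeasurableSpace S]

theorem LocMeasure.integrable_h (h_nonneg : ∀ k x, 0 ≤ h k x) (ν : LocMeasure h) (k : ℕ) :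
    Integrable (h k) ν.1 :=
  integrable_of_lintegral_ofReal_lt_top (h k).continuous.aestronglyMeasurable (h_nonneg k) (ν.2 k)

theorem Dominated.integrable (h_nonneg : ∀ k x, 0 ≤ h k x) {f : S → ℝ} (hf : Dominated h f)
    (ν : LocMeasure h) : Integrable f ν.1 := by
  obtain ⟨k, c, hc, hle⟩ := hf.le
  exact ((LocMeasure.integrable_h h_nonneg ν k).const_mul c).mono'
    hf.continuous.aestronglyMeasurable
    (ae_of_all _ fun x => by rw [Real.norm_of_nonneg (hf.nonneg x)]; exact hle x)

theorem LocMeasure.continuous_integral_mul (k : ℕ) (g : S →ᵇ ℝ) :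
    Continuous fun ν : LocMeasure h => ∫ x, g x * h k x ∂ν.1 :=
  (continuous_apply (A := fun _ => ℝ) (k, g)).comp
    (continuous_induced_dom
      (f := fun (ν : LocMeasure h) (p : ℕ × (S →ᵇ ℝ)) => ∫ x, p.2 x * h p.1 x ∂ν.1))

theorem Dominated.continuous_integral (h_nonneg : ∀ k x, 0 ≤ h k x) {f : S → ℝ}
    (hf : Dominated h f) : Continuous fun ν : LocMeasure h => ∫ x, f x ∂ν.1 := by
  obtain ⟨k, c, hc, hle⟩ := hf.le
  exact continuous_integral_of_le_mul (fun ν : LocMeasure h => ν.1) (h k).continuous (h_nonneg k)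
    (fun ν => LocMeasure.integrable_h h_nonneg ν k)
    (fun g => LocMeasure.continuous_integral_mul k g) hf.continuous hf.nonneg hc hle

end Integrals

/-! ### Level cutoffs -/

/-- The continuous cutoff which is `1` on `[0, K]`, `0` on `[K + δ, ∞)` and linear in between. -/
noncomputable def levelCutoff (K δ : ℝ) (u : ℝ≥0) : ℝ := max 0 (min 1 ((K + δ - u) / δ))

theorem levelCutoff_nonneg (K δ : ℝ) (u : ℝ≥0) : 0 ≤ levelCutoff K δ u := le_max_left _ _

theorem levelCutoff_le_one (K δ : ℝ) (u : ℝ≥0) : levelCutoff K δ u ≤ 1 :=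
  max_le zero_le_one (min_le_left _ _)

@[fun_prop]
theorem continuous_levelCutoff (K δ : ℝ) : Continuous (levelCutoff K δ) := by
  unfold levelCutoff
  exact continuous_const.max (continuous_const.min
    ((continuous_const.sub NNReal.continuous_coe).div_const δ))

theorem levelCutoff_eq_one {K δ : ℝ} (hδ : 0 < δ) {u : ℝ≥0} (hu : (u : ℝ) ≤ K) :
    levelCutoff K δ u = 1 := by
  have : 1 ≤ (K + δ - u) / δ := by rw [le_div_iff₀ hδ]; linarith
  simp [levelCutoff, this]

theorem levelCutoff_eq_zero {K δ : ℝ} (hδ : 0 < δ) {u : ℝ≥0} (hu : K + δ ≤ u) :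
    levelCutoff K δ u = 0 := by
  have : (K + δ - u) / δ ≤ 0 := div_nonpos_of_nonpos_of_nonneg (by linarith) hδ.le
  exact max_eq_left ((min_le_right _ _).trans this)

theorem measurableSet_levelsUpTo (S : Type*) [MeasurableSpace S] (K : ℝ) :
    MeasurableSet (levelsUpTo S K) :=
  measurableSet_le (measurable_coe_nnreal_real.comp measurable_snd) measurable_const

/-! ### Continuity of integrals and averages over levels. -/

section LevelIntegrals

variable {S : Type*} [TopologicalSpace S] [SecondCountableTopology S] [MeasurableSpace S]
  [OpensMeasurableSpace S] {h : ℕ → S →ᵇ ℝ}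

theorem LevelMeasure.integrableOn_h (h_nonneg : ∀ k x, 0 ≤ h k x) (μ : LevelMeasure h) (k : ℕ)
    (K : ℝ) : IntegrableOn (fun z : S × ℝ≥0 => h k z.1) (levelsUpTo S K) μ.1 := by
  have hpos : 0 < max K 1 := lt_max_of_lt_right one_pos
  have : IntegrableOn (fun z : S × ℝ≥0 => h k z.1) (levelsUpTo S (max K 1)) μ.1 :=
    integrable_of_lintegral_ofReal_lt_top
      ((h k).continuous.comp continuous_fst).aestronglyMeasurable (fun z => h_nonneg k z.1)
      (μ.2 k _ hpos)
  exact this.mono_set fun z (hz : (z.2 : ℝ) ≤ K) => hz.trans (le_max_left _ _)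

theorem LevelMeasure.integrable_of_le (h_nonneg : ∀ k x, 0 ≤ h k x) (μ : LevelMeasure h)
    {p : S × ℝ≥0 → ℝ} (hp : AEStronglyMeasurable p μ.1) (hp0 : ∀ z, 0 ≤ p z) {k : ℕ} {c K : ℝ}
    (hle : ∀ z, p z ≤ c * h k z.1) (hK : ∀ z, z ∉ levelsUpTo S K → p z = 0) :
    Integrable p μ.1 := by
  rw [← integrableOn_iff_integrable_of_support_subset (s := levelsUpTo S K)
    (fun z hz => by_contra fun hz' => hz (hK z hz'))]
  exact ((LevelMeasure.integrableOn_h h_nonneg μ k K).const_mul c).mono' hp.restrict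
    (ae_of_all _ fun z => by rw [Real.norm_of_nonneg (hp0 z)]; exact hle z)

theorem LevelMeasure.continuous_integral_mul (k : ℕ) {g : S × ℝ≥0 → ℝ} (hg : Continuous g)
    {B : ℝ} (hB : ∀ z, |g z| ≤ B) {K : ℝ} (hK : ∀ z, z ∉ levelsUpTo S K → g z = 0) :
    Continuous fun μ : LevelMeasure h => ∫ z, g z * h k z.1 ∂μ.1 := by
  have hpos : 0 < max K 1 := lt_max_of_lt_right one_pos
  exact (continuous_apply (A := fun _ => ℝ) ((k, ⟨BoundedContinuousFunction.ofNormedAddCommGroup g hg B hB,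
    max K 1, hpos, fun z hz => hK z fun (hz' : (z.2 : ℝ) ≤ K) =>
      hz (hz'.trans (le_max_left _ _))⟩) : ℕ × {f : (S × ℝ≥0) →ᵇ ℝ //
        ∃ K : ℝ, 0 < K ∧ ∀ z, z ∉ levelsUpTo S K → f z = 0})).comp
    (continuous_induced_dom (f := fun (μ : LevelMeasure h)
      (p : ℕ × {f : (S × ℝ≥0) →ᵇ ℝ // ∃ K : ℝ, 0 < K ∧ ∀ z, z ∉ levelsUpTo S K → f z = 0}) =>
        ∫ z, p.2.1 z * h p.1 z.1 ∂μ.1))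

theorem LevelMeasure.continuous_integral_of_le (h_nonneg : ∀ k x, 0 ≤ h k x)
    {p : S × ℝ≥0 → ℝ} (hp : Continuous p) (hp0 : ∀ z, 0 ≤ p z) {k : ℕ} {c K : ℝ} (hc : 0 < c)
    (hle : ∀ z, p z ≤ c * h k z.1) (hK : ∀ z, z ∉ levelsUpTo S K → p z = 0) :
    Continuous fun μ : LevelMeasure h => ∫ z, p z ∂μ.1 := by
  have hcut : ∀ z : S × ℝ≥0, z ∉ levelsUpTo S (K + 1) → levelCutoff K 1 z.2 = 0 := fun z hz =>
    levelCutoff_eq_zero one_pos (not_le.1 hz).le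
  have hcont : Continuous fun z : S × ℝ≥0 => levelCutoff K 1 z.2 :=
    (continuous_levelCutoff K 1).comp continuous_snd
  have hh : Continuous fun z : S × ℝ≥0 => h k z.1 := (h k).continuous.comp continuous_fst
  -- The weight includes a cutoff equal to `1` on the support of `p`: a general bounded `g` is not
  -- an admissible test function, but `g` times the cutoff is.
  refine continuous_integral_of_le_mul (fun μ : LevelMeasure h => μ.1)
    (w := fun z => levelCutoff K 1 z.2 * h k z.1) (hcont.mul hh)
    (fun z => mul_nonneg (levelCutoff_nonneg _ _ _) (h_nonneg k _)) (fun μ => ?_) (fun g => ?_)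
    hp hp0 hc fun z => ?_
  · refine LevelMeasure.integrable_of_le h_nonneg μ (hcont.mul hh).aestronglyMeasurable
      (fun z => mul_nonneg (levelCutoff_nonneg _ _ _) (h_nonneg k _)) (k := k) (c := 1)
      (K := K + 1) (fun z => mul_le_mul_of_nonneg_right (levelCutoff_le_one _ _ _) (h_nonneg k _))
      fun z hz => by rw [hcut z hz, zero_mul]
  · simp_rw [← mul_assoc]
    refine LevelMeasure.continuous_integral_mul k (g.continuous.mul hcont) (B := ‖g‖)
      (fun z => ?_) (K := K + 1) fun z hz => by rw [hcut z hz, mul_zero]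
    rw [abs_mul, abs_of_nonneg (levelCutoff_nonneg K 1 z.2)]
    exact (mul_le_of_le_one_right (abs_nonneg _) (levelCutoff_le_one _ _ _)).trans
      (g.norm_coe_le_norm z)
  · by_cases hz : z ∈ levelsUpTo S K
    · rw [levelCutoff_eq_one one_pos hz, one_mul]; exact hle z
    · rw [hK z hz]
      exact mul_nonneg hc.le (mul_nonneg (levelCutoff_nonneg _ _ _) (h_nonneg k _))

theorem mul_levelCutoff_eq_zero {f : S → ℝ} {K δ : ℝ} (hδ : 0 < δ) (z : S × ℝ≥0)
    (hz : z ∉ levelsUpTo S (K + δ)) : f z.1 * levelCutoff K δ z.2 = 0 := by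
  rw [levelCutoff_eq_zero hδ (not_le.1 hz).le, mul_zero]

theorem Dominated.continuous_mul_levelCutoff {f : S → ℝ} (hf : Dominated h f) (K δ : ℝ) :
    Continuous fun z : S × ℝ≥0 => f z.1 * levelCutoff K δ z.2 :=
  (hf.continuous.comp continuous_fst).mul ((continuous_levelCutoff K δ).comp continuous_snd)

theorem Dominated.mul_levelCutoff_nonneg {f : S → ℝ} (hf : Dominated h f) (K δ : ℝ)
    (z : S × ℝ≥0) : 0 ≤ f z.1 * levelCutoff K δ z.2 :=
  mul_nonneg (hf.nonneg _) (levelCutoff_nonneg _ _ _)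

theorem Dominated.mul_levelCutoff_le {f : S → ℝ} (hf : Dominated h f) (K δ : ℝ)
    (z : S × ℝ≥0) : f z.1 * levelCutoff K δ z.2 ≤ f z.1 :=
  mul_le_of_le_one_right (hf.nonneg _) (levelCutoff_le_one _ _ _)

theorem Dominated.integrable_mul_levelCutoff (h_nonneg : ∀ k x, 0 ≤ h k x) {f : S → ℝ}
    (hf : Dominated h f) (K : ℝ) {δ : ℝ} (hδ : 0 < δ) (μ : LevelMeasure h) :
    Integrable (fun z : S × ℝ≥0 => f z.1 * levelCutoff K δ z.2) μ.1 := by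
  obtain ⟨k, c, hc, hle⟩ := hf.le
  exact LevelMeasure.integrable_of_le h_nonneg μ
    (hf.continuous_mul_levelCutoff K δ).aestronglyMeasurable (hf.mul_levelCutoff_nonneg K δ)
    (fun z => (hf.mul_levelCutoff_le K δ z).trans (hle z.1))
    (mul_levelCutoff_eq_zero hδ)

theorem Dominated.continuous_integral_mul_levelCutoff (h_nonneg : ∀ k x, 0 ≤ h k x) {f : S → ℝ}
    (hf : Dominated h f) (K : ℝ) {δ : ℝ} (hδ : 0 < δ) :
    Continuous fun μ : LevelMeasure h => ∫ z, f z.1 * levelCutoff K δ z.2 ∂μ.1 := by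
  obtain ⟨k, c, hc, hle⟩ := hf.le
  exact LevelMeasure.continuous_integral_of_le h_nonneg (hf.continuous_mul_levelCutoff K δ)
    (hf.mul_levelCutoff_nonneg K δ) hc (fun z => (hf.mul_levelCutoff_le K δ z).trans (hle z.1))
    (mul_levelCutoff_eq_zero hδ)

/-- The measure `K⁻¹ ∫ φ(u) μ(· × du)` on `S`, where `φ` is the cutoff at level `K`. -/
noncomputable def levelAverageMeasure (K : ℝ) (μ : Measure (S × ℝ≥0)) : Measure S :=
  (μ.withDensity fun z => ENNReal.ofReal (levelCutoff K 1 z.2 / K)).map Prod.fst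

theorem measurable_levelCutoff_div (K : ℝ) :
    Measurable fun z : S × ℝ≥0 => ENNReal.ofReal (levelCutoff K 1 z.2 / K) :=
  ENNReal.measurable_ofReal.comp
    (((continuous_levelCutoff K 1).measurable.comp measurable_snd).div_const K)

theorem lintegral_levelAverageMeasure (K : ℝ) (μ : Measure (S × ℝ≥0)) {f : S → ℝ≥0∞}
    (hf : Measurable f) : ∫⁻ x, f x ∂(levelAverageMeasure K μ) =
      ∫⁻ z, ENNReal.ofReal (levelCutoff K 1 z.2 / K) * f z.1 ∂μ := by
  rw [levelAverageMeasure, lintegral_map hf measurable_fst]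
  exact lintegral_withDensity_eq_lintegral_mul _ (measurable_levelCutoff_div K)
    (hf.comp measurable_fst)

theorem integral_levelAverageMeasure {K : ℝ} (hK : 0 < K) (μ : Measure (S × ℝ≥0)) {f : S → ℝ}
    (hf : Continuous f) : ∫ x, f x ∂(levelAverageMeasure K μ) =
      ∫ z, f z.1 * levelCutoff K 1 z.2 / K ∂μ := by
  rw [levelAverageMeasure, integral_map measurable_fst.aemeasurable hf.aestronglyMeasurable,
    integral_withDensity_eq_integral_toReal_smul (measurable_levelCutoff_div K)
      (ae_of_all _ fun z => ENNReal.ofReal_lt_top)]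
  refine integral_congr_ae (ae_of_all _ fun z => ?_)
  simp only [smul_eq_mul]
  rw [ENNReal.toReal_ofReal (div_nonneg (levelCutoff_nonneg _ _ _) hK.le)]
  ring

/-- `levelAverageMeasure` as a map `M(S × [0, ∞)) → M(S)`. -/
noncomputable def levelAverage {K : ℝ} (hK : 0 < K) (μ : LevelMeasure h) : LocMeasure h :=
  ⟨levelAverageMeasure K μ.1, fun k => by
    refine (lintegral_levelAverageMeasure K μ.1 (ENNReal.measurable_ofReal.comp
      (h k).continuous.measurable)).trans_lt ?_
    have hle : ∀ z : S × ℝ≥0, ENNReal.ofReal (levelCutoff K 1 z.2 / K) * ENNReal.ofReal (h k z.1) ≤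
        (levelsUpTo S (K + 1)).indicator
          (fun z => ENNReal.ofReal (1 / K) * ENNReal.ofReal (h k z.1)) z := by
      intro z
      by_cases hz : z ∈ levelsUpTo S (K + 1)
      · rw [Set.indicator_of_mem hz]
        gcongr
        exact levelCutoff_le_one _ _ _
      · rw [levelCutoff_eq_zero one_pos (not_le.1 hz).le]
        simp
    refine (lintegral_mono hle).trans_lt ?_
    rw [lintegral_indicator (measurableSet_levelsUpTo S _)]
    refine (lintegral_const_mul _
      (ENNReal.measurable_ofReal.comp ((h k).continuous.measurable.comp measurable_fst))).trans_lt ?_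
    exact ENNReal.mul_lt_top ENNReal.ofReal_lt_top (μ.2 k _ (by linarith))⟩

theorem integral_levelAverage {K : ℝ} (hK : 0 < K) (μ : LevelMeasure h) {f : S → ℝ}
    (hf : Continuous f) : ∫ x, f x ∂(levelAverage hK μ).1 =
      ∫ z, f z.1 / K * levelCutoff K 1 z.2 ∂μ.1 := by
  refine (integral_levelAverageMeasure hK μ.1 hf).trans ?_
  refine integral_congr_ae (ae_of_all _ fun z => ?_)
  simp only
  ring

/-- Testing the average against `g h_k` is testing `μ` against `(g φ / K) h_k`, where `g φ / K` is
continuous with bounded level support. This is what the continuous cutoff buys over the indicator of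
`[0, K]`. -/
theorem continuous_levelAverage {K : ℝ} (hK : 0 < K) :
    Continuous (levelAverage hK : LevelMeasure h → LocMeasure h) := by
  refine continuous_induced_rng.2 (continuous_pi fun p => ?_)
  have := LevelMeasure.continuous_integral_mul (h := h) p.1
    (g := fun z => p.2 z.1 / K * levelCutoff K 1 z.2)
    (((p.2.continuous.comp continuous_fst).div_const K).mul
      ((continuous_levelCutoff K 1).comp continuous_snd)) (B := ‖p.2‖ / K) (fun z => ?_)
    (K := K + 1) fun z hz => by rw [levelCutoff_eq_zero one_pos (not_le.1 hz).le, mul_zero]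
  · refine this.congr fun μ => ?_
    refine Eq.trans ?_ (integral_levelAverage hK μ (p.2.continuous.mul (h p.1).continuous)).symm
    refine integral_congr_ae (ae_of_all _ fun z => ?_)
    simp only [Pi.mul_apply]
    ring
  · rw [abs_mul, abs_div, abs_of_pos hK, abs_of_nonneg (levelCutoff_nonneg K 1 z.2)]
    refine (mul_le_of_le_one_right (by positivity) (levelCutoff_le_one _ _ _)).trans ?_
    exact div_le_div_of_nonneg_right (p.2.norm_coe_le_norm z.1) hK.le

end LevelIntegrals

end

section

/-! ### Gluing the weighted measures -/

section Glue

variable {S : Type*} [TopologicalSpace S] [MeasurableSpace S]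

/-- The strictly positive weight `∑ 2⁻¹ ^ (k + 1) h_k`. -/
noncomputable def totalWeight (h : ℕ → S →ᵇ ℝ) : S → ℝ≥0∞ :=
  ∑' k : ℕ, (2⁻¹ : ℝ≥0∞) ^ (k + 1) • fun x => ENNReal.ofReal (h k x)

/-- The measure `ν` whose weighted versions `h_k ν` are the given `m k`, if these are compatible. -/
noncomputable def glueMeasure (h : ℕ → S →ᵇ ℝ) (m : ℕ → Measure S) : Measure S :=
  (Measure.sum fun k : ℕ => (2⁻¹ : ℝ≥0∞) ^ (k + 1) • m k).withDensity
    fun x => (totalWeight h x)⁻¹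

variable {h : ℕ → S →ᵇ ℝ}

theorem totalWeight_apply (x : S) :
    totalWeight h x = ∑' k : ℕ, (2⁻¹ : ℝ≥0∞) ^ (k + 1) * ENNReal.ofReal (h k x) := by
  rw [totalWeight, ENNReal.tsum_apply]
  rfl

theorem totalWeight_ne_zero (h_pos : ∀ x, ∃ k, 0 < h k x) (x : S) : totalWeight h x ≠ 0 := by
  obtain ⟨k, hk⟩ := h_pos x
  rw [totalWeight_apply, Ne, ENNReal.tsum_eq_zero]
  push Not
  exact ⟨k, mul_ne_zero (pow_ne_zero _ (by simp)) (by simpa using hk)⟩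

theorem totalWeight_ne_top (h_le_one : ∀ k x, h k x ≤ 1) (x : S) : totalWeight h x ≠ ∞ := by
  rw [totalWeight_apply]
  refine ne_top_of_le_ne_top ?_ (ENNReal.tsum_le_tsum (g := fun k : ℕ => (2⁻¹ : ℝ≥0∞) ^ (k + 1))
    fun k => mul_le_of_le_one_right' (ENNReal.ofReal_le_one.2 (h_le_one k x)))
  rw [ENNReal.tsum_geometric_add_one, ENNReal.one_sub_inv_two, inv_inv]
  exact ENNReal.mul_ne_top (by simp) (by simp)

variable [OpensMeasurableSpace S]

theorem measurable_ofReal_weight (k : ℕ) : Measurable fun x => ENNReal.ofReal (h k x) :=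
  ENNReal.measurable_ofReal.comp (h k).continuous.measurable

theorem measurable_totalWeight : Measurable (totalWeight h) := by
  rw [show totalWeight h = fun x => _ from funext totalWeight_apply]
  exact Measurable.tsum fun k => (measurable_ofReal_weight k).const_mul _

theorem withDensity_totalWeight (m : Measure S) : m.withDensity (totalWeight h) =
    Measure.sum fun k : ℕ => (2⁻¹ : ℝ≥0∞) ^ (k + 1) •
      m.withDensity fun x => ENNReal.ofReal (h k x) := by
  rw [totalWeight, withDensity_tsum fun k => (measurable_ofReal_weight k).const_smul _]
  simp_rw [withDensity_smul _ (measurable_ofReal_weight _)]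

theorem withDensity_totalWeight_inv (h_le_one : ∀ k x, h k x ≤ 1)
    (h_pos : ∀ x, ∃ k, 0 < h k x) (m : Measure S) :
    (m.withDensity (totalWeight h)).withDensity (fun x => (totalWeight h x)⁻¹) = m :=
  withDensity_inv_same measurable_totalWeight (ae_of_all _ (totalWeight_ne_zero h_pos))
    (ae_of_all _ (totalWeight_ne_top h_le_one))

/-- Densities commute, so compatibility turns `h_j ∑ 2⁻¹ ^ (k + 1) m_k` into `∑ 2⁻¹ ^ (k + 1) h_k
m_j`, which is the total weight times `m_j`; dividing by the total weight leaves `m_j`. -/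
theorem glueMeasure_withDensity_weight (h_le_one : ∀ k x, h k x ≤ 1)
    (h_pos : ∀ x, ∃ k, 0 < h k x) (m : ℕ → Measure S)
    (hm : ∀ j k, (m k).withDensity (fun x => ENNReal.ofReal (h j x)) =
      (m j).withDensity fun x => ENNReal.ofReal (h k x)) (j : ℕ) :
    (glueMeasure h m).withDensity (fun x => ENNReal.ofReal (h j x)) = m j := by
  have hi : Measurable fun x => (totalWeight h x)⁻¹ := measurable_totalWeight.inv
  rw [glueMeasure, ← withDensity_mul _ hi (measurable_ofReal_weight j), mul_comm,
    withDensity_mul _ (measurable_ofReal_weight j) hi, withDensity_sum]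
  simp_rw [withDensity_smul_measure, hm j]
  rw [← withDensity_totalWeight, withDensity_totalWeight_inv h_le_one h_pos]

theorem glueMeasure_self (h_le_one : ∀ k x, h k x ≤ 1)
    (h_pos : ∀ x, ∃ k, 0 < h k x) (ν : Measure S) :
    glueMeasure h (fun k => ν.withDensity fun x => ENNReal.ofReal (h k x)) = ν := by
  rw [glueMeasure, ← withDensity_totalWeight, withDensity_totalWeight_inv h_le_one h_pos]

/-- The finite measure `h_k ν`. -/
noncomputable def LocMeasure.weighted (ν : LocMeasure h) (k : ℕ) : FiniteMeasure S :=
  ⟨ν.1.withDensity fun x => ENNReal.ofReal (h k x), ⟨by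
    rw [withDensity_apply _ MeasurableSet.univ, Measure.restrict_univ]; exact ν.2 k⟩⟩

theorem LocMeasure.ext_weighted (h_le_one : ∀ k x, h k x ≤ 1) (h_pos : ∀ x, ∃ k, 0 < h k x)
    {ν ν' : LocMeasure h} (H : ∀ k, (ν.weighted k : Measure S) = ν'.weighted k) : ν = ν' := by
  refine Subtype.ext ?_
  rw [← glueMeasure_self h_le_one h_pos ν.1, ← glueMeasure_self h_le_one h_pos ν'.1]
  exact congrArg _ (funext H)

theorem integral_withDensity_weight (h_nonneg : ∀ k x, 0 ≤ h k x) (ν : Measure S) (k : ℕ)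
    (g : S → ℝ) : ∫ x, g x ∂(ν.withDensity fun x => ENNReal.ofReal (h k x)) =
      ∫ x, g x * h k x ∂ν := by
  rw [integral_withDensity_eq_integral_toReal_smul (measurable_ofReal_weight k)
    (ae_of_all _ fun z => ENNReal.ofReal_lt_top)]
  refine integral_congr_ae (ae_of_all _ fun x => ?_)
  simp only [smul_eq_mul, ENNReal.toReal_ofReal (h_nonneg k x)]
  ring

theorem integral_weighted (h_nonneg : ∀ k x, 0 ≤ h k x) (ν : LocMeasure h) (k : ℕ)
    (g : S → ℝ) : ∫ x, g x ∂(ν.weighted k : Measure S) = ∫ x, g x * h k x ∂ν.1 :=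
  integral_withDensity_weight h_nonneg ν.1 k g

end Glue

/-! ### Compact sets of locally finite measures -/

section Compact

variable {S : Type*} [TopologicalSpace S] [PolishSpace S] [MeasurableSpace S] [BorelSpace S]
  {h : ℕ → S →ᵇ ℝ}

/-- Along an ultrafilter each `h_k ν` converges to some `m k` in its compact set. The symmetry of
`h_j h_k ν` in `j` and `k` passes to the limit, so the `m k` are compatible and glue to a limit
point. -/
theorem LocMeasure.isCompact_setOf_weighted_mem (h_nonneg : ∀ k x, 0 ≤ h k x)
    (h_le_one : ∀ k x, h k x ≤ 1) (h_pos : ∀ x, ∃ k, 0 < h k x) {𝒦 : ℕ → Set (FiniteMeasure S)}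
    (h𝒦 : ∀ k, IsCompact (𝒦 k)) : IsCompact {ν : LocMeasure h | ∀ k, ν.weighted k ∈ 𝒦 k} := by
  refine isCompact_iff_ultrafilter_le_nhds'.2 fun U hU => ?_
  have hlim : ∀ k, ∃ m ∈ 𝒦 k, Tendsto (fun ν : LocMeasure h => ν.weighted k) U (𝓝 m) := fun k =>
    (h𝒦 k).ultrafilter_le_nhds' (U.map fun ν : LocMeasure h => ν.weighted k) (by
      refine Filter.mem_of_superset (f := (U : Filter (LocMeasure h))) hU fun ν hν => ?_
      exact hν k)
  choose m hm𝒦 hm using hlim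
  have hint : ∀ k (g : S →ᵇ ℝ), Tendsto (fun ν : LocMeasure h => ∫ x, g x * h k x ∂ν.1) U
      (𝓝 (∫ x, g x ∂(m k : Measure S))) := fun k g => by
    have := FiniteMeasure.tendsto_iff_forall_integral_tendsto.1 (hm k) g
    exact this.congr fun ν => integral_weighted h_nonneg ν k g
  have hfin : ∀ j k, IsFiniteMeasure
      ((m k : Measure S).withDensity fun x => ENNReal.ofReal (h j x)) := fun j k =>
    isFiniteMeasure_withDensity_ofReal
      (Integrable.of_bound (h j).continuous.aestronglyMeasurable ‖h j‖
        (ae_of_all _ (h j).norm_coe_le_norm)).2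
  have hcomp : ∀ j k, (m k : Measure S).withDensity (fun x => ENNReal.ofReal (h j x)) =
      (m j : Measure S).withDensity fun x => ENNReal.ofReal (h k x) := by
    intro j k
    have := hfin j k
    have := hfin k j
    refine ext_of_forall_integral_eq_of_IsFiniteMeasure fun g => ?_
    rw [integral_withDensity_weight h_nonneg, integral_withDensity_weight h_nonneg]
    refine tendsto_nhds_unique (hint k (g * h j)) ((hint j (g * h k)).congr fun ν => ?_)
    refine integral_congr_ae (ae_of_all _ fun x => ?_)
    simp only [BoundedContinuousFunction.coe_mul, Pi.mul_apply]
    ring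
  have hglue := glueMeasure_withDensity_weight h_le_one h_pos (fun k => (m k : Measure S)) hcomp
  let ν : LocMeasure h := ⟨glueMeasure h fun k => (m k : Measure S), fun k => by
    rw [← setLIntegral_univ, ← withDensity_apply _ MeasurableSet.univ, hglue k]
    exact measure_lt_top _ _⟩
  have hν : ∀ k, ν.weighted k = m k := fun k => Subtype.ext (hglue k)
  refine ⟨ν, fun k => (hν k).symm ▸ hm𝒦 k, ?_⟩
  change Tendsto id (U : Filter (LocMeasure h)) (𝓝 ν)
  rw [(⟨rfl⟩ : IsInducing (fun (ν : LocMeasure h) (p : ℕ × (S →ᵇ ℝ)) =>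
    ∫ x, p.2 x * h p.1 x ∂ν.1)).tendsto_nhds_iff, tendsto_pi_nhds]
  rintro ⟨k, g⟩
  have := hint k g
  rw [← hν k, integral_weighted h_nonneg] at this
  exact this

/-- These functions express tightness through continuous test functions decreasing to `0`. The
cutoff `v q m` is a product over the first `m` points of a dense sequence; each factor vanishes
within `1 / (q + 1)` of its point and is `1` beyond `2 / (q + 1)`. A point where `v q (m q) ≠ 1` is
thus near one of finitely many centres, and if this holds at all fine scales the point lies in a
closed totally bounded set. -/
theorem exists_antitone_cutoffs (S : Type*) [TopologicalSpace S] [PolishSpace S] :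
    ∃ v : ℕ → ℕ → S → ℝ, (∀ q m, Continuous (v q m)) ∧ (∀ q m x, 0 ≤ v q m x) ∧
      (∀ q m x, v q m x ≤ 1) ∧ (∀ q x, Antitone fun m => v q m x) ∧
      (∀ q x, Tendsto (fun m => v q m x) atTop (𝓝 0)) ∧
      ∀ m : ℕ → ℕ, ∃ K : ℕ → Set S, (∀ i, IsCompact (K i)) ∧
        ∀ i, ∀ x ∉ K i, ∃ q, v (i + 1 + q) (m (i + 1 + q)) x = 1 := by
  rcases isEmpty_or_nonempty S with hS | hS
  · exact ⟨fun _ _ _ => 0, fun _ _ => continuous_const, fun _ _ _ => le_rfl,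
      fun _ _ _ => zero_le_one, fun _ x => isEmptyElim x, fun _ x => isEmptyElim x,
      fun m => ⟨fun _ => Set.univ, fun _ => isCompact_univ, fun _ x => isEmptyElim x⟩⟩
  let := TopologicalSpace.upgradeIsCompletelyMetrizable S
  let y : ℕ → S := TopologicalSpace.denseSeq S
  let u : ℕ → ℕ → S → ℝ := fun q j x => max 0 (min 1 (dist x (y j) * (q + 1) - 1))
  have hu0 : ∀ q j x, 0 ≤ u q j x := fun _ _ _ => le_max_left _ _
  have hu1 : ∀ q j x, u q j x ≤ 1 := fun _ _ _ => max_le zero_le_one (min_le_left _ _)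
  have hanti : ∀ q x, Antitone fun m => ∏ j ∈ Finset.range m, u q j x := fun q x =>
    antitone_nat_of_succ_le fun m => by
      rw [Finset.prod_range_succ]
      exact mul_le_of_le_one_right (Finset.prod_nonneg fun j _ => hu0 q j x) (hu1 q m x)
  refine ⟨fun q m x => ∏ j ∈ Finset.range m, u q j x, fun q m => ?_,
    fun q m x => Finset.prod_nonneg fun j _ => hu0 q j x,
    fun q m x => Finset.prod_le_one (fun j _ => hu0 q j x) fun j _ => hu1 q j x, hanti,
    fun q x => ?_, fun m => ?_⟩
  · exact continuous_finsetProd _ fun j _ => by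
      simp only [u]
      fun_prop
  · have hq : (0 : ℝ) < 1 / ((q : ℝ) + 1) := by positivity
    obtain ⟨j, hj⟩ := (TopologicalSpace.denseRange_denseSeq S).exists_dist_lt x hq
    have hzero : u q j x = 0 := by
      have : dist x (y j) * (q + 1) < 1 := by
        rwa [← lt_div_iff₀ (by positivity)]
      exact max_eq_left ((min_le_right _ _).trans (by linarith))
    refine tendsto_const_nhds.congr' ?_
    filter_upwards [eventually_gt_atTop j] with m hm
    exact (Finset.prod_eq_zero (Finset.mem_range.2 hm) hzero).symm
  · let B : ℕ → Set S := fun q => ⋃ j ∈ Finset.range (m q), Metric.closedBall (y j) (2 / (q + 1))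
    -- Starting at scale `i + 1` makes the later bounds `2 ^ (-(i + 1 + q))` sum to `2 ^ (-i)`, and
    -- leaves index `0` free for the total mass.
    refine ⟨fun i => ⋂ q, B (i + 1 + q), fun i => ?_, fun i x hx => ?_⟩
    · refine TotallyBounded.isCompact_of_isClosed ?_ (isClosed_iInter fun q =>
        Set.Finite.isClosed_biUnion (Finset.finite_toSet _) fun j _ => Metric.isClosed_closedBall)
      refine Metric.totallyBounded_iff.2 fun ε hε => ?_
      obtain ⟨q, hq⟩ := exists_nat_gt (2 / ε)
      refine ⟨y '' (Finset.range (m (i + 1 + q))), (Finset.finite_toSet _).image _, ?_⟩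
      refine (Set.iInter_subset _ q).trans ?_
      rw [Set.biUnion_image]
      refine Set.iUnion₂_mono fun j _ => Metric.closedBall_subset_ball ?_
      push_cast
      rw [div_lt_iff₀ (by positivity)]
      rw [div_lt_iff₀ hε] at hq
      nlinarith [mul_nonneg hε.le (Nat.cast_nonneg (α := ℝ) i)]
    · simp only [Set.mem_iInter, not_forall] at hx
      obtain ⟨q, hq⟩ := hx
      refine ⟨q, Finset.prod_eq_one fun j hj => ?_⟩
      have hd : ¬ dist x (y j) ≤ 2 / ((i + 1 + q : ℕ) + 1 : ℝ) := fun hd =>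
        hq (Set.mem_biUnion hj (Metric.mem_closedBall.2 hd))
      rw [not_le, div_lt_iff₀ (by positivity)] at hd
      have : 1 ≤ dist x (y j) * ((i + 1 + q : ℕ) + 1 : ℝ) - 1 := by linarith
      simp only [u, min_eq_left this]
      exact max_eq_right zero_le_one

/-- Continuous functions `f` with `0 ≤ f ≤ h_k` for some `k`. -/
structure SubWeight (h : ℕ → S →ᵇ ℝ) (f : S → ℝ) : Prop where
  continuous : Continuous f
  nonneg : ∀ x, 0 ≤ f x
  le : ∃ k, ∀ x, f x ≤ h k x

theorem SubWeight.dominated {f : S → ℝ} (hf : SubWeight h f) : Dominated h f :=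
  ⟨hf.continuous, hf.nonneg, hf.le.imp fun _ hk => ⟨1, one_pos, fun x => by simpa using hk x⟩⟩

theorem SubWeight.le_one (h_le_one : ∀ k x, h k x ≤ 1) {f : S → ℝ} (hf : SubWeight h f) (x : S) :
    f x ≤ 1 :=
  (hf.le.choose_spec x).trans (h_le_one _ x)

/-- Relative compactness is encoded by countably many integral bounds. For the index `(k, q)`, the
case `q = 0` bounds the mass of `h_k ν`, and `q > 0` bounds its mass away from finitely many balls
of scale `q`. Monotone decrease to `0` in `m` lets `m` be chosen by a Dini argument. -/
theorem LocMeasure.exists_tightness_family (h_nonneg : ∀ k x, 0 ≤ h k x)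
    (h_le_one : ∀ k x, h k x ≤ 1) (h_pos : ∀ x, ∃ k, 0 < h k x) :
    ∃ G : ℕ × ℕ → ℕ → S → ℝ, (∀ i m, SubWeight h (G i m)) ∧ (∀ i x, Antitone fun m => G i m x) ∧
      (∀ i x, Tendsto (fun m => G i m x) atTop (𝓝 0)) ∧
      ∀ m : ℕ × ℕ → ℕ, ∃ C : Set (LocMeasure h), IsCompact C ∧
        ∀ ν : LocMeasure h, (∀ i, ∫ x, G i (m i) x ∂ν.1 ≤ (1 / 2) ^ i.2) → ν ∈ C := by
  obtain ⟨v, hvc, hv0, hv1, hva, hvt, hvK⟩ := exists_antitone_cutoffs S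
  -- At `q = 0` the bound `∫ h_k / (m + 1) dν ≤ 1` says that `h_k ν` has mass at most `m + 1`.
  let w : ℕ → ℕ → S → ℝ := fun q m => if q = 0 then fun _ => 1 / ((m : ℝ) + 1) else v q m
  have hwc : ∀ q m, Continuous (w q m) := fun q m => by
    by_cases hq : q = 0
    · simp only [w, hq, if_true]; exact continuous_const
    · simp only [w, hq, if_false]; exact hvc q m
  have hw0 : ∀ q m x, 0 ≤ w q m x := fun q m x => by
    by_cases hq : q = 0
    · simp only [w, hq, if_true]; positivity
    · simp only [w, hq, if_false]; exact hv0 q m x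
  have hw1 : ∀ q m x, w q m x ≤ 1 := fun q m x => by
    by_cases hq : q = 0
    · simp only [w, hq, if_true]
      rw [div_le_one (by positivity)]
      linarith [Nat.cast_nonneg (α := ℝ) m]
    · simp only [w, hq, if_false]; exact hv1 q m x
  have hwa : ∀ q x, Antitone fun m => w q m x := fun q x => by
    by_cases hq : q = 0
    · simp only [w, hq, if_true]
      intro a b hab
      have : (a : ℝ) ≤ b := by exact_mod_cast hab
      simp only
      gcongr
    · simp only [w, hq, if_false]; exact hva q x
  have hwt : ∀ q x, Tendsto (fun m => w q m x) atTop (𝓝 0) := fun q x => by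
    by_cases hq : q = 0
    · simp only [w, hq, if_true]; exact tendsto_one_div_add_atTop_nhds_zero_nat
    · simp only [w, hq, if_false]; exact hvt q x
  have hsub : ∀ (i : ℕ × ℕ) m, SubWeight h fun x => h i.1 x * w i.2 m x := fun i m =>
    ⟨(h i.1).continuous.mul (hwc _ _), fun x => mul_nonneg (h_nonneg _ _) (hw0 _ _ _), i.1,
      fun x => mul_le_of_le_one_right (h_nonneg _ _) (hw1 _ _ _)⟩
  refine ⟨fun i m x => h i.1 x * w i.2 m x, hsub,
    fun i x a b hab => mul_le_mul_of_nonneg_left (hwa i.2 x hab) (h_nonneg _ _),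
    fun i x => by simpa using (hwt i.2 x).const_mul (h i.1 x), fun m => ?_⟩
  choose K hKc hK using fun k : ℕ => hvK fun q => m (k, q)
  refine ⟨_, LocMeasure.isCompact_setOf_weighted_mem h_nonneg h_le_one h_pos fun k =>
    isCompact_setOfPred_finiteMeasure_mass_le_compl_isCompact_le (u := fun i : ℕ => (1 / 2) ^ i)
      (m (k, 0) + 1 : ℝ≥0) (tendsto_pow_atTop_nhds_zero_of_lt_one (by positivity) (by
        rw [div_lt_one (by positivity)]; exact one_lt_two)) (hKc k)
      (Or.inl inferInstance), fun ν hν k => ⟨?_, fun i => ?_⟩⟩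
  · have h0 := hν (k, 0)
    simp only [w, if_true, pow_zero] at h0
    rw [integral_mul_const, mul_one_div, div_le_one (by positivity)] at h0
    rw [← NNReal.coe_le_coe]
    refine le_trans (le_of_eq ?_) h0
    have h1 := integral_weighted h_nonneg ν k fun _ => 1
    simp only [one_mul, integral_const, smul_eq_mul, mul_one] at h1
    exact h1
  · rw [← ENNReal.coe_le_coe, FiniteMeasure.ennreal_coeFn_eq_coeFn_toMeasure]
    have hcover : (K k i)ᶜ ⊆ ⋃ q, {x | v (i + 1 + q) (m (k, i + 1 + q)) x = 1} := fun x hx => by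
      obtain ⟨q, hq⟩ := hK k i x hx
      exact Set.mem_iUnion.2 ⟨q, hq⟩
    have hpiece : ∀ q, (ν.weighted k : Measure S) {x | v (i + 1 + q) (m (k, i + 1 + q)) x = 1} ≤
        ENNReal.ofReal ((1 / 2) ^ (i + 1 + q)) := by
      intro q
      have hms : MeasurableSet {x | v (i + 1 + q) (m (k, i + 1 + q)) x = 1} :=
        (isClosed_eq (hvc _ _) continuous_const).measurableSet
      have hq := hν (k, i + 1 + q)
      have hne : i + 1 + q ≠ 0 := by omega
      simp only [w, hne, if_false] at hq
      refine le_trans ?_ (ENNReal.ofReal_le_ofReal hq)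
      have hd := hsub (k, i + 1 + q) (m (k, i + 1 + q))
      simp only [w, hne, if_false] at hd
      rw [ofReal_integral_eq_lintegral_ofReal (hd.dominated.integrable h_nonneg ν)
        (ae_of_all _ hd.nonneg)]
      refine (withDensity_apply _ hms).trans_le ?_
      rw [← lintegral_indicator hms]
      refine lintegral_mono fun x => ?_
      by_cases hx : x ∈ {x | v (i + 1 + q) (m (k, i + 1 + q)) x = 1}
      · have hx' : v (i + 1 + q) (m (k, i + 1 + q)) x = 1 := hx
        rw [Set.indicator_of_mem hx, hx', mul_one]
      · rw [Set.indicator_of_notMem hx]; exact zero_le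
    refine (measure_mono hcover).trans ((measure_iUnion_le _).trans
      ((ENNReal.tsum_le_tsum hpiece).trans ?_))
    rw [← ENNReal.ofReal_tsum_of_nonneg (fun q => by positivity)]
    · rw [ENNReal.coe_nnreal_eq]
      refine ENNReal.ofReal_le_ofReal (le_of_eq ?_)
      simp_rw [pow_add, tsum_mul_left]
      rw [tsum_geometric_two]
      push_cast
      ring
    · simp_rw [pow_add]
      exact (summable_geometric_two).mul_left _

/-- A countable family of test functions which separates the points of `M(S)`. -/
theorem LocMeasure.exists_separating_family (h_nonneg : ∀ k x, 0 ≤ h k x)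
    (h_le_one : ∀ k x, h k x ≤ 1) (h_pos : ∀ x, ∃ k, 0 < h k x) :
    ∃ T : ℕ → S → ℝ, (∀ j, SubWeight h (T j)) ∧
      ∀ ν ν' : LocMeasure h, (∀ j, ∫ x, T j x ∂ν.1 = ∫ x, T j x ∂ν'.1) → ν = ν' := by
  let B := TopologicalSpace.countableBasis S
  have : Countable B := (TopologicalSpace.countable_countableBasis S).to_subtype
  -- Finite intersections of complements of basic open sets form a countable π-system of closed sets
  -- generating the Borel sets. Being closed, they have continuous outer approximations; `J = ∅`
  -- yields the total mass.
  let F : Finset B → Set S := fun J => ⋂ b ∈ J, (b : Set S)ᶜ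
  have hF : ∀ J, IsClosed (F J) := fun J => isClosed_biInter fun b _ =>
    ((TopologicalSpace.isBasis_countableBasis S).isOpen b.2).isClosed_compl
  let T : ℕ × Finset B × ℕ → S → ℝ := fun p x => ((hF p.2.1).apprSeq p.2.2 x : ℝ) * h p.1 x
  have hT : ∀ p, SubWeight h (T p) := fun p =>
    ⟨(NNReal.continuous_coe.comp ((hF p.2.1).apprSeq p.2.2).continuous).mul (h p.1).continuous,
      fun x => mul_nonneg (NNReal.coe_nonneg _) (h_nonneg _ _), p.1, fun x =>
        mul_le_of_le_one_left (h_nonneg _ _)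
          (by exact_mod_cast HasOuterApproxClosed.apprSeq_apply_le_one (hF p.2.1) p.2.2 x)⟩
  obtain ⟨e, he⟩ := exists_surjective_nat (ℕ × Finset B × ℕ)
  refine ⟨fun j => T (e j), fun j => hT _, fun ν ν' H => ?_⟩
  have H' : ∀ p, ∫ x, T p x ∂ν.1 = ∫ x, T p x ∂ν'.1 := fun p => by
    obtain ⟨j, rfl⟩ := he p
    exact H j
  refine LocMeasure.ext_weighted h_le_one h_pos fun k => ?_
  have hFeq : ∀ J, (ν.weighted k : Measure S) (F J) = (ν'.weighted k : Measure S) (F J) := by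
    intro J
    refine tendsto_nhds_unique
      (HasOuterApproxClosed.tendsto_lintegral_apprSeq (hF J) (ν.weighted k : Measure S))
      ((HasOuterApproxClosed.tendsto_lintegral_apprSeq (hF J) (ν'.weighted k : Measure S)).congr
        fun n => ?_)
    have hval : ∀ ν : LocMeasure h,
        ∫⁻ x, ((hF J).apprSeq n x : ℝ≥0∞) ∂(ν.weighted k : Measure S) =
          ENNReal.ofReal (∫ x, T (k, J, n) x ∂ν.1) := fun ν => by
      rw [← integral_weighted h_nonneg ν k fun x => ((hF J).apprSeq n x : ℝ),
        ofReal_integral_eq_lintegral_ofReal]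
      · simp
      · exact Integrable.of_bound (NNReal.continuous_coe.comp
          ((hF J).apprSeq n).continuous).aestronglyMeasurable 1 (ae_of_all _ fun x => by
            simpa using HasOuterApproxClosed.apprSeq_apply_le_one (hF J) n x)
      · exact ae_of_all _ fun x => NNReal.coe_nonneg _
    rw [hval, hval, H']
  have hgen : (inferInstance : MeasurableSpace S) =
      MeasurableSpace.generateFrom (Set.range F) := by
    rw [BorelSpace.measurable_eq (α := S),
      (TopologicalSpace.isBasis_countableBasis S).borel_eq_generateFrom]
    refine le_antisymm (MeasurableSpace.generateFrom_le fun b hb => ?_)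
      (MeasurableSpace.generateFrom_le ?_)
    · have : MeasurableSet[MeasurableSpace.generateFrom (Set.range F)] (F {⟨b, hb⟩}) :=
        MeasurableSpace.measurableSet_generateFrom ⟨_, rfl⟩
      simp only [F, Finset.mem_singleton, Set.iInter_iInter_eq_left] at this
      exact compl_compl b ▸ this.compl
    · rintro _ ⟨J, rfl⟩
      exact Finset.measurableSet_biInter J fun b _ =>
        (MeasurableSpace.measurableSet_generateFrom b.2).compl
  refine ext_of_generate_finite (Set.range F) hgen ?_ ?_ ?_
  · rintro _ ⟨J, rfl⟩ _ ⟨J', rfl⟩ -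
    classical
    refine ⟨J ∪ J', ?_⟩
    ext x
    simp only [F, Set.mem_iInter, Finset.mem_union, Set.mem_inter_iff]
    constructor
    · exact fun hx => ⟨fun b hb => hx b (Or.inl hb), fun b hb => hx b (Or.inr hb)⟩
    · rintro ⟨h1, h2⟩ b (hb | hb)
      exacts [h1 b hb, h2 b hb]
  · rintro _ ⟨J, rfl⟩
    exact hFeq J
  · simpa [F] using hFeq ∅

end Compact

end

section

/-! ### Functions of a random element with values in a σ-compact set -/

/-- If `Φ` is a continuous injection, then on a σ-compact set every continuous function factors
through `Φ` by a Borel function. -/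
theorem exists_measurable_comp_eq {A B T ι : Type*} [TopologicalSpace A] [TopologicalSpace B]
    [T2Space B] [MeasurableSpace B] [OpensMeasurableSpace B] [TopologicalSpace T]
    [MeasurableSpace T] [BorelSpace T] [Countable ι] {Φ : A → B} (hΦ : Continuous Φ)
    (hinj : Function.Injective Φ) {F : A → T} (hF : Continuous F) {C : ι → Set A}
    (hC : ∀ l, IsCompact (C l)) (t₀ : T) :
    ∃ F' : B → T, Measurable F' ∧ (∀ a ∈ ⋃ l, C l, F' (Φ a) = F a) ∧
      ∀ b, F' b = t₀ ∨ F' b ∈ F '' ⋃ l, C l := by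
  classical
  let F' : B → T := fun b => if hb : ∃ a ∈ ⋃ l, C l, Φ a = b then F hb.choose else t₀
  have hF' : ∀ a ∈ ⋃ l, C l, F' (Φ a) = F a := fun a ha => by
    have hb : ∃ a' ∈ ⋃ l, C l, Φ a' = Φ a := ⟨a, ha, rfl⟩
    simp only [F', dif_pos hb]
    rw [hinj hb.choose_spec.2]
  have hF'' : ∀ b, b ∉ Φ '' (⋃ l, C l) → F' b = t₀ := fun b hb => by
    simp only [F']
    exact dif_neg fun ⟨a, ha, hab⟩ => hb ⟨a, ha, hab⟩
  refine ⟨F', measurable_of_isClosed fun Q hQ => ?_, hF', fun b => ?_⟩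
  swap
  · by_cases hb : b ∈ Φ '' (⋃ l, C l)
    · obtain ⟨a, ha, rfl⟩ := hb
      exact Or.inr ⟨a, ha, (hF' a ha).symm⟩
    · exact Or.inl (hF'' b hb)
  -- Compactness makes this image a countable union of compact, hence closed, sets; no countability
  -- of the topology of `A` is needed.
  have hmeas : ∀ Q' : Set A, IsClosed Q' → MeasurableSet (Φ '' ((⋃ l, C l) ∩ Q')) := fun Q' hQ' => by
    rw [Set.iUnion_inter, Set.image_iUnion]
    exact MeasurableSet.iUnion fun l =>
      (((hC l).inter_right hQ').image hΦ).isClosed.measurableSet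
  have hsplit : F' ⁻¹' Q = Φ '' ((⋃ l, C l) ∩ F ⁻¹' Q) ∪
      ((Φ '' ((⋃ l, C l) ∩ Set.univ))ᶜ ∩ {_b | t₀ ∈ Q}) := by
    ext b
    rw [Set.inter_univ]
    by_cases hb : b ∈ Φ '' (⋃ l, C l)
    · obtain ⟨a, ha, rfl⟩ := hb
      simp only [Set.mem_preimage, hF' a ha, Set.mem_union, Set.mem_inter_iff, Set.mem_compl_iff,
        Set.mem_image_of_mem Φ ha, not_true_eq_false, false_and, or_false]
      exact ⟨fun hq => ⟨a, ⟨ha, hq⟩, rfl⟩, fun ⟨a', ⟨_, hq⟩, haa⟩ => hinj haa ▸ hq⟩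
    · have h1 : b ∉ Φ '' ((⋃ l, C l) ∩ F ⁻¹' Q) := fun h =>
        hb (Set.image_mono Set.inter_subset_left h)
      simp only [Set.mem_preimage, hF'' b hb, Set.mem_union, h1, Set.mem_inter_iff,
        Set.mem_compl_iff, hb, not_false_eq_true, true_and, false_or]
      rfl
  rw [hsplit]
  exact (hmeas _ (hQ.preimage hF)).union ((hmeas _ isClosed_univ).compl.inter (.const _))

/-- Only `Φ (X ω)` is assumed measurable. For vectors of random measures, coordinatewise
measurability need not give Borel measurability in the product topology, so a continuous `F` is
handled by factoring it through `Φ`. -/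
theorem aestronglyMeasurable_comp_of_ae_mem {A B Ω ι : Type*} [TopologicalSpace A]
    [TopologicalSpace B] [T2Space B] [MeasurableSpace B] [OpensMeasurableSpace B] [Countable ι]
    {Φ : A → B} (hΦ : Continuous Φ) (hinj : Function.Injective Φ) {F : A → ℝ} (hF : Continuous F)
    {C : ι → Set A} (hC : ∀ l, IsCompact (C l)) [MeasurableSpace Ω] {P : Measure Ω} {X : Ω → A}
    (hX : Measurable fun ω => Φ (X ω)) (hXC : ∀ᵐ ω ∂P, X ω ∈ ⋃ l, C l) :
    AEStronglyMeasurable (fun ω => F (X ω)) P := by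
  obtain ⟨F', hF'm, hF', -⟩ := exists_measurable_comp_eq hΦ hinj hF hC 0
  refine (hF'm.comp hX).stronglyMeasurable.aestronglyMeasurable.congr ?_
  filter_upwards [hXC] with ω hω using hF' _ hω

/-- On a compact set, a continuous function varies little between points at which finitely many
functions of a separating family nearly agree. -/
theorem exists_finset_forall_abs_sub_lt {A ι : Type*} [TopologicalSpace A] {e : ι → A → ℝ}
    (he : ∀ i, Continuous (e i)) (hsep : ∀ x y, (∀ i, e i x = e i y) → x = y) {B : Set A}
    (hB : IsCompact B) {F : A → ℝ} (hF : Continuous F) {ε : ℝ} (hε : 0 < ε) :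
    ∃ J : Finset (ι × ℕ), ∀ x ∈ B, ∀ y ∈ B,
      (∀ p ∈ J, |e p.1 x - e p.1 y| ≤ 1 / ((p.2 : ℝ) + 1)) → |F x - F y| < ε := by
  -- The bad pairs form a compact set off the diagonal. It is covered by the open sets on which some
  -- `e i` differs by more than `1 / (n + 1)`, and a finite subcover is `J`.
  have hK : IsCompact ((B ×ˢ B) ∩ {z : A × A | ε ≤ |F z.1 - F z.2|}) :=
    (hB.prod hB).inter_right (isClosed_le continuous_const
      ((hF.comp continuous_fst).sub (hF.comp continuous_snd)).abs)
  obtain ⟨J, hJ⟩ := hK.elim_finite_subcover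
    (fun p : ι × ℕ => {z : A × A | 1 / ((p.2 : ℝ) + 1) < |e p.1 z.1 - e p.1 z.2|})
    (fun p => isOpen_lt continuous_const
      (((he p.1).comp continuous_fst).sub ((he p.1).comp continuous_snd)).abs) (by
      rintro ⟨x, y⟩ ⟨-, hxy : ε ≤ |F x - F y|⟩
      have hne : x ≠ y := by
        rintro rfl
        rw [sub_self, abs_zero] at hxy
        linarith
      obtain ⟨i, hi⟩ : ∃ i, e i x ≠ e i y := by
        by_contra hcon
        push Not at hcon
        exact hne (hsep x y hcon)
      obtain ⟨n, hn⟩ := exists_nat_one_div_lt (abs_pos.2 (sub_ne_zero.2 hi))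
      exact Set.mem_iUnion.2 ⟨(i, n), hn⟩)
  refine ⟨J, fun x hx y hy hxy => ?_⟩
  by_contra hcon
  obtain ⟨p, hp, hlt⟩ := Set.mem_iUnion₂.1 (hJ (show (x, y) ∈ _ from ⟨⟨hx, hy⟩, not_lt.1 hcon⟩))
  exact absurd (hxy p hp) (not_le.2 hlt)

/-- A difference of at least `ε` occurs only if `X` or `Y` leaves `B`, or if some `e p.1` differs by
more than `1 / (p.2 + 1)`. The random variable `R` is at least `1` in all these cases and its mean
is controlled, as in Markov's inequality. Measurable hulls are used because `{X ∉ B}` need not be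
measurable. -/
theorem integral_abs_comp_sub_le {A ι Ω : Type*} [TopologicalSpace A] {e : ι → A → ℝ}
    {B : Set A} (F : A →ᵇ ℝ) {ε : ℝ} (hε : 0 < ε) {J : Finset (ι × ℕ)}
    (hJ : ∀ x ∈ B, ∀ y ∈ B,
      (∀ p ∈ J, |e p.1 x - e p.1 y| ≤ 1 / ((p.2 : ℝ) + 1)) → |F x - F y| < ε)
    [MeasurableSpace Ω] {P : Measure Ω} [IsProbabilityMeasure P] {X Y : Ω → A}
    {a b : ℝ} (ha : 0 ≤ a)
    (hX : P {ω | X ω ∉ B} ≤ ENNReal.ofReal a) (hY : P {ω | Y ω ∉ B} ≤ ENNReal.ofReal a)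
    (hi : ∀ i, Integrable (fun ω => |e i (X ω) - e i (Y ω)|) P)
    (hb : ∀ i, ∫ ω, |e i (X ω) - e i (Y ω)| ∂P ≤ b) :
    ∫ ω, |F (X ω) - F (Y ω)| ∂P ≤
      ε + 2 * ‖F‖ * (2 * a + (∑ p ∈ J, ((p.2 : ℝ) + 1)) * b) := by
  set U := toMeasurable P {ω | X ω ∉ B}
  set V := toMeasurable P {ω | Y ω ∉ B}
  have hU : MeasurableSet U := measurableSet_toMeasurable _ _
  have hV : MeasurableSet V := measurableSet_toMeasurable _ _
  have hUa : P.real U ≤ a := by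
    rw [measureReal_def, measure_toMeasurable]
    exact ENNReal.toReal_le_of_le_ofReal ha hX
  have hVa : P.real V ≤ a := by
    rw [measureReal_def, measure_toMeasurable]
    exact ENNReal.toReal_le_of_le_ofReal ha hY
  have hM : 0 ≤ 2 * ‖F‖ := by positivity
  have hbd : ∀ x y, |F x - F y| ≤ 2 * ‖F‖ := fun x y => by
    have h1 := F.norm_coe_le_norm x
    have h2 := F.norm_coe_le_norm y
    rw [Real.norm_eq_abs] at h1 h2
    linarith [abs_sub (F x) (F y)]
  let R : Ω → ℝ := fun ω => U.indicator (fun _ => (1 : ℝ)) ω + V.indicator (fun _ => (1 : ℝ)) ω +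
    ∑ p ∈ J, ((p.2 : ℝ) + 1) * |e p.1 (X ω) - e p.1 (Y ω)|
  have hUi : Integrable (U.indicator fun _ => (1 : ℝ)) P := (integrable_const _).indicator hU
  have hVi : Integrable (V.indicator fun _ => (1 : ℝ)) P := (integrable_const _).indicator hV
  have hSi : Integrable (fun ω => ∑ p ∈ J, ((p.2 : ℝ) + 1) * |e p.1 (X ω) - e p.1 (Y ω)|) P :=
    integrable_finsetSum _ fun p _ => (hi p.1).const_mul _
  have hR0 : ∀ ω, 0 ≤ U.indicator (fun _ => (1 : ℝ)) ω := fun ω =>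
    Set.indicator_nonneg (fun _ _ => zero_le_one) ω
  have hR1 : ∀ ω, 0 ≤ V.indicator (fun _ => (1 : ℝ)) ω := fun ω =>
    Set.indicator_nonneg (fun _ _ => zero_le_one) ω
  have hR2 : ∀ ω, 0 ≤ ∑ p ∈ J, ((p.2 : ℝ) + 1) * |e p.1 (X ω) - e p.1 (Y ω)| := fun ω =>
    Finset.sum_nonneg fun p _ => by positivity
  have hpt : ∀ ω, |F (X ω) - F (Y ω)| ≤ ε + 2 * ‖F‖ * R ω := by
    intro ω
    by_cases h1 : X ω ∈ B
    · by_cases h2 : Y ω ∈ B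
      · by_cases h3 : ∀ p ∈ J, |e p.1 (X ω) - e p.1 (Y ω)| ≤ 1 / ((p.2 : ℝ) + 1)
        · have := hJ _ h1 _ h2 h3
          have : 0 ≤ 2 * ‖F‖ * R ω :=
            mul_nonneg hM (add_nonneg (add_nonneg (hR0 ω) (hR1 ω)) (hR2 ω))
          linarith
        · push Not at h3
          obtain ⟨p, hp, hlt⟩ := h3
          rw [div_lt_iff₀ (by positivity)] at hlt
          have h4 : ((p.2 : ℝ) + 1) * |e p.1 (X ω) - e p.1 (Y ω)| ≤
              ∑ p ∈ J, ((p.2 : ℝ) + 1) * |e p.1 (X ω) - e p.1 (Y ω)| :=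
            Finset.single_le_sum (f := fun p : ι × ℕ =>
              ((p.2 : ℝ) + 1) * |e p.1 (X ω) - e p.1 (Y ω)|) (fun p _ => by positivity) hp
          have h5 : 1 ≤ R ω := by
            have := hR0 ω
            have := hR1 ω
            simp only [R]
            linarith
          nlinarith [hbd (X ω) (Y ω)]
      · have h5 : 1 ≤ R ω := by
          have hmem : ω ∈ V := subset_toMeasurable P _ h2
          have := hR0 ω
          have := hR2 ω
          simp only [R, Set.indicator_of_mem hmem]
          linarith
        nlinarith [hbd (X ω) (Y ω)]
    · have h5 : 1 ≤ R ω := by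
        have hmem : ω ∈ U := subset_toMeasurable P _ h1
        have := hR1 ω
        have := hR2 ω
        simp only [R, Set.indicator_of_mem hmem]
        linarith
      nlinarith [hbd (X ω) (Y ω)]
  have hRi : Integrable R P := (hUi.add hVi).add hSi
  have hRle : ∫ ω, R ω ∂P ≤ 2 * a + (∑ p ∈ J, ((p.2 : ℝ) + 1)) * b := by
    have hsplit : ∫ ω, R ω ∂P = ∫ ω, U.indicator (fun _ => (1 : ℝ)) ω ∂P +
        ∫ ω, V.indicator (fun _ => (1 : ℝ)) ω ∂P +
          ∫ ω, ∑ p ∈ J, ((p.2 : ℝ) + 1) * |e p.1 (X ω) - e p.1 (Y ω)| ∂P :=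
      (integral_add (hUi.add hVi) hSi).trans (congrArg (· + _) (integral_add hUi hVi))
    rw [hsplit, integral_finsetSum _ fun p _ => (hi p.1).const_mul _, Finset.sum_mul]
    have hs : ∑ p ∈ J, ∫ ω, ((p.2 : ℝ) + 1) * |e p.1 (X ω) - e p.1 (Y ω)| ∂P ≤
        ∑ p ∈ J, ((p.2 : ℝ) + 1) * b := Finset.sum_le_sum fun p _ => by
      rw [integral_const_mul]
      exact mul_le_mul_of_nonneg_left (hb p.1) (by positivity)
    have h1 : ∫ ω, U.indicator (fun _ => (1 : ℝ)) ω ∂P = P.real U := integral_indicator_one hU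
    have h2 : ∫ ω, V.indicator (fun _ => (1 : ℝ)) ω ∂P = P.real V := integral_indicator_one hV
    linarith
  calc ∫ ω, |F (X ω) - F (Y ω)| ∂P ≤ ∫ ω, (ε + 2 * ‖F‖ * R ω) ∂P :=
        integral_mono_of_nonneg (ae_of_all _ fun ω => abs_nonneg _)
          ((integrable_const _).add (hRi.const_mul _)) (ae_of_all _ hpt)
    _ = ε + 2 * ‖F‖ * ∫ ω, R ω ∂P := by
        rw [integral_add (integrable_const _) (hRi.const_mul _), integral_const_mul]
        simp
    _ ≤ _ := by gcongr

/-! ### Sandwich form of the conditional relations -/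

section Sandwich

variable {S : Type*} [TopologicalSpace S] [SecondCountableTopology S] [MeasurableSpace S]
  [OpensMeasurableSpace S] {h : ℕ → S →ᵇ ℝ}

theorem Dominated.integral_levelsUpTo_le (h_nonneg : ∀ k x, 0 ≤ h k x) {f : S → ℝ}
    (hf : Dominated h f) (K : ℝ) {δ : ℝ} (hδ : 0 < δ) (μ : LevelMeasure h) :
    ∫ z in levelsUpTo S K, f z.1 ∂μ.1 ≤ ∫ z, f z.1 * levelCutoff K δ z.2 ∂μ.1 := by
  rw [← integral_indicator (measurableSet_levelsUpTo S K)]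
  refine integral_mono_of_nonneg (ae_of_all _ fun z =>
    Set.indicator_nonneg (fun z _ => hf.nonneg z.1) z)
    (hf.integrable_mul_levelCutoff h_nonneg K hδ μ) (ae_of_all _ fun z => ?_)
  by_cases hz : z ∈ levelsUpTo S K
  · simp only [Set.indicator_of_mem hz, levelCutoff_eq_one hδ hz, mul_one, le_refl]
  · simp only [Set.indicator_of_notMem hz]
    exact hf.mul_levelCutoff_nonneg K δ z

theorem Dominated.integrableOn_levelsUpTo (h_nonneg : ∀ k x, 0 ≤ h k x) {f : S → ℝ}
    (hf : Dominated h f) (K : ℝ) (μ : LevelMeasure h) :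
    IntegrableOn (fun z : S × ℝ≥0 => f z.1) (levelsUpTo S K) μ.1 := by
  obtain ⟨k, c, hc, hle⟩ := hf.le
  exact ((LevelMeasure.integrableOn_h h_nonneg μ k K).const_mul c).mono'
    (hf.continuous.comp continuous_fst).aestronglyMeasurable
    (ae_of_all _ fun z => by rw [Real.norm_of_nonneg (hf.nonneg z.1)]; exact hle z.1)

theorem Dominated.integral_mul_levelCutoff_le (h_nonneg : ∀ k x, 0 ≤ h k x) {f : S → ℝ}
    (hf : Dominated h f) (K : ℝ) {δ : ℝ} (hδ : 0 < δ) (μ : LevelMeasure h) :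
    ∫ z, f z.1 * levelCutoff K δ z.2 ∂μ.1 ≤ ∫ z in levelsUpTo S (K + δ), f z.1 ∂μ.1 := by
  rw [← integral_indicator (measurableSet_levelsUpTo S _)]
  refine integral_mono (hf.integrable_mul_levelCutoff h_nonneg K hδ μ)
    ((hf.integrableOn_levelsUpTo h_nonneg _ μ).integrable_indicator
      (measurableSet_levelsUpTo S _)) fun z => ?_
  by_cases hz : z ∈ levelsUpTo S (K + δ)
  · simp only [Set.indicator_of_mem hz]
    exact hf.mul_levelCutoff_le K δ z
  · simp only [Set.indicator_of_notMem hz]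
    exact (mul_levelCutoff_eq_zero hδ z hz).le

theorem Dominated.tendsto_integral_mul_levelCutoff (h_nonneg : ∀ k x, 0 ≤ h k x) {f : S → ℝ}
    (hf : Dominated h f) (K : ℝ) (μ : LevelMeasure h) :
    Tendsto (fun n : ℕ => ∫ z, f z.1 * levelCutoff K (1 / ((n : ℝ) + 1)) z.2 ∂μ.1) atTop
      (𝓝 (∫ z in levelsUpTo S K, f z.1 ∂μ.1)) := by
  have hδ : ∀ n : ℕ, (0 : ℝ) < 1 / ((n : ℝ) + 1) := fun n => by positivity
  have hδ1 : ∀ n : ℕ, 1 / ((n : ℝ) + 1) ≤ 1 := fun n => by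
    rw [div_le_one (by positivity)]; linarith [Nat.cast_nonneg (α := ℝ) n]
  rw [← integral_indicator (measurableSet_levelsUpTo S K)]
  refine tendsto_integral_of_dominated_convergence
    ((levelsUpTo S (K + 1)).indicator fun z => f z.1)
    (fun n => (hf.continuous_mul_levelCutoff K _).aestronglyMeasurable)
    ((hf.integrableOn_levelsUpTo h_nonneg _ μ).integrable_indicator
      (measurableSet_levelsUpTo S _)) (fun n => ae_of_all _ fun z => ?_)
    (ae_of_all _ fun z => ?_)
  · rw [Real.norm_of_nonneg (hf.mul_levelCutoff_nonneg K _ z)]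
    by_cases hz : z ∈ levelsUpTo S (K + 1)
    · rw [Set.indicator_of_mem hz]
      exact hf.mul_levelCutoff_le K _ z
    · rw [Set.indicator_of_notMem hz]
      refine (mul_levelCutoff_eq_zero (hδ n) z fun (hz' : (z.2 : ℝ) ≤ _) => hz ?_).le
      exact hz'.trans (by linarith [hδ1 n])
  · by_cases hz : z ∈ levelsUpTo S K
    · simp only [Set.indicator_of_mem hz, levelCutoff_eq_one (hδ _) hz, mul_one]
      exact tendsto_const_nhds
    · rw [Set.indicator_of_notMem hz]
      have hz' : (0 : ℝ) < z.2 - K := sub_pos.2 (not_le.1 hz)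
      obtain ⟨N, hN⟩ := exists_nat_one_div_lt hz'
      refine tendsto_const_nhds.congr' ?_
      filter_upwards [eventually_ge_atTop N] with n hn
      have : 1 / ((n : ℝ) + 1) ≤ 1 / ((N : ℝ) + 1) := by gcongr
      rw [levelCutoff_eq_zero (hδ n) (by linarith), mul_zero]

/-- With the sharp bound on levels continuity in `μ` can fail, but the integral is a pointwise limit
of the continuous ones with ramps of width `1 / (n + 1)`. -/
theorem Dominated.measurable_integral_levelsUpTo (h_nonneg : ∀ k x, 0 ≤ h k x) {f : S → ℝ}
    (hf : Dominated h f) (K : ℝ) :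
    Measurable fun μ : LevelMeasure h => ∫ z in levelsUpTo S K, f z.1 ∂μ.1 :=
  measurable_of_tendsto_metrizable
    (fun n : ℕ => (hf.continuous_integral_mul_levelCutoff h_nonneg K
      (by positivity : (0 : ℝ) < 1 / ((n : ℝ) + 1))).measurable)
    (tendsto_pi_nhds.2 fun μ => hf.tendsto_integral_mul_levelCutoff h_nonneg K μ)

/-! ### From the conditional relations to the sandwich bounds. -/

variable {Ω : Type*} [MeasurableSpace Ω]

/-- Integrated bounds for the conditional Laplace functional of the levels below `K`, up to an
error in the intensity governed by `δ` and `η`. -/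
def LevelSandwich (P : Measure Ω) (ξ : ℝ≥0 → Ω → LevelMeasure h) (Ξ : ℝ≥0 → Ω → LocMeasure h)
    (t : ℝ≥0) (K δ η : ℝ) : Prop :=
  ∀ f : S → ℝ, Dominated h f → ∀ G : Ω → ℝ, StronglyMeasurable[history Ξ t] G →
    (∀ ω, 0 ≤ G ω) → (∃ B, ∀ ω, G ω ≤ B) →
    ∫ ω, G ω * Real.exp (-((K + δ) * (1 + η) * ∫ x, (1 - Real.exp (-f x)) ∂(Ξ t ω).1)) ∂P ≤
        ∫ ω, G ω * Real.exp (-∫ z, f z.1 * levelCutoff K δ z.2 ∂(ξ t ω).1) ∂P ∧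
      ∫ ω, G ω * Real.exp (-∫ z, f z.1 * levelCutoff K δ z.2 ∂(ξ t ω).1) ∂P ≤
        ∫ ω, G ω * Real.exp (-(K * ∫ x, (1 - Real.exp (-f x)) ∂(Ξ t ω).1)) ∂P

theorem history_le {E : Type*} [MeasurableSpace E] {X : ℝ≥0 → Ω → E} (hX : IsProcess X)
    (t : ℝ≥0) : history X t ≤ ‹MeasurableSpace Ω› :=
  iSup₂_le fun s _ => (hX s).comap_le

theorem integral_mul_eq_of_condExp {m mΩ : MeasurableSpace Ω} (hm : m ≤ mΩ) {P : Measure Ω}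
    [IsProbabilityMeasure P] {G W V : Ω → ℝ} (hG : StronglyMeasurable[m] G)
    {B : ℝ} (hG0 : ∀ ω, 0 ≤ G ω) (hB : ∀ ω, G ω ≤ B) (hW : Integrable W P)
    (hWV : P[W | m] =ᵐ[P] V) : ∫ ω, G ω * W ω ∂P = ∫ ω, G ω * V ω ∂P := by
  have hGW : Integrable (G * W) P := hW.bdd_mul (hG.mono hm).aestronglyMeasurable (c := B)
    (ae_of_all _ fun ω => by rw [Real.norm_of_nonneg (hG0 ω)]; exact hB ω)
  calc ∫ ω, G ω * W ω ∂P = ∫ ω, (P[G * W | m]) ω ∂P := (integral_condExp hm).symm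
    _ = ∫ ω, G ω * V ω ∂P := integral_congr_ae <| by
      filter_upwards [condExp_mul_of_stronglyMeasurable_left hG hGW hW, hWV] with ω h1 h2
      rw [h1, Pi.mul_apply, h2]

theorem exp_neg_le_one {a : ℝ} (ha : 0 ≤ a) : Real.exp (-a) ≤ 1 := by simpa using ha

theorem integrable_mul_exp_neg {P : Measure Ω} [IsProbabilityMeasure P] {G W : Ω → ℝ}
    (hG : AEStronglyMeasurable G P) {B : ℝ} (hB : ∀ ω, |G ω| ≤ B)
    (hW : AEStronglyMeasurable W P) (hW0 : ∀ ω, 0 ≤ W ω) :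
    Integrable (fun ω => G ω * Real.exp (-W ω)) P :=
  Integrable.of_bound (hG.mul (Real.continuous_exp.comp_aestronglyMeasurable hW.neg)) B
    (ae_of_all _ fun ω => by
      rw [norm_mul, Real.norm_of_nonneg (Real.exp_pos _).le]
      exact (mul_le_of_le_one_right (norm_nonneg _) (exp_neg_le_one (hW0 ω))).trans (hB ω))

theorem integrable_exp_neg {P : Measure Ω} [IsProbabilityMeasure P] {W : Ω → ℝ}
    (hW : AEStronglyMeasurable W P) (hW0 : ∀ ω, 0 ≤ W ω) :
    Integrable (fun ω => Real.exp (-W ω)) P := by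
  have := integrable_mul_exp_neg (G := fun _ => 1) (B := 1) aestronglyMeasurable_const
    (fun _ => by simp) hW hW0
  simpa only [one_mul] using this

theorem Dominated.integral_one_sub_exp_nonneg {f : S → ℝ} (hf : Dominated h f)
    (ν : LocMeasure h) : 0 ≤ ∫ x, (1 - Real.exp (-f x)) ∂ν.1 :=
  integral_nonneg hf.one_sub_exp_neg.nonneg

/-- A dominated function as a bounded continuous function. -/
noncomputable def Dominated.toBCF (h_le_one : ∀ k x, h k x ≤ 1) {f : S → ℝ}
    (hf : Dominated h f) : S →ᵇ ℝ :=
  BoundedContinuousFunction.ofNormedAddCommGroup f hf.continuous hf.le.choose_spec.choose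
    fun x => by
      obtain ⟨hc, hle⟩ := hf.le.choose_spec.choose_spec
      rw [Real.norm_of_nonneg (hf.nonneg x)]
      exact (hle x).trans (mul_le_of_le_one_right hc.le (h_le_one _ x))

/-- The cutoff lies between the indicators of `[0, K]` and `[0, K + δ]`, and the relation is exact
at both levels. The factor `1 + η` only weakens the lower bound here; it is there for the uniform
relation. -/
theorem CondPoissonRel.levelSandwich (h_nonneg : ∀ k x, 0 ≤ h k x) (h_le_one : ∀ k x, h k x ≤ 1)
    {P : Measure Ω} [IsProbabilityMeasure P] {ξ : ℝ≥0 → Ω → LevelMeasure h}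
    {Ξ : ℝ≥0 → Ω → LocMeasure h} (hξ : IsProcess ξ) (hΞ : IsProcess Ξ)
    (hP : CondPoissonRel P ξ Ξ) (t : ℝ≥0) {K δ η : ℝ} (hK : 0 < K) (hδ : 0 < δ) (hη : 0 < η) :
    LevelSandwich P ξ Ξ t K δ η := by
  intro f hf G hG hG0 ⟨B, hB⟩
  have hm := history_le hΞ t
  have hGm : AEStronglyMeasurable G P := (hG.mono hm).aestronglyMeasurable
  have hGB : ∀ ω, |G ω| ≤ B := fun ω => by rw [abs_of_nonneg (hG0 ω)]; exact hB ω
  have hA0 := fun ω => hf.integral_one_sub_exp_nonneg (Ξ t ω)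
  have hAm : Measurable fun ω => ∫ x, (1 - Real.exp (-f x)) ∂(Ξ t ω).1 :=
    (hf.one_sub_exp_neg.continuous_integral h_nonneg).measurable.comp (hΞ t)
  have hWm : ∀ L, Measurable fun ω => ∫ z in levelsUpTo S L, f z.1 ∂(ξ t ω).1 := fun L =>
    (hf.measurable_integral_levelsUpTo h_nonneg L).comp (hξ t)
  have hφm : Measurable fun ω => ∫ z, f z.1 * levelCutoff K δ z.2 ∂(ξ t ω).1 :=
    (hf.continuous_integral_mul_levelCutoff h_nonneg K hδ).measurable.comp (hξ t)
  have hW0 : ∀ L ω, 0 ≤ ∫ z in levelsUpTo S L, f z.1 ∂(ξ t ω).1 := fun L ω =>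
    integral_nonneg fun z => hf.nonneg z.1
  have hφ0 : ∀ ω, 0 ≤ ∫ z, f z.1 * levelCutoff K δ z.2 ∂(ξ t ω).1 := fun ω =>
    integral_nonneg (hf.mul_levelCutoff_nonneg K δ)
  have hrel : ∀ L, 0 < L → ∫ ω, G ω * Real.exp (-∫ z in levelsUpTo S L, f z.1 ∂(ξ t ω).1) ∂P =
      ∫ ω, G ω * Real.exp (-(L * ∫ x, (1 - Real.exp (-f x)) ∂(Ξ t ω).1)) ∂P := fun L hL =>
    integral_mul_eq_of_condExp hm hG hG0 hB
      (integrable_exp_neg (hWm L).aestronglyMeasurable (hW0 L))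
      (hP t L hL (hf.toBCF h_le_one) hf.nonneg hf.le)
  have hint := fun L => integrable_mul_exp_neg hGm hGB (hWm L).aestronglyMeasurable (hW0 L)
  have hintφ := integrable_mul_exp_neg hGm hGB hφm.aestronglyMeasurable hφ0
  have hintA : ∀ c, 0 ≤ c → Integrable (fun ω => G ω *
      Real.exp (-(c * ∫ x, (1 - Real.exp (-f x)) ∂(Ξ t ω).1))) P := fun c hc =>
    integrable_mul_exp_neg hGm hGB (hAm.const_mul c).aestronglyMeasurable
      fun ω => mul_nonneg hc (hA0 ω)
  have hKδ : 0 < K + δ := by linarith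
  constructor
  · calc _ ≤ ∫ ω, G ω * Real.exp (-((K + δ) * ∫ x, (1 - Real.exp (-f x)) ∂(Ξ t ω).1)) ∂P := by
          refine integral_mono (hintA _ (by positivity)) (hintA _ hKδ.le) fun ω => ?_
          refine mul_le_mul_of_nonneg_left (Real.exp_le_exp.2 (neg_le_neg ?_)) (hG0 ω)
          refine mul_le_mul_of_nonneg_right ?_ (hA0 ω)
          nlinarith
      _ = _ := (hrel _ hKδ).symm
      _ ≤ _ := integral_mono (hint _) hintφ fun ω =>
          mul_le_mul_of_nonneg_left (Real.exp_le_exp.2 (neg_le_neg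
            (hf.integral_mul_levelCutoff_le h_nonneg K hδ (ξ t ω)))) (hG0 ω)
  · rw [← hrel K hK]
    exact integral_mono hintφ (hint _) fun ω => mul_le_mul_of_nonneg_left (Real.exp_le_exp.2
      (neg_le_neg (hf.integral_levelsUpTo_le h_nonneg K hδ (ξ t ω)))) (hG0 ω)

/-- Bounds for the exponent of the uniform-level relation applied to a level cutoff. -/
theorem uniformExponent_bounds {K δ r : ℝ} (hK : 0 < K) (hδ : 0 < δ) (hr : K + δ < r) {f : S → ℝ}
    (x : S) (hf : 0 ≤ f x) :
    K * (1 - Real.exp (-f x)) ≤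
        uniformExponent r (fun z => f z.1 * levelCutoff K δ z.2) x ∧
      uniformExponent r (fun z => f z.1 * levelCutoff K δ z.2) x ≤
        (K + δ) * (1 - Real.exp (-f x)) / (1 - (K + δ) / r) := by
  have hr0 : 0 < r := by linarith
  set a : ℝ := 1 - Real.exp (-f x) with ha
  have ha0 : 0 ≤ a := by rw [ha]; have := exp_neg_le_one hf; linarith
  have ha1 : a < 1 := by rw [ha]; linarith [Real.exp_pos (-f x)]
  have hcont : Continuous fun u : ℝ => Real.exp (-(f x * levelCutoff K δ u.toNNReal)) :=
    Real.continuous_exp.comp (continuous_const.mul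
      ((continuous_levelCutoff K δ).comp continuous_real_toNNReal)).neg
  have hii := fun b c : ℝ => hcont.intervalIntegrable (μ := volume) b c
  set I : ℝ := ∫ u in (0 : ℝ)..r, Real.exp (-(f x * levelCutoff K δ u.toNNReal)) with hI
  have hpt : ∀ u : ℝ, 1 - a ≤ Real.exp (-(f x * levelCutoff K δ u.toNNReal)) := fun u => by
    rw [ha, sub_sub_cancel]
    exact Real.exp_le_exp.2 (neg_le_neg (mul_le_of_le_one_right hf (levelCutoff_le_one _ _ _)))
  have hpt1 : ∀ u : ℝ, Real.exp (-(f x * levelCutoff K δ u.toNNReal)) ≤ 1 := fun u =>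
    exp_neg_le_one (mul_nonneg hf (levelCutoff_nonneg _ _ _))
  -- The integrand equals `1 - a` on `[0, K]`, lies in `[1 - a, 1]` on the ramp and equals `1`
  -- beyond `K + δ`. This puts `I` between `r - (K + δ) a` and `r - K a`.
  have hub : I ≤ r - K * a := by
    rw [hI, ← intervalIntegral.integral_add_adjacent_intervals (hii 0 K) (hii K r)]
    have h1 : ∫ u in (0 : ℝ)..K, Real.exp (-(f x * levelCutoff K δ u.toNNReal)) ≤
        ∫ u in (0 : ℝ)..K, (1 - a) := by
      refine intervalIntegral.integral_mono_on hK.le (hii 0 K) intervalIntegrable_const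
        fun u hu => ?_
      rw [levelCutoff_eq_one hδ (by rw [Real.coe_toNNReal u hu.1]; exact hu.2), mul_one, ha,
        sub_sub_cancel]
    have h2 : ∫ u in K..r, Real.exp (-(f x * levelCutoff K δ u.toNNReal)) ≤
        ∫ u in K..r, (1 : ℝ) :=
      intervalIntegral.integral_mono_on (by linarith) (hii K r) intervalIntegrable_const
        fun u _ => hpt1 u
    simp only [intervalIntegral.integral_const, smul_eq_mul, sub_zero, mul_one] at h1 h2
    linarith
  have hlb : r - (K + δ) * a ≤ I := by
    rw [hI, ← intervalIntegral.integral_add_adjacent_intervals (hii 0 (K + δ)) (hii (K + δ) r)]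
    have h1 : ∫ u in (0 : ℝ)..(K + δ), (1 - a) ≤
        ∫ u in (0 : ℝ)..(K + δ), Real.exp (-(f x * levelCutoff K δ u.toNNReal)) :=
      intervalIntegral.integral_mono_on (by linarith) intervalIntegrable_const (hii _ _)
        fun u _ => hpt u
    have h2 : ∫ u in (K + δ)..r, (1 : ℝ) ≤
        ∫ u in (K + δ)..r, Real.exp (-(f x * levelCutoff K δ u.toNNReal)) := by
      refine intervalIntegral.integral_mono_on hr.le intervalIntegrable_const (hii _ _)
        fun u hu => ?_
      have hu0 : 0 ≤ u := by linarith [hu.1]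
      rw [levelCutoff_eq_zero hδ (by rw [Real.coe_toNNReal u hu0]; exact hu.1)]
      simp
    simp only [intervalIntegral.integral_const, smul_eq_mul, sub_zero, mul_one] at h1 h2
    linarith
  have hKδ : 0 < K + δ := by linarith
  have hIpos : 0 < I := by nlinarith
  have hq : 0 < r⁻¹ * I := by positivity
  have hval : uniformExponent r (fun z => f z.1 * levelCutoff K δ z.2) x =
      r * -Real.log (r⁻¹ * I) := by
    rw [uniformExponent, hI]; ring
  rw [hval]
  -- With `y = I / r`, the lower bound comes from `log y ≤ y - 1` and the upper one from `log y ≥ 1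
  -- - 1 / y`; since `a < 1`, the denominator `y` is at least `1 - (K + δ) / r`.
  constructor
  · have h1 := Real.log_le_sub_one_of_pos hq
    have h2 : r * (r⁻¹ * I) = I := by field_simp
    nlinarith
  · have h1 := Real.one_sub_inv_le_log_of_pos hq
    have hd : 0 < 1 - (K + δ) / r := by
      rw [sub_pos, div_lt_one hr0]; exact hr
    have h2 : r * -Real.log (r⁻¹ * I) ≤ r * ((r⁻¹ * I)⁻¹ - 1) := by
      refine mul_le_mul_of_nonneg_left (by linarith) hr0.le
    refine h2.trans ?_
    have h3 : r * ((r⁻¹ * I)⁻¹ - 1) = (r - I) / (I / r) := by field_simp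
    rw [h3]
    have h4 : 1 - (K + δ) / r ≤ I / r := by
      rw [le_div_iff₀ hr0, sub_mul, div_mul_cancel₀ _ hr0.ne']
      nlinarith
    exact div_le_div₀ (by positivity) (by linarith) hd h4

theorem continuous_uniformExponent {K δ r : ℝ} (hK : 0 < K) (hδ : 0 < δ) (hr : K + δ < r)
    {f : S → ℝ} (hf : Continuous f) :
    Continuous (uniformExponent r fun z : S × ℝ≥0 => f z.1 * levelCutoff K δ z.2) := by
  have hcont : Continuous fun x => ∫ u in (0 : ℝ)..r,
      Real.exp (-(f x * levelCutoff K δ u.toNNReal)) := by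
    refine intervalIntegral.continuous_parametric_intervalIntegral_of_continuous' ?_ 0 r
    exact Real.continuous_exp.comp ((hf.comp continuous_fst).mul
      ((continuous_levelCutoff K δ).comp (continuous_real_toNNReal.comp continuous_snd))).neg
  have hr0 : 0 < r := by linarith
  refine continuous_const.mul (Continuous.log (continuous_const.mul hcont) fun x => ?_)
  refine (mul_pos (inv_pos.2 hr0) (intervalIntegral.intervalIntegral_pos_of_pos
    ?_ (fun u => Real.exp_pos _) hr0)).ne'
  have hc : Continuous fun u : ℝ => Real.exp (-(f x * levelCutoff K δ u.toNNReal)) :=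
    Real.continuous_exp.comp (continuous_const.mul
      ((continuous_levelCutoff K δ).comp continuous_real_toNNReal)).neg
  exact hc.intervalIntegrable _ _

/-- The relation is applied to `f(x) φ(u)`, and `uniformExponent_bounds` compares its exponent with
`1 - exp (-f)`. The hypothesis `hη` says that `1 + η` absorbs the denominator `1 - (K + δ) / r`. -/
theorem CondUniformRel.levelSandwich (h_nonneg : ∀ k x, 0 ≤ h k x) (h_le_one : ∀ k x, h k x ≤ 1)
    {P : Measure Ω} [IsProbabilityMeasure P] {ξ : ℝ≥0 → Ω → LevelMeasure h}
    {Ξ : ℝ≥0 → Ω → LocMeasure h} (hξ : IsProcess ξ) (hΞ : IsProcess Ξ) {r : ℝ}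
    (hU : CondUniformRel P r ξ Ξ) (t : ℝ≥0) {K δ η : ℝ} (hK : 0 < K) (hδ : 0 < δ)
    (hr : K + δ < r) (hη : 1 ≤ (1 + η) * (1 - (K + δ) / r)) :
    LevelSandwich P ξ Ξ t K δ η := by
  intro f hf G hG hG0 ⟨B, hB⟩
  have hm := history_le hΞ t
  have hGm : AEStronglyMeasurable G P := (hG.mono hm).aestronglyMeasurable
  have hGB : ∀ ω, |G ω| ≤ B := fun ω => by rw [abs_of_nonneg (hG0 ω)]; exact hB ω
  have hr0 : 0 < r := by linarith
  have hd : 0 < 1 - (K + δ) / r := by rw [sub_pos, div_lt_one hr0]; exact hr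
  have hη0 : 0 < 1 + η := by
    by_contra hcon
    nlinarith
  have hKδ : 0 < K + δ := by linarith
  have hφm : Measurable fun ω => ∫ z, f z.1 * levelCutoff K δ z.2 ∂(ξ t ω).1 :=
    (hf.continuous_integral_mul_levelCutoff h_nonneg K hδ).measurable.comp (hξ t)
  have hφ0 : ∀ ω, 0 ≤ ∫ z, f z.1 * levelCutoff K δ z.2 ∂(ξ t ω).1 := fun ω =>
    integral_nonneg (hf.mul_levelCutoff_nonneg K δ)
  have hbd := fun x => uniformExponent_bounds hK hδ hr (f := f) x (hf.nonneg x)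
  have hUle : ∀ x, uniformExponent r (fun z => f z.1 * levelCutoff K δ z.2) x ≤
      (K + δ) * (1 + η) * (1 - Real.exp (-f x)) := fun x => by
    refine (hbd x).2.trans ?_
    rw [div_le_iff₀ hd]
    have := mul_nonneg hKδ.le (hf.one_sub_exp_neg.nonneg x)
    nlinarith
  have hUdom : Dominated h (uniformExponent r fun z => f z.1 * levelCutoff K δ z.2) :=
    hf.one_sub_exp_neg.of_le (continuous_uniformExponent hK hδ hr hf.continuous)
      (fun x => (mul_nonneg hK.le (hf.one_sub_exp_neg.nonneg x)).trans (hbd x).1)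
      (mul_pos hKδ hη0) hUle
  have hUm : Measurable fun ω =>
      ∫ x, uniformExponent r (fun z => f z.1 * levelCutoff K δ z.2) x ∂(Ξ t ω).1 :=
    (hUdom.continuous_integral h_nonneg).measurable.comp (hΞ t)
  have hA0 := fun ω => hf.integral_one_sub_exp_nonneg (Ξ t ω)
  have hAm : Measurable fun ω => ∫ x, (1 - Real.exp (-f x)) ∂(Ξ t ω).1 :=
    (hf.one_sub_exp_neg.continuous_integral h_nonneg).measurable.comp (hΞ t)
  have hintA : ∀ c, 0 ≤ c → Integrable (fun ω => G ω *
      Real.exp (-(c * ∫ x, (1 - Real.exp (-f x)) ∂(Ξ t ω).1))) P := fun c hc =>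
    integrable_mul_exp_neg hGm hGB (hAm.const_mul c).aestronglyMeasurable
      fun ω => mul_nonneg hc (hA0 ω)
  have hintU := integrable_mul_exp_neg hGm hGB hUm.aestronglyMeasurable
    fun ω => integral_nonneg hUdom.nonneg
  obtain ⟨k, c, hc, hle⟩ := hf.le
  let p : (S × ℝ≥0) →ᵇ ℝ := BoundedContinuousFunction.ofNormedAddCommGroup
    (fun z => f z.1 * levelCutoff K δ z.2) (hf.continuous_mul_levelCutoff K δ) c fun z => by
      rw [Real.norm_of_nonneg (hf.mul_levelCutoff_nonneg K δ z)]
      exact (hf.mul_levelCutoff_le K δ z).trans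
        ((hle z.1).trans (mul_le_of_le_one_right hc.le (h_le_one k _)))
  have hsupp : ∀ ω, ∫ z in levelsUpTo S r, f z.1 * levelCutoff K δ z.2 ∂(ξ t ω).1 =
      ∫ z, f z.1 * levelCutoff K δ z.2 ∂(ξ t ω).1 := fun ω =>
    setIntegral_eq_integral_of_forall_compl_eq_zero fun z hz =>
      mul_levelCutoff_eq_zero hδ z fun (hz' : (z.2 : ℝ) ≤ _) => hz (hz'.trans hr.le)
  have hce := hU t p (hf.mul_levelCutoff_nonneg K δ)
    ⟨k, c, hc, fun z => (hf.mul_levelCutoff_le K δ z).trans (hle z.1)⟩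
  have hfun : (fun ω => Real.exp (-∫ z in levelsUpTo S r, p z ∂(ξ t ω).1)) =
      fun ω => Real.exp (-∫ z, f z.1 * levelCutoff K δ z.2 ∂(ξ t ω).1) :=
    funext fun ω => congrArg (fun a => Real.exp (-a)) (hsupp ω)
  rw [hfun] at hce
  have hrel := integral_mul_eq_of_condExp hm hG hG0 hB
      (integrable_exp_neg hφm.aestronglyMeasurable hφ0) hce
  rw [hrel]
  constructor
  · refine integral_mono (hintA _ (by positivity)) hintU fun ω =>
      mul_le_mul_of_nonneg_left (Real.exp_le_exp.2 (neg_le_neg ?_)) (hG0 ω)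
    rw [← integral_const_mul]
    exact integral_mono (hUdom.integrable h_nonneg _)
      ((hf.one_sub_exp_neg.integrable h_nonneg _).const_mul _) hUle
  · refine integral_mono hintU (hintA _ hK.le) fun ω =>
      mul_le_mul_of_nonneg_left (Real.exp_le_exp.2 (neg_le_neg ?_)) (hG0 ω)
    rw [← integral_const_mul]
    exact integral_mono ((hf.one_sub_exp_neg.integrable h_nonneg _).const_mul _)
      (hUdom.integrable h_nonneg _) fun x => (hbd x).1

end Sandwich

end

section

/-! ### Laplace functionals -/

section Laplace

variable {S : Type*} [TopologicalSpace S] [MeasurableSpace S] {h : ℕ → S →ᵇ ℝ}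

/-- The Laplace functional `exp (-∫ f dν)`. -/
noncomputable def LocMeasure.laplace (f : S → ℝ) (ν : LocMeasure h) : ℝ :=
  Real.exp (-∫ x, f x ∂ν.1)

/-- The Laplace functional `exp (-∫ f(x) φ(u) μ(dx, du))` for the cutoff `φ`. -/
noncomputable def LevelMeasure.laplace (K δ : ℝ) (f : S → ℝ) (μ : LevelMeasure h) : ℝ :=
  Real.exp (-∫ z, f z.1 * levelCutoff K δ z.2 ∂μ.1)

theorem LocMeasure.laplace_pos (f : S → ℝ) (ν : LocMeasure h) : 0 < ν.laplace f :=
  Real.exp_pos _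

theorem Dominated.laplace_le_one {f : S → ℝ} (hf : Dominated h f) (ν : LocMeasure h) :
    ν.laplace f ≤ 1 :=
  exp_neg_le_one (integral_nonneg hf.nonneg)

theorem Dominated.abs_laplace_le_one {f : S → ℝ} (hf : Dominated h f) (ν : LocMeasure h) :
    |ν.laplace f| ≤ 1 := by
  rw [abs_of_pos (ν.laplace_pos f)]; exact hf.laplace_le_one ν

theorem LevelMeasure.laplace_pos (K δ : ℝ) (f : S → ℝ) (μ : LevelMeasure h) :
    0 < μ.laplace K δ f :=
  Real.exp_pos _

theorem Dominated.level_laplace_le_one {f : S → ℝ} (hf : Dominated h f) (K δ : ℝ)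
    (μ : LevelMeasure h) : μ.laplace K δ f ≤ 1 :=
  exp_neg_le_one (integral_nonneg fun z => mul_nonneg (hf.nonneg z.1) (levelCutoff_nonneg _ _ _))

theorem Dominated.abs_level_laplace_le_one {f : S → ℝ} (hf : Dominated h f) (K δ : ℝ)
    (μ : LevelMeasure h) : |μ.laplace K δ f| ≤ 1 := by
  rw [abs_of_pos (μ.laplace_pos K δ f)]; exact hf.level_laplace_le_one K δ μ

theorem Dominated.continuous_laplace [OpensMeasurableSpace S] (h_nonneg : ∀ k x, 0 ≤ h k x)
    {f : S → ℝ} (hf : Dominated h f) :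
    Continuous (LocMeasure.laplace f : LocMeasure h → ℝ) :=
  Real.continuous_exp.comp (hf.continuous_integral h_nonneg).neg

theorem Dominated.continuous_level_laplace [SecondCountableTopology S] [OpensMeasurableSpace S]
    (h_nonneg : ∀ k x, 0 ≤ h k x) {f : S → ℝ} (hf : Dominated h f) (K : ℝ) {δ : ℝ} (hδ : 0 < δ) :
    Continuous (LevelMeasure.laplace K δ f : LevelMeasure h → ℝ) :=
  Real.continuous_exp.comp (hf.continuous_integral_mul_levelCutoff h_nonneg K hδ).neg

theorem LocMeasure.laplace_eq_iff {f : S → ℝ} {ν ν' : LocMeasure h} :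
    ν.laplace f = ν'.laplace f ↔ ∫ x, f x ∂ν.1 = ∫ x, f x ∂ν'.1 := by
  rw [LocMeasure.laplace, LocMeasure.laplace, Real.exp_eq_exp, neg_inj]

theorem laplace_levelAverage [SecondCountableTopology S] [OpensMeasurableSpace S] {K : ℝ}
    (hK : 0 < K) {f : S → ℝ} (hf : Continuous f) (μ : LevelMeasure h) :
    (levelAverage hK μ).laplace f = μ.laplace K 1 fun x => 1 / K * f x := by
  rw [LocMeasure.laplace, LevelMeasure.laplace, integral_levelAverage hK μ hf]
  congr 2
  refine integral_congr_ae (ae_of_all _ fun z => ?_)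
  simp only
  ring

end Laplace

/-! ### Consequences of the sandwich bounds -/

theorem measurable_history {E Ω : Type*} [MeasurableSpace E] {X : ℝ≥0 → Ω → E} {s t : ℝ≥0}
    (hst : s ≤ t) : Measurable[history X t] (X s) :=
  measurable_iff_comap_le.2 (le_iSup₂_of_le s hst le_rfl)

theorem mul_exp_neg_le_one {x : ℝ} : x * Real.exp (-x) ≤ 1 := by
  have h1 := Real.add_one_le_exp x
  have h2 := Real.exp_pos (-x)
  have h3 : Real.exp x * Real.exp (-x) = 1 := by rw [← Real.exp_add]; simp
  nlinarith

theorem sub_sq_le_one_sub_exp_neg {x : ℝ} (hx : 0 ≤ x) : x - x ^ 2 ≤ 1 - Real.exp (-x) := by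
  have h1 : Real.exp (-x) ≤ 1 / (1 + x) := by
    rw [Real.exp_neg, ← one_div]
    exact one_div_le_one_div_of_le (by linarith) (by linarith [Real.add_one_le_exp x])
  have h2 : 1 / (1 + x) ≤ 1 - x + x ^ 2 := by
    rw [div_le_iff₀ (by linarith)]
    nlinarith [pow_nonneg hx 3]
  linarith

theorem half_le_one_sub_exp_neg {x : ℝ} (hx : 0 ≤ x) (hx1 : x ≤ 1) :
    1 / 2 * x ≤ 1 - Real.exp (-x) := by
  have h1 : Real.exp (-x) ≤ 1 / (1 + x) := by
    rw [Real.exp_neg, ← one_div]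
    exact one_div_le_one_div_of_le (by linarith) (by linarith [Real.add_one_le_exp x])
  have h2 : 1 / (1 + x) ≤ 1 - 1 / 2 * x := by
    rw [div_le_iff₀ (by linarith)]
    nlinarith
  linarith

/-- Here `x` stands for `∫ f dΞ`. For `K = ∞` the three terms cancel as `1 - 2 + 1` times `exp
(-2x)`. For finite `K` the exponents move by `O(x / K)`, and `x exp (-x) ≤ 1` makes the cost `O(1 /
K)`: `4 / K` from the first term and `2 * 3 / K` from the middle one. -/
theorem exp_quadratic_defect_le {K x : ℝ} (hK : 4 ≤ K) (hx : 0 ≤ x) :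
    Real.exp (-(2 * (1 - 2 / K) * x)) -
        2 * (Real.exp (-x) * Real.exp (-((K + 1) * (1 + 1 / K) * (1 / K * x)))) +
      Real.exp (-x) ^ 2 ≤ 10 / K := by
  have hK0 : 0 < K := by linarith
  set s : ℝ := 1 / K with hs
  have hs0 : 0 < s := by positivity
  have hs1 : s ≤ 1 / 4 := by rw [hs]; exact one_div_le_one_div_of_le (by norm_num) hK
  have hKs : K * s = 1 := by rw [hs]; field_simp
  have e1 : (2 : ℝ) / K = 2 * s := by rw [hs]; ring
  have e2 : (10 : ℝ) / K = 10 * s := by rw [hs]; ring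
  have e3 : (K + 1) * (1 + s) * (s * x) = x + (2 * s + s ^ 2) * x := by
    linear_combination ((1 + s) * x) * hKs
  rw [e1, e2, e3]
  have hx1 := mul_exp_neg_le_one (x := x)
  have hsq : Real.exp (-x) ^ 2 = Real.exp (-(2 * x)) := by
    rw [← Real.exp_nat_mul]; congr 1; push_cast; ring
  have hprod : Real.exp (-x) * Real.exp (-(x + (2 * s + s ^ 2) * x)) =
      Real.exp (-(2 * x)) * Real.exp (-((2 * s + s ^ 2) * x)) := by
    rw [← Real.exp_add, ← Real.exp_add]; congr 1; ring
  have hle : Real.exp (-(2 * x)) ≤ Real.exp (-x) := Real.exp_le_exp.2 (by linarith)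
  have hE := Real.exp_pos (-(2 * x))
  have h1 : Real.exp (-(2 * x)) - 3 * s ≤
      Real.exp (-x) * Real.exp (-(x + (2 * s + s ^ 2) * x)) := by
    rw [hprod]
    have h2 := Real.add_one_le_exp (-((2 * s + s ^ 2) * x))
    have h3 : x * Real.exp (-(2 * x)) ≤ 1 := by nlinarith
    have h4 : (2 * s + s ^ 2) * (x * Real.exp (-(2 * x))) ≤ (2 * s + s ^ 2) * 1 :=
      mul_le_mul_of_nonneg_left h3 (by positivity)
    have h5 := mul_le_mul_of_nonneg_left h2 hE.le
    nlinarith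
  have h6 : Real.exp (-(2 * (1 - 2 * s) * x)) - Real.exp (-(2 * x)) ≤ 4 * s := by
    have hfac : Real.exp (-(2 * x)) =
        Real.exp (-(2 * (1 - 2 * s) * x)) * Real.exp (-(4 * s * x)) := by
      rw [← Real.exp_add]; congr 1; ring
    have h2 := Real.add_one_le_exp (-(4 * s * x))
    have hF := Real.exp_pos (-(2 * (1 - 2 * s) * x))
    have h7 : Real.exp (-(2 * (1 - 2 * s) * x)) ≤ Real.exp (-x) :=
      Real.exp_le_exp.2 (by nlinarith)
    have h8 : x * Real.exp (-(2 * (1 - 2 * s) * x)) ≤ 1 := by nlinarith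
    have h9 := mul_le_mul_of_nonneg_left h2 hF.le
    rw [← hfac] at h9
    have h10 : 4 * s * (x * Real.exp (-(2 * (1 - 2 * s) * x))) ≤ 4 * s * 1 :=
      mul_le_mul_of_nonneg_left h8 (by positivity)
    nlinarith
  rw [hsq]
  linarith

/-! ### Second-moment and tightness estimates. -/

section Estimates

variable {S : Type*} [TopologicalSpace S] [PolishSpace S] [MeasurableSpace S]
  [BorelSpace S] {h : ℕ → S →ᵇ ℝ} {Ω : Type*} [MeasurableSpace Ω]
  {P : Measure Ω} [IsProbabilityMeasure P] {ξ : ℝ≥0 → Ω → LevelMeasure h}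
  {Ξ : ℝ≥0 → Ω → LocMeasure h} {t : ℝ≥0} {f : S → ℝ}

theorem integrable_loc_laplace (h_nonneg : ∀ k x, 0 ≤ h k x) (hf : Dominated h f)
    {Y : Ω → LocMeasure h} (hY : Measurable Y) : Integrable (fun ω => (Y ω).laplace f) P :=
  Integrable.of_bound ((hf.continuous_laplace h_nonneg).measurable.comp hY).aestronglyMeasurable 1
    (ae_of_all _ fun _ => hf.abs_laplace_le_one _)

theorem integrable_level_laplace (h_nonneg : ∀ k x, 0 ≤ h k x) (hf : Dominated h f) (K : ℝ)
    {δ : ℝ} (hδ : 0 < δ) {Y : Ω → LevelMeasure h} (hY : Measurable Y) :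
    Integrable (fun ω => (Y ω).laplace K δ f) P :=
  Integrable.of_bound
    ((hf.continuous_level_laplace h_nonneg K hδ).measurable.comp hY).aestronglyMeasurable 1
    (ae_of_all _ fun _ => hf.abs_level_laplace_le_one K δ _)

theorem integral_sub_two_mul_add {u v w : Ω → ℝ} (hu : Integrable u P) (hv : Integrable v P)
    (hw : Integrable w P) : ∫ ω, (u ω - 2 * v ω + w ω) ∂P =
      ∫ ω, u ω ∂P - 2 * ∫ ω, v ω ∂P + ∫ ω, w ω ∂P := by
  refine (integral_add (hu.sub (hv.const_mul 2)) hw).trans (congrArg (· + _) ?_)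
  refine (integral_sub hu (hv.const_mul 2)).trans ?_
  rw [integral_const_mul]

theorem integral_abs_le_of_integral_sq_le {X : Ω → ℝ} (hX : Integrable X P)
    (hX2 : Integrable (fun ω => X ω ^ 2) P) {L : ℝ} (hL : 0 < L)
    (hle : ∫ ω, X ω ^ 2 ∂P ≤ 10 / L ^ 2) : ∫ ω, |X ω| ∂P ≤ 6 / L := by
  -- The inequality of the means, balanced for a second moment of order `1 / L ^ 2`; it gives `5 / L
  -- + 1 / (2 L)`.
  have hpt : ∀ ω, |X ω| ≤ L / 2 * X ω ^ 2 + 1 / (2 * L) := fun ω => by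
    have h1 : 0 ≤ (L * |X ω| - 1) ^ 2 := sq_nonneg _
    have h2 : |X ω| ^ 2 = X ω ^ 2 := sq_abs _
    rw [← sub_nonneg]
    have : L / 2 * X ω ^ 2 + 1 / (2 * L) - |X ω| = (L * |X ω| - 1) ^ 2 / (2 * L) := by
      rw [← h2]; field_simp; ring
    rw [this]
    positivity
  calc ∫ ω, |X ω| ∂P ≤ ∫ ω, (L / 2 * X ω ^ 2 + 1 / (2 * L)) ∂P :=
        integral_mono hX.abs ((hX2.const_mul _).add (integrable_const _)) hpt
    _ = L / 2 * ∫ ω, X ω ^ 2 ∂P + 1 / (2 * L) := by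
        rw [integral_add (hX2.const_mul _) (integrable_const _), integral_const_mul]; simp
    _ ≤ L / 2 * (10 / L ^ 2) + 1 / (2 * L) := by gcongr
    _ ≤ 6 / L := by
        rw [← sub_nonneg]
        have : 6 / L - (L / 2 * (10 / L ^ 2) + 1 / (2 * L)) = 1 / (2 * L) := by
          field_simp; ring
        rw [this]; positivity

/-- The quantitative law of large numbers. In `E (Z - a)²` the term `Z²` is the Laplace functional
for `2 f / K`, bounded above with weight `1`; the cross term `a Z` is bounded below with weight `a`,
which is history measurable. The three resulting exponentials are compared pointwise by
`exp_quadratic_defect_le`. -/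
theorem LevelSandwich.integral_abs_laplace_sub_le (h_nonneg : ∀ k x, 0 ≤ h k x)
    (h_le_one : ∀ k x, h k x ≤ 1) (hξ : IsProcess ξ) (hΞ : IsProcess Ξ) {K L : ℝ}
    (hL : 2 ≤ L) (hKL : K = L ^ 2) (hK : 0 < K) (hs : LevelSandwich P ξ Ξ t K 1 (1 / K))
    (hf : SubWeight h f) :
    ∫ ω, |(levelAverage hK (ξ t ω)).laplace f - (Ξ t ω).laplace f| ∂P ≤ 6 / L := by
  have hK4 : 4 ≤ K := by rw [hKL]; nlinarith
  have hfd := hf.dominated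
  have hZi : Integrable (fun ω => (levelAverage hK (ξ t ω)).laplace f) P :=
    integrable_loc_laplace h_nonneg hfd ((continuous_levelAverage hK).measurable.comp (hξ t))
  have hai := integrable_loc_laplace (P := P) h_nonneg hfd (hΞ t)
  set Z : Ω → ℝ := fun ω => (levelAverage hK (ξ t ω)).laplace f with hZ
  set a : Ω → ℝ := fun ω => (Ξ t ω).laplace f with ha
  have hZb : ∀ ω, |Z ω| ≤ 1 := fun ω => hfd.abs_laplace_le_one _
  have hab : ∀ ω, |a ω| ≤ 1 := fun ω => hfd.abs_laplace_le_one _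
  have hZ2 : Integrable (fun ω => Z ω ^ 2) P := by
    simp_rw [sq]
    exact hZi.bdd_mul hZi.1 (ae_of_all _ hZb)
  have haZ : Integrable (fun ω => a ω * Z ω) P := hZi.bdd_mul hai.1 (ae_of_all _ hab)
  have ha2 : Integrable (fun ω => a ω ^ 2) P := by
    simp_rw [sq]
    exact hai.bdd_mul hai.1 (ae_of_all _ hab)
  have hA0 : ∀ ω, 0 ≤ ∫ x, f x ∂(Ξ t ω).1 := fun ω => integral_nonneg hf.nonneg
  have hAm : Measurable fun ω => ∫ x, f x ∂(Ξ t ω).1 :=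
    (hfd.continuous_integral h_nonneg).measurable.comp (hΞ t)
  have hexpi : ∀ c, 0 ≤ c → Integrable (fun ω => Real.exp (-(c * ∫ x, f x ∂(Ξ t ω).1))) P :=
    fun c hc => integrable_exp_neg (hAm.const_mul c).aestronglyMeasurable
      fun ω => mul_nonneg hc (hA0 ω)
  have hK2 : 2 / K ≤ 1 / 2 := by rw [div_le_div_iff₀ hK two_pos]; linarith
  have hdom := fun c (hc : 0 ≤ c) => hfd.const_mul hc
  have hAm' : ∀ c, 0 ≤ c → Measurable fun ω => ∫ x, (1 - Real.exp (-(c * f x))) ∂(Ξ t ω).1 :=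
    fun c hc => ((hdom c hc).one_sub_exp_neg.continuous_integral h_nonneg).measurable.comp (hΞ t)
  have hup : ∫ ω, Z ω ^ 2 ∂P ≤
      ∫ ω, Real.exp (-(2 * (1 - 2 / K) * ∫ x, f x ∂(Ξ t ω).1)) ∂P := by
    have h1 := (hs _ (hdom (2 / K) (by positivity)) (fun _ => 1) stronglyMeasurable_const
      (fun _ => zero_le_one) ⟨1, fun _ => le_rfl⟩).2
    simp only [one_mul] at h1
    have h2 : ∀ ω, Z ω ^ 2 =
        Real.exp (-∫ z, 2 / K * f z.1 * levelCutoff K 1 z.2 ∂(ξ t ω).1) := fun ω => by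
      simp only [hZ]
      rw [laplace_levelAverage hK hf.continuous, LevelMeasure.laplace, ← Real.exp_nat_mul]
      congr 1
      rw [mul_neg, ← integral_const_mul]
      congr 1
      refine integral_congr_ae (ae_of_all _ fun z => ?_)
      simp only
      push_cast
      ring
    simp_rw [h2]
    refine h1.trans ?_
    refine integral_mono (integrable_exp_neg
      ((hAm' (2 / K) (by positivity)).const_mul K).aestronglyMeasurable fun ω => mul_nonneg hK.le
        ((hdom (2 / K) (by positivity)).integral_one_sub_exp_nonneg _)) (hexpi _ (by linarith))
      fun ω => Real.exp_le_exp.2 (neg_le_neg ?_)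
    rw [← integral_const_mul, ← integral_const_mul]
    refine integral_mono ((hfd.integrable h_nonneg _).const_mul _)
      (((hdom (2 / K) (by positivity)).one_sub_exp_neg.integrable h_nonneg _).const_mul _)
      fun x => ?_
    -- Since `f ≤ 1`, this gives `K (1 - exp (-2 f / K)) ≥ 2 f - 4 f² / K ≥ 2 (1 - 2 / K) f`.
    have h3 := sub_sq_le_one_sub_exp_neg (mul_nonneg (by positivity : 0 ≤ 2 / K) (hf.nonneg x))
    have h4 := mul_le_mul_of_nonneg_left h3 hK.le
    refine le_trans ?_ h4
    have h5 : K * (2 / K * f x - (2 / K * f x) ^ 2) = 2 * f x - 4 / K * (f x * f x) := by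
      field_simp; ring
    have h6 : f x * f x ≤ f x := mul_le_of_le_one_right (hf.nonneg x) (hf.le_one h_le_one x)
    have h7 : 4 / K * (f x * f x) ≤ 4 / K * f x := mul_le_mul_of_nonneg_left h6 (by positivity)
    rw [h5]
    have h8 : 2 * (1 - 2 / K) * f x = 2 * f x - 4 / K * f x := by ring
    rw [h8]
    linarith
  have hlow : ∫ ω, a ω *
      Real.exp (-((K + 1) * (1 + 1 / K) * (1 / K * ∫ x, f x ∂(Ξ t ω).1))) ∂P ≤
        ∫ ω, a ω * Z ω ∂P := by
    have hGm : StronglyMeasurable[history Ξ t] a :=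
      ((hfd.continuous_laplace h_nonneg).measurable.comp
        (measurable_history le_rfl)).stronglyMeasurable
    have h1 := (hs _ (hdom (1 / K) (by positivity)) a hGm (fun ω => (LocMeasure.laplace_pos _ _).le)
      ⟨1, fun ω => hfd.laplace_le_one _⟩).1
    have h2 : ∀ ω, Z ω =
        Real.exp (-∫ z, 1 / K * f z.1 * levelCutoff K 1 z.2 ∂(ξ t ω).1) := fun ω =>
      laplace_levelAverage hK hf.continuous _
    simp_rw [h2]
    refine le_trans ?_ h1
    have hc : 0 ≤ (K + 1) * (1 + 1 / K) := by positivity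
    refine integral_mono
      (integrable_mul_exp_neg hai.1 hab ((hAm.const_mul (1 / K)).const_mul _).aestronglyMeasurable
        fun ω => mul_nonneg hc (mul_nonneg (by positivity) (hA0 ω)))
      (integrable_mul_exp_neg hai.1 hab
        ((hAm' (1 / K) (by positivity)).const_mul _).aestronglyMeasurable fun ω =>
        mul_nonneg hc ((hdom (1 / K) (by positivity)).integral_one_sub_exp_nonneg _))
      fun ω => mul_le_mul_of_nonneg_left (Real.exp_le_exp.2 (neg_le_neg
        (mul_le_mul_of_nonneg_left ?_ hc))) (LocMeasure.laplace_pos _ _).le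
    rw [← integral_const_mul]
    refine integral_mono ((hdom (1 / K) (by positivity)).one_sub_exp_neg.integrable h_nonneg _)
      ((hfd.integrable h_nonneg _).const_mul _) fun x => ?_
    linarith [Real.add_one_le_exp (-(1 / K * f x))]
  refine integral_abs_le_of_integral_sq_le (X := fun ω => Z ω - a ω) (hZi.sub hai) ?_
    (by linarith) ?_
  · have : (fun ω => (Z ω - a ω) ^ 2) = fun ω => Z ω ^ 2 - 2 * (a ω * Z ω) + a ω ^ 2 := by
      funext ω; ring
    rw [this]
    exact (hZ2.sub (haZ.const_mul 2)).add ha2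
  · have hsq : ∀ ω, (Z ω - a ω) ^ 2 = Z ω ^ 2 - 2 * (a ω * Z ω) + a ω ^ 2 := fun ω => by ring
    simp_rw [hsq]
    have e1 := integral_sub_two_mul_add hZ2 haZ ha2
    rw [e1]
    have hc : 0 ≤ (K + 1) * (1 + 1 / K) := by positivity
    have hB : Integrable (fun ω => a ω *
        Real.exp (-((K + 1) * (1 + 1 / K) * (1 / K * ∫ x, f x ∂(Ξ t ω).1)))) P :=
      integrable_mul_exp_neg hai.1 hab ((hAm.const_mul (1 / K)).const_mul _).aestronglyMeasurable
        fun ω => mul_nonneg hc (mul_nonneg (by positivity) (hA0 ω))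
    have hA := hexpi (2 * (1 - 2 / K)) (by linarith)
    have e2 := integral_sub_two_mul_add hA hB ha2
    have h3 : ∫ ω, (Real.exp (-(2 * (1 - 2 / K) * ∫ x, f x ∂(Ξ t ω).1)) - 2 * (a ω *
        Real.exp (-((K + 1) * (1 + 1 / K) * (1 / K * ∫ x, f x ∂(Ξ t ω).1)))) + a ω ^ 2) ∂P ≤
        ∫ ω, 10 / K ∂P :=
      integral_mono ((hA.sub (hB.const_mul 2)).add ha2) (integrable_const _)
        fun ω => exp_quadratic_defect_le hK4 (hA0 ω)
    rw [e2] at h3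
    simp only [integral_const, probReal_univ, one_smul] at h3
    rw [← hKL]
    linarith

/-- Tightness passes from `ξ` to `Ξ`: for `f ≤ 1` one has `f / 2 ≤ 1 - exp (-f)`, and `1 - y² ≤ 2 (1
- y)` with `y = exp (-∫ f dΞ / 2)` removes the factor `1 / 2`. -/
theorem LevelSandwich.integral_one_sub_laplace_le (h_nonneg : ∀ k x, 0 ≤ h k x)
    (h_le_one : ∀ k x, h k x ≤ 1) (hξ : IsProcess ξ) (hΞ : IsProcess Ξ)
    (hs : LevelSandwich P ξ Ξ t 1 1 1) (hf : SubWeight h f) :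
    ∫ ω, (1 - (Ξ t ω).laplace f) ∂P ≤ 2 * ∫ ω, (1 - (ξ t ω).laplace 1 1 f) ∂P := by
  have hfd := hf.dominated
  have hai := integrable_loc_laplace (P := P) h_nonneg hfd (hΞ t)
  have hbi := integrable_level_laplace (P := P) h_nonneg hfd 1 one_pos (hξ t)
  have h1 := (hs _ hfd (fun _ => 1) stronglyMeasurable_const
    (fun _ => zero_le_one) ⟨1, fun _ => le_rfl⟩).2
  simp only [one_mul] at h1
  have hA0 : ∀ ω, 0 ≤ ∫ x, f x ∂(Ξ t ω).1 := fun ω => integral_nonneg hf.nonneg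
  have hAm : Measurable fun ω => ∫ x, f x ∂(Ξ t ω).1 :=
    (hfd.continuous_integral h_nonneg).measurable.comp (hΞ t)
  have hAm' : Measurable fun ω => ∫ x, (1 - Real.exp (-f x)) ∂(Ξ t ω).1 :=
    (hfd.one_sub_exp_neg.continuous_integral h_nonneg).measurable.comp (hΞ t)
  have h2 : ∫ ω, (1 - (Ξ t ω).laplace f) ∂P ≤
      ∫ ω, 2 * (1 - Real.exp (-∫ x, (1 - Real.exp (-f x)) ∂(Ξ t ω).1)) ∂P := by
    refine integral_mono ((integrable_const _).sub hai) (((integrable_const _).sub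
      (integrable_exp_neg hAm'.aestronglyMeasurable
        fun ω => hfd.integral_one_sub_exp_nonneg _)).const_mul 2) fun ω => ?_
    have h3 : 1 / 2 * ∫ x, f x ∂(Ξ t ω).1 ≤ ∫ x, (1 - Real.exp (-f x)) ∂(Ξ t ω).1 := by
      rw [← integral_const_mul]
      exact integral_mono ((hfd.integrable h_nonneg _).const_mul _)
        (hfd.one_sub_exp_neg.integrable h_nonneg _) fun x =>
          half_le_one_sub_exp_neg (hf.nonneg x) (hf.le_one h_le_one x)
    have h4 : Real.exp (-∫ x, (1 - Real.exp (-f x)) ∂(Ξ t ω).1) ≤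
        Real.exp (-(1 / 2 * ∫ x, f x ∂(Ξ t ω).1)) := Real.exp_le_exp.2 (neg_le_neg h3)
    have h5 : (Ξ t ω).laplace f = Real.exp (-(1 / 2 * ∫ x, f x ∂(Ξ t ω).1)) ^ 2 := by
      rw [LocMeasure.laplace, ← Real.exp_nat_mul]; congr 1; push_cast; ring
    simp only
    rw [h5]
    nlinarith [sq_nonneg (1 - Real.exp (-(1 / 2 * ∫ x, f x ∂(Ξ t ω).1)))]
  refine h2.trans ?_
  rw [integral_const_mul, integral_sub (integrable_const _)
    (integrable_exp_neg hAm'.aestronglyMeasurable fun ω => hfd.integral_one_sub_exp_nonneg _),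
    integral_sub (integrable_const _) hbi]
  have h6 : ∫ ω, (ξ t ω).laplace 1 1 f ∂P ≤
    ∫ ω, Real.exp (-∫ x, (1 - Real.exp (-f x)) ∂(Ξ t ω).1) ∂P := h1
  linarith

/-- Tightness passes back from `Ξ` to the level averages, uniformly in `K ≥ 1`. The constant is `(1
+ 1 / K)² ≤ 4`, taken out of the exponent by Bernoulli's inequality. -/
theorem LevelSandwich.integral_one_sub_laplace_levelAverage_le (h_nonneg : ∀ k x, 0 ≤ h k x)
    (hξ : IsProcess ξ)
    (hΞ : IsProcess Ξ) {K : ℝ} (hK : 1 ≤ K) (hK0 : 0 < K)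
    (hs : LevelSandwich P ξ Ξ t K 1 (1 / K)) (hf : SubWeight h f) :
    ∫ ω, (1 - (levelAverage hK0 (ξ t ω)).laplace f) ∂P ≤
      4 * ∫ ω, (1 - (Ξ t ω).laplace f) ∂P := by
  have hfd := hf.dominated
  have hZi : Integrable (fun ω => (levelAverage hK0 (ξ t ω)).laplace f) P :=
    integrable_loc_laplace h_nonneg hfd ((continuous_levelAverage hK0).measurable.comp (hξ t))
  have hai := integrable_loc_laplace (P := P) h_nonneg hfd (hΞ t)
  have hd := hfd.const_mul (by positivity : 0 ≤ 1 / K)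
  have h1 := (hs _ hd (fun _ => 1) stronglyMeasurable_const
    (fun _ => zero_le_one) ⟨1, fun _ => le_rfl⟩).1
  simp only [one_mul] at h1
  have hc : 0 ≤ (K + 1) * (1 + 1 / K) := by positivity
  have hAm' : Measurable fun ω => ∫ x, (1 - Real.exp (-(1 / K * f x))) ∂(Ξ t ω).1 :=
    (hd.one_sub_exp_neg.continuous_integral h_nonneg).measurable.comp (hΞ t)
  have hWi := integrable_exp_neg (P := P) (hAm'.const_mul ((K + 1) * (1 + 1 / K))).aestronglyMeasurable
    fun ω => mul_nonneg hc (hd.integral_one_sub_exp_nonneg _)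
  have h2 : ∫ ω, (1 - (levelAverage hK0 (ξ t ω)).laplace f) ∂P ≤ ∫ ω, (1 -
      Real.exp (-((K + 1) * (1 + 1 / K) * ∫ x, (1 - Real.exp (-(1 / K * f x))) ∂(Ξ t ω).1))) ∂P := by
    rw [integral_sub (integrable_const _) hZi, integral_sub (integrable_const _) hWi]
    have h3 : ∀ ω, (levelAverage hK0 (ξ t ω)).laplace f =
        Real.exp (-∫ z, 1 / K * f z.1 * levelCutoff K 1 z.2 ∂(ξ t ω).1) := fun ω =>
      laplace_levelAverage hK0 hf.continuous _
    simp_rw [h3]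
    linarith
  refine h2.trans ?_
  rw [← integral_const_mul]
  refine integral_mono ((integrable_const _).sub hWi) (((integrable_const _).sub hai).const_mul 4)
    fun ω => ?_
  have hA0 : 0 ≤ ∫ x, f x ∂(Ξ t ω).1 := integral_nonneg hf.nonneg
  have h4 : ∫ x, (1 - Real.exp (-(1 / K * f x))) ∂(Ξ t ω).1 ≤ 1 / K * ∫ x, f x ∂(Ξ t ω).1 := by
    rw [← integral_const_mul]
    refine integral_mono (hd.one_sub_exp_neg.integrable h_nonneg _)
      ((hfd.integrable h_nonneg _).const_mul _) fun x => ?_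
    linarith [Real.add_one_le_exp (-(1 / K * f x))]
  have h5 : (K + 1) * (1 + 1 / K) * ∫ x, (1 - Real.exp (-(1 / K * f x))) ∂(Ξ t ω).1 ≤
      4 * ∫ x, f x ∂(Ξ t ω).1 := by
    refine (mul_le_mul_of_nonneg_left h4 hc).trans ?_
    rw [← mul_assoc]
    refine mul_le_mul_of_nonneg_right ?_ hA0
    have hs1 : 1 / K ≤ 1 := by rw [div_le_one hK0]; exact hK
    have hs0 : 0 < 1 / K := by positivity
    have e : (K + 1) * (1 + 1 / K) * (1 / K) = (1 + 1 / K) * (1 + 1 / K) := by field_simp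
    rw [e]
    nlinarith
  have h6 : (Ξ t ω).laplace f ^ 4 ≤ Real.exp
      (-((K + 1) * (1 + 1 / K) * ∫ x, (1 - Real.exp (-(1 / K * f x))) ∂(Ξ t ω).1)) := by
    rw [LocMeasure.laplace, ← Real.exp_nat_mul]
    refine Real.exp_le_exp.2 ?_
    push_cast
    linarith
  have h7 := one_add_mul_le_pow (a := (Ξ t ω).laplace f - 1)
    (by linarith [(Ξ t ω).laplace_pos f]) 4
  simp only [add_sub_cancel] at h7
  push_cast at h7
  simp only
  linarith

end Estimates

end

section

/-! ### Compact containment -/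

/-- A Dini argument: one index that works for the limit `b` works for all large `n`, and
monotonicity lets it be increased to serve the finitely many others. -/
theorem exists_forall_le_of_antitone_of_tendsto {a : ℕ → ℕ → ℝ} {b : ℕ → ℝ}
    (hanti : ∀ n, Antitone (a n)) (ha : ∀ n, Tendsto (a n) atTop (𝓝 0))
    (hb : Tendsto b atTop (𝓝 0)) (hab : ∀ m, Tendsto (fun n => a n m) atTop (𝓝 (b m))) {ε : ℝ}
    (hε : 0 < ε) : ∃ m, ∀ n, a n m ≤ ε := by
  obtain ⟨m₀, hm₀⟩ := (hb.eventually (gt_mem_nhds hε)).exists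
  obtain ⟨N, hN⟩ := eventually_atTop.1 ((hab m₀).eventually (gt_mem_nhds hm₀))
  choose m hm using fun n => ((ha n).eventually (gt_mem_nhds hε)).exists
  refine ⟨max m₀ ((Finset.range N).sup m), fun n => ?_⟩
  rcases lt_or_ge n N with hn | hn
  · exact (hanti n ((Finset.le_sup (f := m) (Finset.mem_range.2 hn)).trans (le_max_right _ _))).trans
      (hm n).le
  · exact (hanti n (le_max_left _ _)).trans (hN n hn).le

theorem integral_abs_sub_le_add {Ω : Type*} [MeasurableSpace Ω] {P : Measure Ω} {u v w : Ω → ℝ}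
    (hu : Integrable u P) (hv : Integrable v P) (hw : Integrable w P) :
    ∫ ω, |u ω - v ω| ∂P ≤ ∫ ω, |u ω - w ω| ∂P + ∫ ω, |v ω - w ω| ∂P := by
  refine le_trans ?_ (integral_add (hu.sub hw).abs (hv.sub hw).abs).le
  refine integral_mono (hu.sub hv).abs ((hu.sub hw).abs.add (hv.sub hw).abs) fun ω => ?_
  simp only [Pi.sub_apply]
  rw [abs_sub_comm (v ω)]
  exact abs_sub_le _ _ _

section Containment

variable {S : Type*} [TopologicalSpace S] [PolishSpace S] [MeasurableSpace S]
  [BorelSpace S] {h : ℕ → S →ᵇ ℝ}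

/-- Laplace bounds with constants `c` for the test functions `q` force a random measure into the
compact set `C` up to probability `ε`. -/
structure TightControl (C : Set (LocMeasure h)) (q : ℕ × ℕ → S → ℝ) (c : ℕ × ℕ → ℝ)
    (ε : ℝ) : Prop where
  isCompact : IsCompact C
  subWeight : ∀ i, SubWeight h (q i)
  mem : ∀ ν : LocMeasure h, (∀ i, ∫ x, q i x ∂ν.1 ≤ (1 / 2) ^ i.2) → ν ∈ C
  tsum_le : ∑' i, ENNReal.ofReal (4 * c i / (1 - Real.exp (-(1 / 2) ^ i.2))) ≤ ENNReal.ofReal ε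

/-- Leaving `C` violates one of countably many integral bounds, so Markov's inequality and a union
bound suffice. The allowance `4 * c i` lets the same `C` serve the level averages, whose bounds are
worse by a factor `4`. -/
theorem TightControl.measure_notMem_le (h_nonneg : ∀ k x, 0 ≤ h k x) {C : Set (LocMeasure h)}
    {q : ℕ × ℕ → S → ℝ} {c : ℕ × ℕ → ℝ} {ε : ℝ} (hT : TightControl C q c ε) {Ω : Type*}
    [MeasurableSpace Ω] {P : Measure Ω} [IsProbabilityMeasure P] {Y : Ω → LocMeasure h}
    (hY : Measurable Y) (hle : ∀ i, ∫ ω, (1 - (Y ω).laplace (q i)) ∂P ≤ 4 * c i) :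
    P {ω | Y ω ∉ C} ≤ ENNReal.ofReal ε := by
  refine le_trans ?_ hT.tsum_le
  have hsub : {ω | Y ω ∉ C} ⊆ ⋃ i : ℕ × ℕ,
      {ω | 1 - Real.exp (-(1 / 2) ^ i.2) ≤ 1 - (Y ω).laplace (q i)} := by
    intro ω hω
    by_contra hcon
    refine hω (hT.mem _ fun i => ?_)
    have hi : ¬ (1 - Real.exp (-(1 / 2) ^ i.2) ≤ 1 - (Y ω).laplace (q i)) := fun hi =>
      hcon (Set.mem_iUnion.2 ⟨i, hi⟩)
    have h1 : Real.exp (-(1 / 2) ^ i.2) < Real.exp (-∫ x, q i x ∂(Y ω).1) := by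
      have : (Y ω).laplace (q i) = Real.exp (-∫ x, q i x ∂(Y ω).1) := rfl
      linarith
    linarith [Real.exp_lt_exp.1 h1]
  refine (measure_mono hsub).trans ((measure_iUnion_le _).trans (ENNReal.tsum_le_tsum fun i => ?_))
  have hd := (hT.subWeight i).dominated
  have hpos : 0 < 1 - Real.exp (-(1 / 2) ^ i.2) := by
    have : Real.exp (-(1 / 2) ^ i.2) < 1 := Real.exp_lt_one_iff.2 (by
      rw [neg_lt_zero]; positivity)
    linarith
  have hM := mul_meas_ge_le_integral_of_nonneg (μ := P)
    (f := fun ω => 1 - (Y ω).laplace (q i))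
    (ae_of_all _ fun ω => sub_nonneg.2 (hd.laplace_le_one _))
    ((integrable_const _).sub (integrable_loc_laplace h_nonneg hd hY))
    (1 - Real.exp (-(1 / 2) ^ i.2))
  rw [← ofReal_measureReal]
  refine ENNReal.ofReal_le_ofReal ?_
  rw [le_div_iff₀ hpos, mul_comm]
  exact hM.trans (hle i)

end Containment

/-! ### The limiting procedure -/

/-- The fixed sequence of averages over levels, `16 ^ (j + 1)` being the number of levels. -/
noncomputable def levelMean {S : Type*} [TopologicalSpace S] [SecondCountableTopology S]
    [MeasurableSpace S] [OpensMeasurableSpace S] {h : ℕ → S →ᵇ ℝ} (j : ℕ) :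
    LevelMeasure h → LocMeasure h :=
  levelAverage (K := ((4 : ℝ) ^ (j + 1)) ^ 2) (by positivity)

theorem continuous_levelMean {S : Type*} [TopologicalSpace S] [SecondCountableTopology S]
    [MeasurableSpace S] [OpensMeasurableSpace S] {h : ℕ → S →ᵇ ℝ} (j : ℕ) :
    Continuous (levelMean j : LevelMeasure h → LocMeasure h) :=
  continuous_levelAverage _

/-- The common setting: convergence of the finite-dimensional distributions of `ξ' n`, and the
sandwich bounds for `(ξ' n, Ξ' n)` for all large `n`. -/
structure LevelApproximation {S : Type*} [TopologicalSpace S] [PolishSpace S] [MeasurableSpace S]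
    [BorelSpace S] (h : ℕ → S →ᵇ ℝ) {Ω' : ℕ → Type*} [∀ n, MeasurableSpace (Ω' n)]
    (P' : ∀ n, Measure (Ω' n)) {Ω : Type*} [MeasurableSpace Ω] (P : Measure Ω)
    (ξ' : ∀ n, ℝ≥0 → Ω' n → LevelMeasure h) (Ξ' : ∀ n, ℝ≥0 → Ω' n → LocMeasure h)
    (ξ : ℝ≥0 → Ω → LevelMeasure h) : Prop where
  nonneg : ∀ k x, 0 ≤ h k x
  le_one : ∀ k x, h k x ≤ 1
  pos : ∀ x, ∃ k, 0 < h k x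
  process_ξ' : ∀ n, IsProcess (ξ' n)
  process_Ξ' : ∀ n, IsProcess (Ξ' n)
  process_ξ : IsProcess ξ
  conv : FDDConverges P' ξ' P ξ
  sandwich : ∀ K : ℝ, 0 < K → ∀ δ : ℝ, 0 < δ → ∀ η : ℝ, 0 < η →
    ∀ᶠ n in atTop, ∀ t, LevelSandwich (P' n) (ξ' n) (Ξ' n) t K δ η

namespace LevelApproximation

variable {S : Type*} [TopologicalSpace S] [PolishSpace S] [MeasurableSpace S]
  [BorelSpace S] {h : ℕ → S →ᵇ ℝ} {Ω' : ℕ → Type*} [∀ n, MeasurableSpace (Ω' n)]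
  {P' : ∀ n, Measure (Ω' n)} [∀ n, IsProbabilityMeasure (P' n)] {Ω : Type*} [MeasurableSpace Ω]
  {P : Measure Ω} [IsProbabilityMeasure P]
  {ξ' : ∀ n, ℝ≥0 → Ω' n → LevelMeasure h} {Ξ' : ∀ n, ℝ≥0 → Ω' n → LocMeasure h}
  {ξ : ℝ≥0 → Ω → LevelMeasure h}

theorem tendsto_integral (H : LevelApproximation h P' P ξ' Ξ' ξ) (t : ℝ≥0)
    {W : LevelMeasure h → ℝ} (hW : Continuous W) {B : ℝ} (hB : ∀ μ, |W μ| ≤ B) :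
    Tendsto (fun n => ∫ ω, W (ξ' n t ω) ∂(P' n)) atTop (𝓝 (∫ ω, W (ξ t ω) ∂P)) :=
  H.conv 1 (fun _ => t) (BoundedContinuousFunction.ofNormedAddCommGroup
    (fun y : Fin 1 → LevelMeasure h => W (y 0)) (hW.comp (continuous_apply 0)) B fun _ => hB _)

theorem tendsto_one_sub_laplace_zero (h_nonneg : ∀ k x, 0 ≤ h k x) {G : ℕ → S → ℝ}
    (hG : ∀ m, SubWeight h (G m)) (hanti : ∀ x, Antitone fun m => G m x)
    (hlim : ∀ x, Tendsto (fun m => G m x) atTop (𝓝 0)) {Ω₁ : Type*} [MeasurableSpace Ω₁]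
    {P₁ : Measure Ω₁} [IsProbabilityMeasure P₁] {Y : Ω₁ → LevelMeasure h} (hY : Measurable Y) :
    Antitone (fun m => ∫ ω, (1 - (Y ω).laplace 1 1 (G m)) ∂P₁) ∧
      Tendsto (fun m => ∫ ω, (1 - (Y ω).laplace 1 1 (G m)) ∂P₁) atTop (𝓝 0) := by
  have hd := fun m => (hG m).dominated
  have hi := fun m => integrable_level_laplace (P := P₁) h_nonneg (hd m) 1 one_pos hY
  constructor
  · intro a b hab
    refine integral_mono ((integrable_const _).sub (hi b)) ((integrable_const _).sub (hi a))
      fun ω => sub_le_sub_left (Real.exp_le_exp.2 (neg_le_neg ?_)) _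
    exact integral_mono ((hd b).integrable_mul_levelCutoff h_nonneg 1 one_pos _)
      ((hd a).integrable_mul_levelCutoff h_nonneg 1 one_pos _) fun z =>
        mul_le_mul_of_nonneg_right (hanti z.1 hab) (levelCutoff_nonneg _ _ _)
  · have := tendsto_integral_of_dominated_convergence (μ := P₁)
      (F := fun m ω => 1 - (Y ω).laplace 1 1 (G m)) (f := fun _ => (0 : ℝ)) (fun _ => (1 : ℝ))
      (fun m => ((integrable_const _).sub (hi m)).1) (integrable_const _)
      (fun m => ae_of_all _ fun ω => ?_) (ae_of_all _ fun ω => ?_)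
    · simpa using this
    · rw [Real.norm_of_nonneg (sub_nonneg.2 ((hd m).level_laplace_le_one 1 1 _))]
      linarith [(Y ω).laplace_pos 1 1 (G m)]
    · have h1 : Tendsto (fun m => ∫ z, G m z.1 * levelCutoff 1 1 z.2 ∂(Y ω).1) atTop (𝓝 0) := by
        have := tendsto_integral_of_dominated_convergence (μ := (Y ω).1)
          (F := fun m (z : S × ℝ≥0) => G m z.1 * levelCutoff 1 1 z.2) (f := fun _ => (0 : ℝ))
          (fun z => G 0 z.1 * levelCutoff 1 1 z.2)
          (fun m => ((hd m).integrable_mul_levelCutoff h_nonneg 1 one_pos _).1)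
          ((hd 0).integrable_mul_levelCutoff h_nonneg 1 one_pos _)
          (fun m => ae_of_all _ fun z => ?_) (ae_of_all _ fun z => ?_)
        · simpa using this
        · rw [Real.norm_of_nonneg ((hd m).mul_levelCutoff_nonneg 1 1 z)]
          exact mul_le_mul_of_nonneg_right (hanti z.1 (Nat.zero_le m)) (levelCutoff_nonneg _ _ _)
        · simpa using (hlim z.1).mul_const (levelCutoff 1 1 z.2)
      have h2 := (Real.continuous_exp.tendsto _).comp h1.neg
      simpa [LevelMeasure.laplace, Function.comp_def] using h2.const_sub 1

theorem exists_forall_one_sub_laplace_le (H : LevelApproximation h P' P ξ' Ξ' ξ) {N : ℕ}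
    (hN : ∀ n ≥ N, ∀ t, LevelSandwich (P' n) (ξ' n) (Ξ' n) t 1 1 1) (t : ℝ≥0) {G : ℕ → S → ℝ}
    (hG : ∀ m, SubWeight h (G m)) (hanti : ∀ x, Antitone fun m => G m x)
    (hlim : ∀ x, Tendsto (fun m => G m x) atTop (𝓝 0)) {ε : ℝ} (hε : 0 < ε) :
    ∃ m, ∀ n ≥ N, ∫ ω, (1 - (Ξ' n t ω).laplace (G m)) ∂(P' n) ≤ ε := by
  have hz := fun n => tendsto_one_sub_laplace_zero H.nonneg hG hanti hlim (P₁ := P' n)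
    (H.process_ξ' n t)
  obtain ⟨m, hm⟩ := exists_forall_le_of_antitone_of_tendsto (fun n => (hz n).1)
    (fun n => (hz n).2)
    (tendsto_one_sub_laplace_zero H.nonneg hG hanti hlim (P₁ := P) (H.process_ξ t)).2
    (fun m => H.tendsto_integral t (W := fun μ => 1 - μ.laplace 1 1 (G m))
      (continuous_const.sub ((hG m).dominated.continuous_level_laplace H.nonneg 1 one_pos))
      (B := 1) fun μ => by
        rw [abs_of_nonneg (sub_nonneg.2 ((hG m).dominated.level_laplace_le_one 1 1 _))]
        linarith [μ.laplace_pos 1 1 (G m)]) (half_pos hε)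
  refine ⟨m, fun n hn => ?_⟩
  have := (hN n hn t).integral_one_sub_laplace_le H.nonneg H.le_one (H.process_ξ' n)
    (H.process_Ξ' n) (hG m)
  linarith [hm n]

theorem exists_tightControl (H : LevelApproximation h P' P ξ' Ξ' ξ) {N : ℕ}
    (hN : ∀ n ≥ N, ∀ t, LevelSandwich (P' n) (ξ' n) (Ξ' n) t 1 1 1) (t : ℝ≥0) {ε : ℝ}
    (hε : 0 < ε) : ∃ (C : Set (LocMeasure h)) (q : ℕ × ℕ → S → ℝ) (c : ℕ × ℕ → ℝ),
      TightControl C q c ε ∧ (∀ i, 0 ≤ c i) ∧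
        ∀ n ≥ N, ∀ i, ∫ ω, (1 - (Ξ' n t ω).laplace (q i)) ∂(P' n) ≤ c i := by
  obtain ⟨G, hG, hanti, hlim, hC⟩ := LocMeasure.exists_tightness_family H.nonneg H.le_one H.pos
  obtain ⟨e, he0, hesum⟩ := ENNReal.exists_pos_sum_of_countable
    (ENNReal.ofReal_pos.2 hε).ne' (ℕ × ℕ)
  have hpos : ∀ i : ℕ × ℕ, 0 < 1 - Real.exp (-(1 / 2) ^ i.2) := fun i => by
    have : Real.exp (-(1 / 2) ^ i.2) < 1 := Real.exp_lt_one_iff.2 (by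
      rw [neg_lt_zero]; positivity)
    linarith
  -- These constants make the terms of the series in `TightControl` equal to `e i`, whose sum is
  -- below `ε`.
  have hc : ∀ i, 0 < (e i : ℝ) * (1 - Real.exp (-(1 / 2) ^ i.2)) / 4 := fun i =>
    div_pos (mul_pos (he0 i) (hpos i)) (by norm_num)
  choose m hm using fun i => H.exists_forall_one_sub_laplace_le hN t (hG i) (hanti i) (hlim i) (hc i)
  obtain ⟨C, hCc, hCm⟩ := hC m
  refine ⟨C, fun i => G i (m i), fun i => (e i : ℝ) * (1 - Real.exp (-(1 / 2) ^ i.2)) / 4,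
    ⟨hCc, fun i => hG i _, hCm, ?_⟩, fun i => (hc i).le, fun n hn i => hm i n hn⟩
  refine le_trans (le_of_eq (tsum_congr fun i => ?_)) hesum.le
  rw [mul_div_cancel₀ _ (by norm_num : (4 : ℝ) ≠ 0), mul_div_cancel_right₀ _ (hpos i).ne',
    ENNReal.ofReal_coe_nnreal]

/-- The sets depend neither on `n` nor on the number `j` of the level mean. For the limit `ξ` the
Laplace bounds themselves pass to the limit, and the Markov argument is repeated. -/
theorem exists_compact_containment (H : LevelApproximation h P' P ξ' Ξ' ξ) :
    ∃ C : ℝ≥0 → ℕ → Set (LocMeasure h), (∀ t l, IsCompact (C t l)) ∧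
      (∀ᶠ n in atTop, ∀ t l, P' n {ω | Ξ' n t ω ∉ C t l} ≤ ENNReal.ofReal ((1 / 2) ^ l)) ∧
      (∀ j, ∀ᶠ n in atTop, ∀ t l,
        P' n {ω | levelMean j (ξ' n t ω) ∉ C t l} ≤ ENNReal.ofReal ((1 / 2) ^ l)) ∧
      ∀ j t l, P {ω | levelMean j (ξ t ω) ∉ C t l} ≤ ENNReal.ofReal ((1 / 2) ^ l) := by
  obtain ⟨N, hN⟩ := eventually_atTop.1 (H.sandwich 1 one_pos 1 one_pos 1 one_pos)
  choose C q c hT hc hle using fun (t : ℝ≥0) (l : ℕ) =>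
    H.exists_tightControl hN t (by positivity : (0 : ℝ) < (1 / 2) ^ l)
  have hmean : ∀ j, ∀ᶠ n in atTop, ∀ t l i,
      ∫ ω, (1 - (levelMean j (ξ' n t ω)).laplace (q t l i)) ∂(P' n) ≤ 4 * c t l i := fun j => by
    have hK : (0 : ℝ) < ((4 : ℝ) ^ (j + 1)) ^ 2 := by positivity
    have hK1 : (1 : ℝ) ≤ ((4 : ℝ) ^ (j + 1)) ^ 2 :=
      one_le_pow₀ (one_le_pow₀ (by norm_num))
    filter_upwards [H.sandwich _ hK 1 one_pos (1 / ((4 : ℝ) ^ (j + 1)) ^ 2) (by positivity),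
      eventually_ge_atTop N] with n hn hnN t l i
    refine ((hn t).integral_one_sub_laplace_levelAverage_le H.nonneg (H.process_ξ' n)
      (H.process_Ξ' n) hK1 hK ((hT t l).subWeight i)).trans ?_
    linarith [hle t l n hnN i]
  refine ⟨C, fun t l => (hT t l).isCompact, ?_, fun j => ?_, fun j t l => ?_⟩
  · filter_upwards [eventually_ge_atTop N] with n hn t l
    exact (hT t l).measure_notMem_le H.nonneg (H.process_Ξ' n t) fun i =>
      (hle t l n hn i).trans (by linarith [hc t l i])
  · filter_upwards [hmean j] with n hn t l
    exact (hT t l).measure_notMem_le H.nonneg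
      ((continuous_levelMean j).measurable.comp (H.process_ξ' n t)) (hn t l)
  · refine (hT t l).measure_notMem_le H.nonneg
      ((continuous_levelMean j).measurable.comp (H.process_ξ t)) fun i => ?_
    have hd := ((hT t l).subWeight i).dominated
    refine le_of_tendsto (H.tendsto_integral t
      (W := fun μ => 1 - (levelMean j μ).laplace (q t l i))
      (continuous_const.sub ((hd.continuous_laplace H.nonneg).comp (continuous_levelMean j)))
      (B := 1) fun μ => ?_) ((hmean j).mono fun n hn => hn t l i)
    rw [abs_of_nonneg (sub_nonneg.2 (hd.laplace_le_one _))]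
    linarith [(levelMean j μ).laplace_pos (q t l i)]

theorem eventually_integral_abs_levelMean_sub_le (H : LevelApproximation h P' P ξ' Ξ' ξ) (j : ℕ) :
    ∀ᶠ n in atTop, ∀ t, ∀ f, SubWeight h f →
      ∫ ω, |(levelMean j (ξ' n t ω)).laplace f - (Ξ' n t ω).laplace f| ∂(P' n) ≤
        6 / 4 ^ (j + 1) := by
  have hK : (0 : ℝ) < ((4 : ℝ) ^ (j + 1)) ^ 2 := by positivity
  have hL : (2 : ℝ) ≤ (4 : ℝ) ^ (j + 1) := by
    have : (1 : ℝ) ≤ 4 ^ j := one_le_pow₀ (by norm_num)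
    rw [pow_succ]; linarith
  filter_upwards [H.sandwich _ hK 1 one_pos (1 / ((4 : ℝ) ^ (j + 1)) ^ 2) (by positivity)]
    with n hn t f hf
  exact (hn t).integral_abs_laplace_sub_le H.nonneg H.le_one (H.process_ξ' n) (H.process_Ξ' n) hL
    rfl hK hf

/-- Before the limit both means are close to `Ξ' n`. Comparing them with each other eliminates `Ξ'
n` and leaves a continuous functional of `ξ' n t` alone, to which the convergence applies. -/
theorem integral_abs_levelMean_sub_le (H : LevelApproximation h P' P ξ' Ξ' ξ) (j j' : ℕ) (t : ℝ≥0)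
    {f : S → ℝ} (hf : SubWeight h f) :
    ∫ ω, |(levelMean j (ξ t ω)).laplace f - (levelMean j' (ξ t ω)).laplace f| ∂P ≤
      6 / 4 ^ (j + 1) + 6 / 4 ^ (j' + 1) := by
  have hc := hf.dominated.continuous_laplace (h := h) H.nonneg
  refine le_of_tendsto (H.tendsto_integral t
    (W := fun μ => |(levelMean j μ).laplace f - (levelMean j' μ).laplace f|)
    ((hc.comp (continuous_levelMean j)).sub (hc.comp (continuous_levelMean j'))).abs (B := 2)
    fun μ => ?_) ?_
  · rw [abs_abs]
    refine (abs_sub _ _).trans ?_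
    linarith [hf.dominated.abs_laplace_le_one (levelMean j μ),
      hf.dominated.abs_laplace_le_one (levelMean j' μ)]
  · filter_upwards [H.eventually_integral_abs_levelMean_sub_le j,
      H.eventually_integral_abs_levelMean_sub_le j'] with n h1 h2
    have hi : ∀ j, Integrable (fun ω => (levelMean j (ξ' n t ω)).laplace f) (P' n) := fun j =>
      integrable_loc_laplace H.nonneg hf.dominated
        ((continuous_levelMean j).measurable.comp (H.process_ξ' n t))
    have hiΞ := integrable_loc_laplace (P := P' n) H.nonneg hf.dominated (H.process_Ξ' n t)
    exact (integral_abs_sub_le_add (hi j) (hi j') hiΞ).trans (add_le_add (h1 t f hf) (h2 t f hf))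

end LevelApproximation

end

section

/-! ### Construction of the limiting random measure -/

theorem ae_exists_tendsto_of_summable_integral {Ω : Type*} [MeasurableSpace Ω] {P : Measure Ω}
    {X : ℕ → Ω → ℝ} (hX : ∀ j, Integrable (X j) P) {r : ℕ → ℝ} (hr : Summable r)
    (hle : ∀ j, ∫ ω, |X j ω - X (j + 1) ω| ∂P ≤ r j) :
    ∀ᵐ ω ∂P, ∃ l, Tendsto (fun j => X j ω) atTop (𝓝 l) := by
  have hi : ∀ j, Integrable (fun ω => |X j ω - X (j + 1) ω|) P := fun j =>
    ((hX j).sub (hX (j + 1))).abs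
  have hr0 : ∀ j, 0 ≤ r j := fun j => (integral_nonneg fun ω => abs_nonneg _).trans (hle j)
  have hm : ∀ j, AEMeasurable (fun ω => ENNReal.ofReal |X j ω - X (j + 1) ω|) P := fun j =>
    (hi j).aemeasurable.ennreal_ofReal
  have hfin : ∫⁻ ω, ∑' j, ENNReal.ofReal |X j ω - X (j + 1) ω| ∂P ≠ ∞ := by
    rw [lintegral_tsum hm]
    refine ne_top_of_le_ne_top ?_ (ENNReal.tsum_le_tsum (g := fun j => ENNReal.ofReal (r j))
      fun j => ?_)
    · rw [← ENNReal.ofReal_tsum_of_nonneg hr0 hr]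
      exact ENNReal.ofReal_ne_top
    · rw [← ofReal_integral_eq_lintegral_ofReal (hi j) (ae_of_all _ fun ω => abs_nonneg _)]
      exact ENNReal.ofReal_le_ofReal (hle j)
  filter_upwards [ae_lt_top' (AEMeasurable.tsum hm) hfin] with ω hω
  refine cauchySeq_tendsto_of_complete (cauchySeq_of_summable_dist ?_)
  have := ENNReal.summable_toReal hω.ne
  simpa [ENNReal.toReal_ofReal, Real.dist_eq] using this

theorem tendsto_ofReal_half_pow :
    Tendsto (fun l : ℕ => ENNReal.ofReal ((1 / 2) ^ l)) atTop (𝓝 0) := by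
  have := ENNReal.tendsto_ofReal
    (tendsto_pow_atTop_nhds_zero_of_lt_one (by norm_num : (0 : ℝ) ≤ 1 / 2) (by norm_num))
  simpa using this

theorem ae_mem_iUnion_of_measure_le {Ω E : Type*} [MeasurableSpace Ω] {P : Measure Ω} {X : Ω → E}
    {C : ℕ → Set E} (hC : ∀ l, P {ω | X ω ∉ C l} ≤ ENNReal.ofReal ((1 / 2) ^ l)) :
    ∀ᵐ ω ∂P, X ω ∈ ⋃ l, C l := by
  rw [ae_iff]
  refine le_antisymm (ge_of_tendsto' tendsto_ofReal_half_pow fun l => ?_) zero_le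
  exact (measure_mono fun ω (hω : X ω ∉ ⋃ l, C l) => fun hl => hω (Set.mem_iUnion.2 ⟨l, hl⟩)).trans
    (hC l)

theorem measure_limit_notMem_le {Ω B : Type*} [MeasurableSpace Ω] [TopologicalSpace B]
    {P : Measure Ω} {X : ℕ → Ω → B} {L : Ω → B}
    (hL : ∀ᵐ ω ∂P, Tendsto (fun j => X j ω) atTop (𝓝 (L ω))) {K : Set B} (hK : IsClosed K)
    {a : ℝ≥0∞} (ha : ∀ j, P {ω | X j ω ∉ K} ≤ a) : P {ω | L ω ∉ K} ≤ a := by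
  have hsub : {ω | L ω ∉ K} ≤ᵐ[P] (⋃ N : ℕ, ⋂ j ∈ Set.Ici N, {ω | X j ω ∉ K} : Set Ω) := by
    filter_upwards [hL] with ω hω hLω
    obtain ⟨N, hN⟩ := eventually_atTop.1 (hω.eventually (hK.isOpen_compl.mem_nhds hLω))
    exact Set.mem_iUnion.2 ⟨N, Set.mem_iInter₂.2 fun j hj => hN j hj⟩
  refine (measure_mono_ae hsub).trans ?_
  rw [Monotone.measure_iUnion fun N M hNM =>
    Set.biInter_mono (Set.Ici_subset_Ici.2 hNM) fun j _ => subset_rfl]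
  exact iSup_le fun N => (measure_mono (Set.biInter_subset_of_mem Set.self_mem_Ici)).trans (ha N)

/-- The sequence of Laplace functionals of a family of test functions. -/
noncomputable def LocMeasure.laplaceVec {S : Type*} [TopologicalSpace S] [MeasurableSpace S]
    {h : ℕ → S →ᵇ ℝ} (T : ℕ → S → ℝ) (ν : LocMeasure h) (i : ℕ) : ℝ :=
  ν.laplace (T i)

namespace LevelApproximation

variable {S : Type*} [TopologicalSpace S] [PolishSpace S] [MeasurableSpace S]
  [BorelSpace S] {h : ℕ → S →ᵇ ℝ} {Ω' : ℕ → Type*} [∀ n, MeasurableSpace (Ω' n)]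
  {P' : ∀ n, Measure (Ω' n)} [∀ n, IsProbabilityMeasure (P' n)] {Ω : Type*} [MeasurableSpace Ω]
  {P : Measure Ω} [IsProbabilityMeasure P]
  {ξ' : ∀ n, ℝ≥0 → Ω' n → LevelMeasure h} {Ξ' : ∀ n, ℝ≥0 → Ω' n → LocMeasure h}
  {ξ : ℝ≥0 → Ω → LevelMeasure h}

/-- The `L¹` distances of successive level means are summable, so the Laplace vectors converge
almost surely in `ℕ → ℝ`. Up to probability `(1 / 2) ^ l` the limit stays in the compact image of `C
l`; hence it is almost surely the Laplace vector of a measure, recovered by a measurable inverse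
`Ψ`. -/
theorem exists_limit_measure (H : LevelApproximation h P' P ξ' Ξ' ξ) {T : ℕ → S → ℝ}
    (hT : ∀ i, SubWeight h (T i))
    (hinj : Function.Injective (LocMeasure.laplaceVec T : LocMeasure h → ℕ → ℝ)) (t : ℝ≥0)
    {C : ℕ → Set (LocMeasure h)} (hC : ∀ l, IsCompact (C l))
    (hP : ∀ j l, P {ω | levelMean j (ξ t ω) ∉ C l} ≤ ENNReal.ofReal ((1 / 2) ^ l)) :
    ∃ (X : Ω → LocMeasure h) (Ψ : (ℕ → ℝ) → LocMeasure h), Measurable X ∧ Measurable Ψ ∧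
      (∀ ω, Ψ (LocMeasure.laplaceVec T (X ω)) = X ω) ∧
      (∀ l, P {ω | X ω ∉ C l} ≤ ENNReal.ofReal ((1 / 2) ^ l)) ∧
      ∀ i j, ∫ ω, |(levelMean j (ξ t ω)).laplace (T i) - (X ω).laplace (T i)| ∂P ≤
        12 / 4 ^ (j + 1) := by
  have hd := fun i => (hT i).dominated
  have hΦ : Continuous (LocMeasure.laplaceVec T : LocMeasure h → ℕ → ℝ) :=
    continuous_pi fun i => (hd i).continuous_laplace H.nonneg
  have hZm : ∀ j, Measurable fun ω => levelMean j (ξ t ω) := fun j =>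
    (continuous_levelMean j).measurable.comp (H.process_ξ t)
  have hZi := fun i j => integrable_loc_laplace (P := P) H.nonneg (hd i) (hZm j)
  have hsum : Summable fun j : ℕ => (6 : ℝ) / 4 ^ (j + 1) + 6 / 4 ^ (j + 1 + 1) := by
    have : Summable fun j : ℕ => (1 / 4 : ℝ) ^ j :=
      summable_geometric_of_lt_one (by norm_num) (by norm_num)
    refine (this.mul_left (6 / 4 + 6 / 16)).congr fun j => ?_
    rw [pow_succ, pow_succ, pow_succ, one_div_pow]
    field_simp
    ring
  have hae : ∀ᵐ ω ∂P, ∃ l, Tendsto (fun j => LocMeasure.laplaceVec T (levelMean j (ξ t ω))) atTop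
      (𝓝 l) := by
    have := ae_all_iff.2 fun i => ae_exists_tendsto_of_summable_integral (hZi i) hsum
      fun j => H.integral_abs_levelMean_sub_le j (j + 1) t (hT i)
    filter_upwards [this] with ω hω
    choose l hl using hω
    exact ⟨l, tendsto_pi_nhds.2 hl⟩
  obtain ⟨L, hLm, hL⟩ := measurable_limit_of_tendsto_metrizable_ae
    (fun j => (hΦ.measurable.comp (hZm j)).aemeasurable) hae
  have hLC : ∀ l, P {ω | L ω ∉ LocMeasure.laplaceVec T '' C l} ≤ ENNReal.ofReal ((1 / 2) ^ l) :=
    fun l => measure_limit_notMem_le hL ((hC l).image hΦ).isClosed fun j =>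
      (measure_mono fun ω (hω : LocMeasure.laplaceVec T (levelMean j (ξ t ω)) ∉
          LocMeasure.laplaceVec T '' C l)
        (hmem : levelMean j (ξ t ω) ∈ C l) => hω ⟨_, hmem, rfl⟩).trans (hP j l)
  let ν₀ : LocMeasure h := ⟨0, fun k => by simp⟩
  -- Adjoining the default value `ν₀` to the σ-compact set makes `Ψ` invert the Laplace vector of `X
  -- ω` for every `ω`, not just almost surely.
  let D : Option ℕ → Set (LocMeasure h) := fun o => o.elim {ν₀} C
  have hD : ∀ o, IsCompact (D o) := fun o => by
    cases o with
    | none => exact isCompact_singleton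
    | some l => exact hC l
  obtain ⟨Ψ, hΨm, hΨ, hΨr⟩ := exists_measurable_comp_eq hΦ hinj continuous_id hD ν₀
  have hΨC : ∀ l, ∀ ω, L ω ∈ LocMeasure.laplaceVec T '' C l →
      Ψ (L ω) ∈ C l ∧ LocMeasure.laplaceVec T (Ψ (L ω)) = L ω := by
    rintro l ω ⟨ν, hν, hνL⟩
    rw [← hνL, hΨ ν (Set.mem_iUnion.2 ⟨some l, hν⟩)]
    exact ⟨hν, rfl⟩
  refine ⟨fun ω => Ψ (L ω), Ψ, hΨm.comp hLm, hΨm, fun ω => ?_, fun l => ?_, fun i j => ?_⟩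
  · refine hΨ _ ?_
    rcases hΨr (L ω) with h0 | ⟨ν, hν, hνL⟩
    · exact Set.mem_iUnion.2 ⟨none, h0⟩
    · have hνL' : ν = Ψ (L ω) := hνL
      exact Set.mem_of_eq_of_mem hνL'.symm hν
  · exact (measure_mono fun ω (hω : Ψ (L ω) ∉ C l)
      (hmem : L ω ∈ LocMeasure.laplaceVec T '' C l) => hω (hΨC l ω hmem).1).trans (hLC l)
  · have hXL : ∀ᵐ ω ∂P, LocMeasure.laplaceVec T (Ψ (L ω)) = L ω := by
      filter_upwards [ae_mem_iUnion_of_measure_le hLC] with ω hω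
      obtain ⟨l, hl⟩ := Set.mem_iUnion.1 hω
      exact (hΨC l ω hl).2
    have hconv : Tendsto (fun j' => ∫ ω, |(levelMean j (ξ t ω)).laplace (T i) -
        (levelMean j' (ξ t ω)).laplace (T i)| ∂P) atTop
        (𝓝 (∫ ω, |(levelMean j (ξ t ω)).laplace (T i) - (Ψ (L ω)).laplace (T i)| ∂P)) := by
      refine tendsto_integral_of_dominated_convergence (fun _ => 2)
        (fun j' => ((hZi i j).sub (hZi i j')).abs.1) (integrable_const _)
        (fun j' => ae_of_all _ fun ω => ?_) ?_
      · rw [Real.norm_eq_abs, abs_abs]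
        refine (abs_sub _ _).trans ?_
        linarith [(hd i).abs_laplace_le_one (levelMean j (ξ t ω)),
          (hd i).abs_laplace_le_one (levelMean j' (ξ t ω))]
      · filter_upwards [hL, hXL] with ω h1 h2
        have h3 := tendsto_pi_nhds.1 h1 i
        rw [← h2] at h3
        exact (tendsto_const_nhds.sub h3).abs
    refine le_of_tendsto hconv ?_
    filter_upwards [eventually_ge_atTop j] with j' hj'
    refine (H.integral_abs_levelMean_sub_le j j' t (hT i)).trans ?_
    have : (6 : ℝ) / 4 ^ (j' + 1) ≤ 6 / 4 ^ (j + 1) :=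
      div_le_div_of_nonneg_left (by norm_num) (by positivity)
        (pow_le_pow_right₀ (by norm_num) (by omega))
    have e : (12 : ℝ) / 4 ^ (j + 1) = 6 / 4 ^ (j + 1) + 6 / 4 ^ (j + 1) := by ring
    rw [e]
    linarith

end LevelApproximation

end

section

/-! ### Joint convergence -/

/-! ### Vectors of random measures. -/

section Vectors

variable {S : Type*} [TopologicalSpace S] [PolishSpace S] [MeasurableSpace S]
  [BorelSpace S] {h : ℕ → S →ᵇ ℝ}

/-- Laplace functionals of a vector of measures. -/
noncomputable def LocMeasure.laplaceMat (T : ℕ → S → ℝ) {m : ℕ} (p : Fin m × ℕ)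
    (x : Fin m → LocMeasure h) : ℝ :=
  (x p.1).laplace (T p.2)

theorem LocMeasure.continuous_laplaceMat (h_nonneg : ∀ k x, 0 ≤ h k x) {T : ℕ → S → ℝ}
    (hT : ∀ i, SubWeight h (T i)) {m : ℕ} (p : Fin m × ℕ) :
    Continuous (LocMeasure.laplaceMat T p : (Fin m → LocMeasure h) → ℝ) :=
  ((hT p.2).dominated.continuous_laplace h_nonneg).comp (continuous_apply p.1)

theorem LocMeasure.laplaceMat_separates {T : ℕ → S → ℝ}
    (hinj : Function.Injective (LocMeasure.laplaceVec T : LocMeasure h → ℕ → ℝ)) {m : ℕ}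
    (x y : Fin m → LocMeasure h)
    (hxy : ∀ p, LocMeasure.laplaceMat T p x = LocMeasure.laplaceMat T p y) : x = y :=
  funext fun i => hinj (funext fun j => hxy (i, j))

theorem aestronglyMeasurable_comp_vec (h_nonneg : ∀ k x, 0 ≤ h k x) {T : ℕ → S → ℝ}
    (hT : ∀ i, SubWeight h (T i))
    (hinj : Function.Injective (LocMeasure.laplaceVec T : LocMeasure h → ℕ → ℝ)) {m : ℕ}
    (F : (Fin m → LocMeasure h) →ᵇ ℝ) {C : Fin m → ℕ → Set (LocMeasure h)}
    (hC : ∀ i l, IsCompact (C i l)) {Ω : Type*} [MeasurableSpace Ω] {P : Measure Ω}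
    {X : Fin m → Ω → LocMeasure h} (hX : ∀ i, Measurable (X i))
    (hXC : ∀ i l, P {ω | X i ω ∉ C i l} ≤ ENNReal.ofReal ((1 / 2) ^ l)) :
    AEStronglyMeasurable (fun ω => F fun i => X i ω) P := by
  refine aestronglyMeasurable_comp_of_ae_mem
    (Φ := fun (x : Fin m → LocMeasure h) (p : Fin m × ℕ) => LocMeasure.laplaceMat T p x)
    (continuous_pi fun p => LocMeasure.continuous_laplaceMat h_nonneg hT p)
    (fun x y hxy => LocMeasure.laplaceMat_separates hinj x y (congrFun hxy)) F.continuous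
    (C := fun l : Fin m → ℕ => Set.pi Set.univ fun i => C i (l i))
    (fun l => isCompact_univ_pi fun i => hC i (l i)) (measurable_pi_lambda _ fun p =>
      ((hT p.2).dominated.continuous_laplace h_nonneg).measurable.comp (hX p.1)) ?_
  filter_upwards [ae_all_iff.2 fun i => ae_mem_iUnion_of_measure_le (hXC i)] with ω hω
  choose l hl using fun i => Set.mem_iUnion.1 (hω i)
  exact Set.mem_iUnion.2 ⟨l, fun i _ => hl i⟩

theorem integrable_comp_vec (h_nonneg : ∀ k x, 0 ≤ h k x) {T : ℕ → S → ℝ}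
    (hT : ∀ i, SubWeight h (T i))
    (hinj : Function.Injective (LocMeasure.laplaceVec T : LocMeasure h → ℕ → ℝ)) {m : ℕ}
    (F : (Fin m → LocMeasure h) →ᵇ ℝ) {C : Fin m → ℕ → Set (LocMeasure h)}
    (hC : ∀ i l, IsCompact (C i l)) {Ω : Type*} [MeasurableSpace Ω] {P : Measure Ω}
    [IsFiniteMeasure P] {X : Fin m → Ω → LocMeasure h} (hX : ∀ i, Measurable (X i))
    (hXC : ∀ i l, P {ω | X i ω ∉ C i l} ≤ ENNReal.ofReal ((1 / 2) ^ l)) :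
    Integrable (fun ω => F fun i => X i ω) P :=
  Integrable.of_bound (aestronglyMeasurable_comp_vec h_nonneg hT hinj F hC hX hXC) ‖F‖
    (ae_of_all _ fun _ => F.norm_coe_le_norm _)

theorem measure_notMem_pi_le {E Ω : Type*} [MeasurableSpace Ω] {P : Measure Ω} {m : ℕ}
    {C : Fin m → Set E} {X : Fin m → Ω → E} {a : ℝ}
    (hXC : ∀ i, P {ω | X i ω ∉ C i} ≤ ENNReal.ofReal a) :
    P {ω | (fun i => X i ω) ∉ Set.pi Set.univ C} ≤ ENNReal.ofReal (m * a) := by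
  have hsub : {ω | (fun i => X i ω) ∉ Set.pi Set.univ C} ⊆ ⋃ i, {ω | X i ω ∉ C i} := by
    intro ω hω
    by_contra hcon
    refine hω fun i _ => ?_
    by_contra hi
    exact hcon (Set.mem_iUnion.2 ⟨i, hi⟩)
  refine (measure_mono hsub).trans ((measure_iUnion_fintype_le _ _).trans
    ((Finset.sum_le_sum fun i _ => hXC i).trans ?_))
  rw [Finset.sum_const, Finset.card_univ, Fintype.card_fin, nsmul_eq_mul,
    ENNReal.ofReal_mul (Nat.cast_nonneg m), ENNReal.ofReal_natCast]

end Vectors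

/-- The limit `Ξ` of the level means of `ξ`, with the compact sets `C` which contain all the
random measures with high probability, and a separating family `T` of test functions. -/
structure IsLevelLimit {S : Type*} [TopologicalSpace S] [PolishSpace S] [MeasurableSpace S]
    [BorelSpace S] {h : ℕ → S →ᵇ ℝ} {Ω' : ℕ → Type*} [∀ n, MeasurableSpace (Ω' n)]
    (P' : ∀ n, Measure (Ω' n)) {Ω : Type*} [MeasurableSpace Ω] (P : Measure Ω)
    (ξ' : ∀ n, ℝ≥0 → Ω' n → LevelMeasure h) (Ξ' : ∀ n, ℝ≥0 → Ω' n → LocMeasure h)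
    (ξ : ℝ≥0 → Ω → LevelMeasure h) (Ξ : ℝ≥0 → Ω → LocMeasure h) (T : ℕ → S → ℝ)
    (C : ℝ≥0 → ℕ → Set (LocMeasure h)) : Prop where
  subWeight : ∀ i, SubWeight h (T i)
  injective : Function.Injective (LocMeasure.laplaceVec T : LocMeasure h → ℕ → ℝ)
  isCompact : ∀ t l, IsCompact (C t l)
  pre_measure : ∀ᶠ n in atTop, ∀ t l, P' n {ω | Ξ' n t ω ∉ C t l} ≤ ENNReal.ofReal ((1 / 2) ^ l)
  pre_mean_measure : ∀ j, ∀ᶠ n in atTop, ∀ t l,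
    P' n {ω | levelMean j (ξ' n t ω) ∉ C t l} ≤ ENNReal.ofReal ((1 / 2) ^ l)
  mean_measure : ∀ j t l, P {ω | levelMean j (ξ t ω) ∉ C t l} ≤ ENNReal.ofReal ((1 / 2) ^ l)
  process : IsProcess Ξ
  measure : ∀ t l, P {ω | Ξ t ω ∉ C t l} ≤ ENNReal.ofReal ((1 / 2) ^ l)
  factor : ∀ t, ∃ Ψ : (ℕ → ℝ) → LocMeasure h, Measurable Ψ ∧
    ∀ ω, Ψ (LocMeasure.laplaceVec T (Ξ t ω)) = Ξ t ω
  mean_close : ∀ t i j,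
    ∫ ω, |(levelMean j (ξ t ω)).laplace (T i) - (Ξ t ω).laplace (T i)| ∂P ≤ 12 / 4 ^ (j + 1)

variable {S : Type*} [TopologicalSpace S] [PolishSpace S] [MeasurableSpace S]
  [BorelSpace S] {h : ℕ → S →ᵇ ℝ} {Ω' : ℕ → Type*} [∀ n, MeasurableSpace (Ω' n)]
  {P' : ∀ n, Measure (Ω' n)} [∀ n, IsProbabilityMeasure (P' n)] {Ω : Type*} [MeasurableSpace Ω]
  {P : Measure Ω} [IsProbabilityMeasure P]
  {ξ' : ∀ n, ℝ≥0 → Ω' n → LevelMeasure h} {Ξ' : ∀ n, ℝ≥0 → Ω' n → LocMeasure h}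
  {ξ : ℝ≥0 → Ω → LevelMeasure h}

theorem LevelApproximation.exists_isLevelLimit (H : LevelApproximation h P' P ξ' Ξ' ξ) :
    ∃ Ξ T C, IsLevelLimit P' P ξ' Ξ' ξ Ξ T C := by
  obtain ⟨T, hT, hsep⟩ := LocMeasure.exists_separating_family H.nonneg H.le_one H.pos
  have hinj : Function.Injective (LocMeasure.laplaceVec T : LocMeasure h → ℕ → ℝ) :=
    fun ν ν' hν => hsep ν ν' fun i => LocMeasure.laplace_eq_iff.1 (congrFun hν i)
  obtain ⟨C, hC, h1, h2, h3⟩ := H.exists_compact_containment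
  choose Ξ Ψ hm hΨm hΨ hP hclose using fun t =>
    H.exists_limit_measure hT hinj t (hC t) fun j l => h3 j t l
  exact ⟨Ξ, T, C, hT, hinj, hC, h1, h2, h3, hm, hP, fun t => ⟨Ψ t, hΨm t, hΨ t⟩, hclose⟩

namespace IsLevelLimit

variable {Ξ : ℝ≥0 → Ω → LocMeasure h} {T : ℕ → S → ℝ} {C : ℝ≥0 → ℕ → Set (LocMeasure h)}

/-- The choices are made in the order `l`, `J`, `j`: a compact set with small exceptional
probability, finitely many Laplace functionals controlling `F` on it, then enough levels to make
these close in mean. One `j` serves all large `n` and the limit. -/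
theorem integral_abs_comp_sub_le_of_close (H : LevelApproximation h P' P ξ' Ξ' ξ)
    (hL : IsLevelLimit P' P ξ' Ξ' ξ Ξ T C) {m : ℕ} (s : Fin m → ℝ≥0)
    (F : (Fin m → LocMeasure h) →ᵇ ℝ) {ε : ℝ} (hε : 0 < ε) :
    ∃ j, (∀ᶠ n in atTop, ∫ ω, |F (fun i => levelMean j (ξ' n (s i) ω)) -
        F (fun i => Ξ' n (s i) ω)| ∂(P' n) ≤ ε) ∧
      ∫ ω, |F (fun i => levelMean j (ξ (s i) ω)) - F (fun i => Ξ (s i) ω)| ∂P ≤ ε := by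
  have hl : Tendsto (fun l : ℕ => 2 * ‖F‖ * (2 * (m * (1 / 2 : ℝ) ^ l))) atTop (𝓝 0) := by
    have := (((tendsto_pow_atTop_nhds_zero_of_lt_one (by norm_num : (0 : ℝ) ≤ 1 / 2)
      (by norm_num)).const_mul (m : ℝ)).const_mul 2).const_mul (2 * ‖F‖)
    simpa using this
  obtain ⟨l, hl⟩ := (hl.eventually (gt_mem_nhds (by positivity : 0 < ε / 4))).exists
  let B : Set (Fin m → LocMeasure h) := Set.pi Set.univ fun i => C (s i) l
  have hB : IsCompact B := isCompact_univ_pi fun i => hL.isCompact (s i) l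
  obtain ⟨J, hJ⟩ := exists_finset_forall_abs_sub_lt
    (fun p => LocMeasure.continuous_laplaceMat H.nonneg hL.subWeight p)
    (LocMeasure.laplaceMat_separates hL.injective) hB F.continuous (by positivity : 0 < ε / 2)
  have hj : Tendsto (fun j : ℕ => 2 * ‖F‖ * ((∑ p ∈ J, ((p.2 : ℝ) + 1)) * (12 / 4 ^ (j + 1))))
      atTop (𝓝 0) := by
    have h4 : Tendsto (fun j : ℕ => (12 : ℝ) / 4 ^ (j + 1)) atTop (𝓝 0) := by
      have := ((tendsto_pow_atTop_nhds_zero_of_lt_one (by norm_num : (0 : ℝ) ≤ 1 / 4)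
        (by norm_num)).comp (tendsto_add_atTop_nat 1)).const_mul (12 : ℝ)
      simpa [Function.comp_def, one_div_pow, div_eq_mul_inv] using this
    simpa using (h4.const_mul (∑ p ∈ J, ((p.2 : ℝ) + 1))).const_mul (2 * ‖F‖)
  obtain ⟨j, hj⟩ := (hj.eventually (gt_mem_nhds (by positivity : 0 < ε / 4))).exists
  have hfin : ε / 2 + 2 * ‖F‖ * (2 * (m * (1 / 2 : ℝ) ^ l) +
      (∑ p ∈ J, ((p.2 : ℝ) + 1)) * (12 / 4 ^ (j + 1))) ≤ ε := by
    rw [mul_add]; linarith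
  have hd := fun i => (hL.subWeight i).dominated
  refine ⟨j, ?_, ?_⟩
  · filter_upwards [hL.pre_measure, hL.pre_mean_measure j,
      H.eventually_integral_abs_levelMean_sub_le j] with n h1 h2 h3
    refine (integral_abs_comp_sub_le F (by positivity) hJ (a := m * (1 / 2 : ℝ) ^ l)
      (b := 12 / 4 ^ (j + 1)) (by positivity)
      (measure_notMem_pi_le fun i => h2 (s i) l)
      (measure_notMem_pi_le fun i => h1 (s i) l)
      (fun p => ((integrable_loc_laplace H.nonneg (hd p.2)
        ((continuous_levelMean j).measurable.comp (H.process_ξ' n (s p.1)))).sub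
        (integrable_loc_laplace H.nonneg (hd p.2) (H.process_Ξ' n (s p.1)))).abs)
      fun p => (h3 (s p.1) _ (hL.subWeight p.2)).trans ?_).trans hfin
    gcongr
    norm_num
  · exact (integral_abs_comp_sub_le F (by positivity) hJ (a := m * (1 / 2 : ℝ) ^ l)
      (b := 12 / 4 ^ (j + 1)) (by positivity)
      (measure_notMem_pi_le fun i => hL.mean_measure j (s i) l)
      (measure_notMem_pi_le fun i => hL.measure (s i) l)
      (fun p => ((integrable_loc_laplace H.nonneg (hd p.2)
        ((continuous_levelMean j).measurable.comp (H.process_ξ (s p.1)))).sub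
        (integrable_loc_laplace H.nonneg (hd p.2) (hL.process (s p.1)))).abs)
      fun p => hL.mean_close (s p.1) p.2 j).trans hfin

theorem abs_integral_mul_sub_le {Ω₁ : Type*} [MeasurableSpace Ω₁] {P₁ : Measure Ω₁}
    [IsProbabilityMeasure P₁] {u v w : Ω₁ → ℝ} (hu : Integrable u P₁) (hv : Integrable v P₁)
    (hw : AEStronglyMeasurable w P₁) {B : ℝ} (hB : ∀ ω, |w ω| ≤ B) :
    |∫ ω, u ω * w ω ∂P₁ - ∫ ω, v ω * w ω ∂P₁| ≤ B * ∫ ω, |u ω - v ω| ∂P₁ := by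
  have huw := hu.mul_bdd hw (ae_of_all _ hB)
  have hvw := hv.mul_bdd hw (ae_of_all _ hB)
  rw [← integral_sub huw hvw, ← integral_const_mul]
  refine (abs_integral_le_integral_abs).trans (integral_mono (huw.sub hvw).abs
    ((hu.sub hv).abs.const_mul B) fun ω => ?_)
  simp only
  rw [← sub_mul, abs_mul, mul_comm]
  exact mul_le_mul_of_nonneg_right (hB ω) (abs_nonneg _)

/-- Replacing `Ξ'` and `Ξ` by the `j`-th level means costs at most `‖W‖ δ` on each side; what
remains is a bounded continuous function of `ξ'` at the times `t` and `s i`. -/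
theorem tendsto_integral_mul (H : LevelApproximation h P' P ξ' Ξ' ξ)
    (hL : IsLevelLimit P' P ξ' Ξ' ξ Ξ T C) {m : ℕ} (s : Fin m → ℝ≥0)
    (F : (Fin m → LocMeasure h) →ᵇ ℝ) (t : ℝ≥0) (W : LevelMeasure h →ᵇ ℝ) :
    Tendsto (fun n => ∫ ω, F (fun i => Ξ' n (s i) ω) * W (ξ' n t ω) ∂(P' n)) atTop
      (𝓝 (∫ ω, F (fun i => Ξ (s i) ω) * W (ξ t ω) ∂P)) := by
  rw [Metric.tendsto_atTop']
  intro ε hε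
  set δ : ℝ := ε / (4 * (‖W‖ + 1)) with hδ_def
  have hδ : 0 < δ := by positivity
  have hWδ : ‖W‖ * δ < ε / 3 := by
    have h1 : (‖W‖ + 1) * δ = ε / 4 := by rw [hδ_def]; field_simp
    nlinarith [norm_nonneg W]
  obtain ⟨j, hj1, hj2⟩ := integral_abs_comp_sub_le_of_close H hL s F hδ
  let V : (Fin (m + 1) → LevelMeasure h) →ᵇ ℝ := BoundedContinuousFunction.ofNormedAddCommGroup
    (fun y => F (fun i => levelMean j (y i.succ)) * W (y 0))
    ((F.continuous.comp (continuous_pi fun i =>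
      (continuous_levelMean j).comp (continuous_apply i.succ))).mul
        (W.continuous.comp (continuous_apply 0))) (‖F‖ * ‖W‖) fun y => by
      rw [norm_mul]
      exact mul_le_mul (F.norm_coe_le_norm _) (W.norm_coe_le_norm _) (norm_nonneg _) (norm_nonneg _)
  have hV := H.conv (m + 1) (Fin.cons t s) V
  have hVe : ∀ y : Fin (m + 1) → LevelMeasure h,
      V y = F (fun i => levelMean j (y i.succ)) * W (y 0) := fun _ => rfl
  simp only [hVe, Fin.cons_succ, Fin.cons_zero] at hV
  have hlim := abs_integral_mul_sub_le (w := fun ω => W (ξ t ω))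
    (integrable_comp_vec H.nonneg hL.subWeight hL.injective F
      (fun i l => hL.isCompact (s i) l)
      (fun i => (continuous_levelMean j).measurable.comp (H.process_ξ (s i)))
      fun i l => hL.mean_measure j (s i) l)
    (integrable_comp_vec H.nonneg hL.subWeight hL.injective F
      (fun i l => hL.isCompact (s i) l) (fun i => hL.process (s i)) fun i l => hL.measure (s i) l)
    (W.continuous.measurable.comp (H.process_ξ t)).aestronglyMeasurable
    (fun ω => W.norm_coe_le_norm _)
  have hev : ∀ᶠ n in atTop, dist (∫ ω, F (fun i => Ξ' n (s i) ω) * W (ξ' n t ω) ∂(P' n))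
      (∫ ω, F (fun i => Ξ (s i) ω) * W (ξ t ω) ∂P) < ε := by
    filter_upwards [hj1, hL.pre_measure, hL.pre_mean_measure j,
      Metric.tendsto_nhds.1 hV (ε / 3) (by positivity)] with n h1 h2 h3 h4
    have hpre := abs_integral_mul_sub_le (w := fun ω => W (ξ' n t ω))
      (integrable_comp_vec H.nonneg hL.subWeight hL.injective F
        (fun i l => hL.isCompact (s i) l)
        (fun i => (continuous_levelMean j).measurable.comp (H.process_ξ' n (s i)))
        fun i l => h3 (s i) l)
      (integrable_comp_vec H.nonneg hL.subWeight hL.injective F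
        (fun i l => hL.isCompact (s i) l) (fun i => H.process_Ξ' n (s i)) fun i l => h2 (s i) l)
      (W.continuous.measurable.comp (H.process_ξ' n t)).aestronglyMeasurable
      (fun ω => W.norm_coe_le_norm _)
    have h5 := hpre.trans (mul_le_mul_of_nonneg_left h1 (norm_nonneg W))
    have h6 := hlim.trans (mul_le_mul_of_nonneg_left hj2 (norm_nonneg W))
    rw [Real.dist_eq] at h4 ⊢
    have h7 := abs_lt.1 h4
    have h8 := abs_le.1 h5
    have h9 := abs_le.1 h6
    simp only [Function.comp_apply] at h8 h9
    rw [abs_lt]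
    constructor <;> linarith
  obtain ⟨N, hN⟩ := eventually_atTop.1 hev
  exact ⟨N, fun n hn => hN n hn.le⟩

theorem fddConverges (H : LevelApproximation h P' P ξ' Ξ' ξ)
    (hL : IsLevelLimit P' P ξ' Ξ' ξ Ξ T C) : FDDConverges P' Ξ' P Ξ := fun m s F => by
  simpa using tendsto_integral_mul H hL s F 0 1

end IsLevelLimit

end

section

/-! ### Conditional expectation given the history -/

theorem norm_coe_nnreal_le {E : Type*} [TopologicalSpace E] (F : E →ᵇ ℝ≥0) (y : E) :
    ‖(F y : ℝ)‖ ≤ nndist F 0 := by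
  rw [Real.norm_of_nonneg (F y).coe_nonneg]
  exact NNReal.coe_le_coe.2 (BoundedContinuousFunction.NNReal.upper_bound F y)

/-- Bounded continuous functions determine a finite measure on `E`, here the image under `Y` of `W
P` and of `V P`. In the application `E` consists of finite families of Laplace vectors. -/
theorem withDensity_preimage_eq {Ω E : Type*} [MeasurableSpace Ω] {P : Measure Ω}
    [IsProbabilityMeasure P] [TopologicalSpace E] [MeasurableSpace E] [BorelSpace E]
    [HasOuterApproxClosed E] {Y : Ω → E} (hY : Measurable Y) {W V : Ω → ℝ} (hW : Measurable W)
    (hV : Measurable V) (hW0 : ∀ ω, 0 ≤ W ω) (hV0 : ∀ ω, 0 ≤ V ω) (hWi : Integrable W P)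
    (hVi : Integrable V P)
    (H : ∀ F : E →ᵇ ℝ≥0, ∫ ω, (F (Y ω) : ℝ) * W ω ∂P = ∫ ω, (F (Y ω) : ℝ) * V ω ∂P)
    {A : Set E} (hA : MeasurableSet A) :
    P.withDensity (fun ω => ENNReal.ofReal (W ω)) (Y ⁻¹' A) =
      P.withDensity (fun ω => ENNReal.ofReal (V ω)) (Y ⁻¹' A) := by
  have key : ∀ {U : Ω → ℝ}, Measurable U → (∀ ω, 0 ≤ U ω) → Integrable U P → ∀ F : E →ᵇ ℝ≥0,
      ∫⁻ y, F y ∂((P.withDensity fun ω => ENNReal.ofReal (U ω)).map Y) =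
        ENNReal.ofReal (∫ ω, (F (Y ω) : ℝ) * U ω ∂P) := by
    intro U hU hU0 hUi F
    have hF : Measurable fun y => (F y : ℝ≥0∞) := F.continuous.measurable.coe_nnreal_ennreal
    have hFY : Measurable fun ω => (F (Y ω) : ℝ) := (F.continuous.measurable.comp hY).coe_nnreal_real
    rw [lintegral_map hF hY, lintegral_withDensity_eq_lintegral_mul _ hU.ennreal_ofReal
      (show Measurable fun ω => (F (Y ω) : ℝ≥0∞) from hF.comp hY)]
    have hint : Integrable (fun ω => (F (Y ω) : ℝ) * U ω) P :=
      hUi.bdd_mul hFY.aestronglyMeasurable (ae_of_all _ fun ω => norm_coe_nnreal_le F (Y ω))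
    rw [ofReal_integral_eq_lintegral_ofReal hint
      (ae_of_all _ fun ω => mul_nonneg (F (Y ω)).coe_nonneg (hU0 ω))]
    refine lintegral_congr fun ω => ?_
    rw [ENNReal.ofReal_mul (F (Y ω)).coe_nonneg, ENNReal.ofReal_coe_nnreal, mul_comm]
    rfl
  have hfin : ∀ {U : Ω → ℝ}, Integrable U P →
      IsFiniteMeasure ((P.withDensity fun ω => ENNReal.ofReal (U ω)).map Y) := fun hU => by
    have := isFiniteMeasure_withDensity_ofReal hU.2
    infer_instance
  have := hfin hWi
  have hmap : (P.withDensity fun ω => ENNReal.ofReal (W ω)).map Y =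
      (P.withDensity fun ω => ENNReal.ofReal (V ω)).map Y :=
    ext_of_forall_lintegral_eq_of_IsFiniteMeasure fun F => by
      rw [key hW hW0 hWi, key hV hV0 hVi, H F]
  rw [← Measure.map_apply hY hA, hmap, Measure.map_apply hY hA]

/-- Finite intersections of events from single times form a π-system generating the history. Since
`Ξ t` is a measurable function of `φ (Ξ t)`, these events are already events of the coded vectors.
-/
theorem withDensity_eq_of_history {Ω E X : Type*} [MeasurableSpace Ω] [MeasurableSpace E]
    [MeasurableSpace X] {Ξ : ℝ≥0 → Ω → E} (hΞ : IsProcess Ξ) {φ : E → X}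
    (hfac : ∀ t, ∃ Ψ : X → E, Measurable Ψ ∧ ∀ ω, Ψ (φ (Ξ t ω)) = Ξ t ω)
    {Q₁ Q₂ : Measure Ω} [IsFiniteMeasure Q₁] (t : ℝ≥0)
    (H : ∀ (m : ℕ) (s : Fin m → ℝ≥0), (∀ i, s i ≤ t) → ∀ A : Set (Fin m → X), MeasurableSet A →
      Q₁ ((fun ω i => φ (Ξ (s i) ω)) ⁻¹' A) = Q₂ ((fun ω i => φ (Ξ (s i) ω)) ⁻¹' A))
    {A : Set Ω} (hA : MeasurableSet[history Ξ t] A) : Q₁ A = Q₂ A := by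
  refine ext_on_measurableSpace_of_generate_finite _ (piiUnionInter
    (fun s => {B | MeasurableSet[MeasurableSpace.comap (Ξ s) inferInstance] B}) {s | s ≤ t}) ?_
    (history_le hΞ t) (generateFrom_piiUnionInter_measurableSet
      (fun s => MeasurableSpace.comap (Ξ s) inferInstance) {s | s ≤ t}).symm
    (isPiSystem_piiUnionInter _ (fun s => @MeasurableSpace.isPiSystem_measurableSet Ω
      (MeasurableSpace.comap (Ξ s) inferInstance)) _) ?_ hA
  · rintro _ ⟨J, hJ, f, hf, rfl⟩
    choose Ψ hΨm hΨ using hfac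
    have hf' : ∀ i : Fin J.card, ∃ B, MeasurableSet B ∧
        Ξ (J.equivFin.symm i) ⁻¹' B = f (J.equivFin.symm i) := fun i => hf _ (Subtype.prop _)
    choose B hBm hB using hf'
    have hset : (⋂ x ∈ J, f x) = (fun ω (i : Fin J.card) => φ (Ξ (J.equivFin.symm i) ω)) ⁻¹'
        ⋂ i, {y | Ψ (J.equivFin.symm i) (y i) ∈ B i} := by
      ext ω
      simp only [Set.mem_iInter, Set.mem_preimage, Set.mem_ofPred_eq, hΨ]
      constructor
      · intro hω i
        have := hω _ (J.equivFin.symm i).2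
        rwa [← hB i] at this
      · intro hω x hx
        have := hω (J.equivFin ⟨x, hx⟩)
        have h2 : ω ∈ Ξ (J.equivFin.symm (J.equivFin ⟨x, hx⟩)) ⁻¹' B (J.equivFin ⟨x, hx⟩) := this
        rw [hB] at h2
        simpa using h2
    rw [hset]
    exact H _ (fun i => J.equivFin.symm i) (fun i => hJ (J.equivFin.symm i).2) _
      (MeasurableSet.iInter fun i => ((hΨm _).comp (measurable_pi_apply i)) (hBm i))
  · simpa using H 0 Fin.elim0 (fun i => i.elim0) Set.univ MeasurableSet.univ

theorem condExp_ae_eq_of_withDensity_eq {Ω : Type*} {m mΩ : MeasurableSpace Ω} (hm : m ≤ mΩ)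
    {P : Measure Ω} [IsProbabilityMeasure P] {W V : Ω → ℝ} (hW0 : ∀ ω, 0 ≤ W ω)
    (hV0 : ∀ ω, 0 ≤ V ω) (hWi : Integrable W P) (hVi : Integrable V P)
    (hVm : StronglyMeasurable[m] V)
    (H : ∀ A, MeasurableSet[m] A → P.withDensity (fun ω => ENNReal.ofReal (W ω)) A =
      P.withDensity (fun ω => ENNReal.ofReal (V ω)) A) : P[W | m] =ᵐ[P] V := by
  refine (ae_eq_condExp_of_forall_setIntegral_eq hm hWi (fun _ _ _ => hVi.integrableOn)
    (fun A hA _ => ?_) hVm.aestronglyMeasurable).symm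
  rw [integral_eq_lintegral_of_nonneg_ae (ae_of_all _ hV0) hVi.aestronglyMeasurable.restrict,
    integral_eq_lintegral_of_nonneg_ae (ae_of_all _ hW0) hWi.aestronglyMeasurable.restrict,
    ← withDensity_apply _ (hm A hA), ← withDensity_apply _ (hm A hA), H A hA]

variable {S : Type*} [TopologicalSpace S] [PolishSpace S] [MeasurableSpace S]
  [BorelSpace S] {h : ℕ → S →ᵇ ℝ} {Ω' : ℕ → Type*} [∀ n, MeasurableSpace (Ω' n)]
  {P' : ∀ n, Measure (Ω' n)} [∀ n, IsProbabilityMeasure (P' n)] {Ω : Type*} [MeasurableSpace Ω]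
  {P : Measure Ω} [IsProbabilityMeasure P]
  {ξ' : ∀ n, ℝ≥0 → Ω' n → LevelMeasure h} {Ξ' : ∀ n, ℝ≥0 → Ω' n → LocMeasure h}
  {ξ : ℝ≥0 → Ω → LevelMeasure h}

theorem LocMeasure.continuous_laplaceVec (h_nonneg : ∀ k x, 0 ≤ h k x) {T : ℕ → S → ℝ}
    (hT : ∀ i, SubWeight h (T i)) :
    Continuous (LocMeasure.laplaceVec T : LocMeasure h → ℕ → ℝ) :=
  continuous_pi fun i => (hT i).dominated.continuous_laplace h_nonneg

theorem measurable_laplaceVec_history (h_nonneg : ∀ k x, 0 ≤ h k x) {T : ℕ → S → ℝ}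
    (hT : ∀ i, SubWeight h (T i)) {Ω₁ : Type*} {X : ℝ≥0 → Ω₁ → LocMeasure h} {m : ℕ}
    {s : Fin m → ℝ≥0} {t : ℝ≥0} (hs : ∀ i, s i ≤ t) :
    Measurable[history X t] fun ω i => LocMeasure.laplaceVec T (X (s i) ω) := by
  refine @measurable_pi_lambda _ _ _ (history X t) _ _ fun i => ?_
  exact (LocMeasure.continuous_laplaceVec h_nonneg hT).measurable.comp
    (measurable_history (X := X) (hs i))

namespace IsLevelLimit

variable {Ξ : ℝ≥0 → Ω → LocMeasure h} {T : ℕ → S → ℝ} {C : ℝ≥0 → ℕ → Set (LocMeasure h)}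

theorem tendsto_integral_mul_exp_neg (H : LevelApproximation h P' P ξ' Ξ' ξ)
    (hL : IsLevelLimit P' P ξ' Ξ' ξ Ξ T C) {m : ℕ} (s : Fin m → ℝ≥0)
    (F : (Fin m → LocMeasure h) →ᵇ ℝ) (t : ℝ≥0) {g : S → ℝ} (hg : Dominated h g) {c : ℝ}
    (hc : 0 ≤ c) :
    Tendsto (fun n => ∫ ω, F (fun i => Ξ' n (s i) ω) *
      Real.exp (-(c * ∫ x, g x ∂(Ξ' n t ω).1)) ∂(P' n)) atTop
      (𝓝 (∫ ω, F (fun i => Ξ (s i) ω) * Real.exp (-(c * ∫ x, g x ∂(Ξ t ω).1)) ∂P)) := by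
  let V : (Fin (m + 1) → LocMeasure h) →ᵇ ℝ := BoundedContinuousFunction.ofNormedAddCommGroup
    (fun y => F (fun i => y i.succ) * Real.exp (-(c * ∫ x, g x ∂(y 0).1)))
    ((F.continuous.comp (continuous_pi fun i => continuous_apply i.succ)).mul
      (Real.continuous_exp.comp (continuous_const.mul
        ((hg.continuous_integral H.nonneg).comp (continuous_apply 0))).neg)) (‖F‖ * 1) fun y => by
      rw [norm_mul]
      refine mul_le_mul (F.norm_coe_le_norm _) ?_ (norm_nonneg _) (norm_nonneg _)
      rw [Real.norm_of_nonneg (Real.exp_nonneg _)]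
      exact exp_neg_le_one (mul_nonneg hc (integral_nonneg hg.nonneg))
  have hV := fddConverges H hL (m + 1) (Fin.cons t s) V
  have hVe : ∀ y : Fin (m + 1) → LocMeasure h,
      V y = F (fun i => y i.succ) * Real.exp (-(c * ∫ x, g x ∂(y 0).1)) := fun _ => rfl
  simpa only [hVe, Fin.cons_succ, Fin.cons_zero] using hV

/-- The weight is a function of Laplace vectors at times up to `t`, so before the limit it is
measurable for the history of `Ξ' n`. The outer expectations converge by the convergence of `Ξ'`,
the middle one by joint convergence with `ξ'`. -/
theorem sandwich (H : LevelApproximation h P' P ξ' Ξ' ξ)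
    (hL : IsLevelLimit P' P ξ' Ξ' ξ Ξ T C) {m : ℕ} {s : Fin m → ℝ≥0} {t : ℝ≥0}
    (hs : ∀ i, s i ≤ t) (F : (Fin m → ℕ → ℝ) →ᵇ ℝ≥0) {f : S → ℝ} (hf : Dominated h f) {K δ η : ℝ}
    (hK : 0 < K) (hδ : 0 < δ) (hη : 0 < η) :
    ∫ ω, (F (fun i => LocMeasure.laplaceVec T (Ξ (s i) ω)) : ℝ) *
        Real.exp (-((K + δ) * (1 + η) * ∫ x, (1 - Real.exp (-f x)) ∂(Ξ t ω).1)) ∂P ≤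
      ∫ ω, (F (fun i => LocMeasure.laplaceVec T (Ξ (s i) ω)) : ℝ) *
        Real.exp (-∫ z, f z.1 * levelCutoff K δ z.2 ∂(ξ t ω).1) ∂P ∧
    ∫ ω, (F (fun i => LocMeasure.laplaceVec T (Ξ (s i) ω)) : ℝ) *
        Real.exp (-∫ z, f z.1 * levelCutoff K δ z.2 ∂(ξ t ω).1) ∂P ≤
      ∫ ω, (F (fun i => LocMeasure.laplaceVec T (Ξ (s i) ω)) : ℝ) *
        Real.exp (-(K * ∫ x, (1 - Real.exp (-f x)) ∂(Ξ t ω).1)) ∂P := by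
  have hB' : ∀ y, (F y : ℝ) ≤ nndist F 0 := fun y =>
    (le_abs_self _).trans (norm_coe_nnreal_le F y)
  let G : (Fin m → LocMeasure h) →ᵇ ℝ := BoundedContinuousFunction.ofNormedAddCommGroup
    (fun y => (F (fun i => LocMeasure.laplaceVec T (y i)) : ℝ))
    (NNReal.continuous_coe.comp (F.continuous.comp (continuous_pi fun i =>
      (LocMeasure.continuous_laplaceVec H.nonneg hL.subWeight).comp (continuous_apply i)))) (nndist F 0)
    fun y => norm_coe_nnreal_le F _
  let W : LevelMeasure h →ᵇ ℝ := BoundedContinuousFunction.ofNormedAddCommGroup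
    (LevelMeasure.laplace K δ f) (hf.continuous_level_laplace H.nonneg K hδ) 1
    fun μ => hf.abs_level_laplace_le_one K δ μ
  have h1 := tendsto_integral_mul_exp_neg H hL s G t hf.one_sub_exp_neg
    (c := (K + δ) * (1 + η)) (by positivity)
  have h2 := tendsto_integral_mul H hL s G t W
  have h3 := tendsto_integral_mul_exp_neg H hL s G t hf.one_sub_exp_neg hK.le
  have hev := H.sandwich K hK δ hδ η hη
  have hG : ∀ n, StronglyMeasurable[history (Ξ' n) t]
      fun ω => (F (fun i => LocMeasure.laplaceVec T (Ξ' n (s i) ω)) : ℝ) := fun n =>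
    ((NNReal.continuous_coe.comp F.continuous).measurable.comp
      (measurable_laplaceVec_history (X := Ξ' n) H.nonneg hL.subWeight hs)).stronglyMeasurable
  constructor
  · refine le_of_tendsto_of_tendsto h1 h2 (hev.mono fun n hn => ?_)
    exact (hn t f hf _ (hG n) (fun ω => NNReal.coe_nonneg _) ⟨_, fun ω => hB' _⟩).1
  · refine le_of_tendsto_of_tendsto h2 h3 (hev.mono fun n hn => ?_)
    exact (hn t f hf _ (hG n) (fun ω => NNReal.coe_nonneg _) ⟨_, fun ω => hB' _⟩).2

/-- With `δ = η = 1 / (N + 1)` both bounds of the sandwich tend to the right-hand side, and the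
cutoffs shrink to the indicator of `[0, K]`. -/
theorem integral_mul_exp_neg_eq (H : LevelApproximation h P' P ξ' Ξ' ξ)
    (hL : IsLevelLimit P' P ξ' Ξ' ξ Ξ T C) {m : ℕ} {s : Fin m → ℝ≥0} {t : ℝ≥0}
    (hs : ∀ i, s i ≤ t) (F : (Fin m → ℕ → ℝ) →ᵇ ℝ≥0) {f : S → ℝ} (hf : Dominated h f) {K : ℝ}
    (hK : 0 < K) :
    ∫ ω, (F (fun i => LocMeasure.laplaceVec T (Ξ (s i) ω)) : ℝ) *
        Real.exp (-∫ z in levelsUpTo S K, f z.1 ∂(ξ t ω).1) ∂P =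
      ∫ ω, (F (fun i => LocMeasure.laplaceVec T (Ξ (s i) ω)) : ℝ) *
        Real.exp (-(K * ∫ x, (1 - Real.exp (-f x)) ∂(Ξ t ω).1)) ∂P := by
  have hGm : Measurable fun ω => (F (fun i => LocMeasure.laplaceVec T (Ξ (s i) ω)) : ℝ) :=
    (NNReal.continuous_coe.comp F.continuous).measurable.comp
      ((measurable_laplaceVec_history (X := Ξ) H.nonneg hL.subWeight hs).mono
        (history_le hL.process t) le_rfl)
  have hAm : Measurable fun ω => ∫ x, (1 - Real.exp (-f x)) ∂(Ξ t ω).1 :=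
    (hf.one_sub_exp_neg.continuous_integral H.nonneg).measurable.comp (hL.process t)
  have hlim : ∀ {u : ℕ → Ω → ℝ} {v : Ω → ℝ}, (∀ N, Measurable (u N)) → (∀ N ω, 0 ≤ u N ω) →
      (∀ ω, Tendsto (fun N => u N ω) atTop (𝓝 (v ω))) →
      Tendsto (fun N => ∫ ω, (F (fun i => LocMeasure.laplaceVec T (Ξ (s i) ω)) : ℝ) *
        Real.exp (-u N ω) ∂P) atTop
        (𝓝 (∫ ω, (F (fun i => LocMeasure.laplaceVec T (Ξ (s i) ω)) : ℝ) *
          Real.exp (-v ω) ∂P)) := by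
    intro u v hu hu0 huv
    refine tendsto_integral_of_dominated_convergence (fun _ => (nndist F 0 : ℝ))
      (fun N => (hGm.mul (Real.measurable_exp.comp (hu N).neg)).aestronglyMeasurable)
      (integrable_const _) (fun N => ae_of_all _ fun ω => ?_) (ae_of_all _ fun ω =>
        ((Real.continuous_exp.tendsto _).comp (huv ω).neg).const_mul _)
    rw [norm_mul, Real.norm_of_nonneg (Real.exp_nonneg _)]
    exact (mul_le_of_le_one_right (norm_nonneg _) (exp_neg_le_one (hu0 N ω))).trans
      (norm_coe_nnreal_le F _)
  have hδ : ∀ N : ℕ, (0 : ℝ) < 1 / ((N : ℝ) + 1) := fun N => by positivity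
  have hδ0 : Tendsto (fun N : ℕ => 1 / ((N : ℝ) + 1)) atTop (𝓝 0) :=
    tendsto_one_div_add_atTop_nhds_zero_nat
  have h2 := hlim (fun N => (hf.continuous_integral_mul_levelCutoff H.nonneg K
      (hδ N)).measurable.comp (H.process_ξ t))
    (fun N ω => integral_nonneg fun z => hf.mul_levelCutoff_nonneg _ _ z)
    (fun ω => hf.tendsto_integral_mul_levelCutoff H.nonneg K (ξ t ω))
  have h1 := hlim (u := fun N ω => (K + 1 / ((N : ℝ) + 1)) * (1 + 1 / ((N : ℝ) + 1)) *
      ∫ x, (1 - Real.exp (-f x)) ∂(Ξ t ω).1)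
    (v := fun ω => K * ∫ x, (1 - Real.exp (-f x)) ∂(Ξ t ω).1)
    (fun N => hAm.const_mul _)
    (fun N ω => mul_nonneg (by have := hδ N; positivity) (hf.integral_one_sub_exp_nonneg (Ξ t ω)))
    (fun ω => by
      have := ((hδ0.const_add K).mul (hδ0.const_add 1)).mul_const
        (∫ x, (1 - Real.exp (-f x)) ∂(Ξ t ω).1)
      simpa only [add_zero, mul_one] using this)
  refine le_antisymm (le_of_tendsto' h2 fun N => ?_) (le_of_tendsto_of_tendsto' h1 h2 fun N => ?_)
  · exact (sandwich H hL hs F hf hK (hδ N) (hδ N)).2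
  · exact (sandwich H hL hs F hf hK (hδ N) (hδ N)).1

theorem condPoissonRel (H : LevelApproximation h P' P ξ' Ξ' ξ)
    (hL : IsLevelLimit P' P ξ' Ξ' ξ Ξ T C) : CondPoissonRel P ξ Ξ := by
  intro t K hK f hf0 hfle
  have hf : Dominated h f := ⟨f.continuous, hf0, hfle⟩
  have hW := (hf.measurable_integral_levelsUpTo H.nonneg K).comp (H.process_ξ t)
  have hA := hf.one_sub_exp_neg.continuous_integral H.nonneg
  have hVh : Measurable[history Ξ t] fun ω =>
      Real.exp (-(K * ∫ x, (1 - Real.exp (-f x)) ∂(Ξ t ω).1)) :=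
    (Real.continuous_exp.comp (continuous_const.mul hA).neg).measurable.comp
      (measurable_history (X := Ξ) le_rfl)
  have hVm := hVh.mono (history_le hL.process t) le_rfl
  have hWi : Integrable (fun ω => Real.exp (-∫ z in levelsUpTo S K, f z.1 ∂(ξ t ω).1)) P :=
    integrable_exp_neg hW.aestronglyMeasurable fun ω => integral_nonneg fun z => hf0 z.1
  have hVi : Integrable (fun ω =>
      Real.exp (-(K * ∫ x, (1 - Real.exp (-f x)) ∂(Ξ t ω).1))) P :=
    integrable_exp_neg ((hA.measurable.comp (hL.process t)).const_mul K).aestronglyMeasurable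
      fun ω => mul_nonneg hK.le (hf.integral_one_sub_exp_nonneg (Ξ t ω))
  have := isFiniteMeasure_withDensity_ofReal hWi.2
  refine condExp_ae_eq_of_withDensity_eq (history_le hL.process t) (fun ω => Real.exp_nonneg _)
    (fun ω => Real.exp_nonneg _) hWi hVi hVh.stronglyMeasurable fun A hA' => ?_
  refine withDensity_eq_of_history hL.process hL.factor t (fun m s hs B hB => ?_) hA'
  exact withDensity_preimage_eq ((measurable_laplaceVec_history H.nonneg hL.subWeight hs).mono
    (history_le hL.process t) le_rfl) (Real.measurable_exp.comp hW.neg) hVm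
    (fun ω => Real.exp_nonneg _) (fun ω => Real.exp_nonneg _) hWi hVi
    (fun F => integral_mul_exp_neg_eq H hL hs F hf hK) hB

end IsLevelLimit

theorem LevelApproximation.exists_limit (H : LevelApproximation h P' P ξ' Ξ' ξ) :
    ∃ Ξ : ℝ≥0 → Ω → LocMeasure h,
      IsProcess Ξ ∧ FDDConverges P' Ξ' P Ξ ∧ CondPoissonRel P ξ Ξ := by
  obtain ⟨Ξ, T, C, hL⟩ := H.exists_isLevelLimit
  exact ⟨Ξ, hL.process, hL.fddConverges H, hL.condPoissonRel H⟩

end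

/-! ### The main theorem. -/

theorem mainTheorem7 {S : Type*} [TopologicalSpace S] [PolishSpace S]
    [MeasurableSpace S] [BorelSpace S]
    (h : ℕ → S →ᵇ ℝ) (h_nonneg : ∀ k x, 0 ≤ h k x) (h_le_one : ∀ k x, h k x ≤ 1)
    (h_pos : ∀ x, ∃ k, 0 < h k x)
    {Ω' : ℕ → Type*} [∀ n, MeasurableSpace (Ω' n)] (P' : ∀ n, Measure (Ω' n))
    [∀ n, IsProbabilityMeasure (P' n)]
    {Ω : Type*} [MeasurableSpace Ω] (P : Measure Ω) [IsProbabilityMeasure P]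
    (ξ' : ∀ n, ℝ≥0 → Ω' n → LevelMeasure h) (Ξ' : ∀ n, ℝ≥0 → Ω' n → LocMeasure h)
    (ξ : ℝ≥0 → Ω → LevelMeasure h)
    (hξ' : ∀ n, IsProcess (ξ' n)) (hξ'_cadlag : ∀ n, IsCadlag (ξ' n))
    (hΞ' : ∀ n, IsProcess (Ξ' n)) (hΞ'_cadlag : ∀ n, IsCadlag (Ξ' n))
    (hξ : IsProcess ξ)
    (hconv : FDDConverges P' ξ' P ξ) :
    ((∀ n, CondPoissonRel (P' n) (ξ' n) (Ξ' n)) →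
      ∃ Ξ : ℝ≥0 → Ω → LocMeasure h,
        IsProcess Ξ ∧ FDDConverges P' Ξ' P Ξ ∧ CondPoissonRel P ξ Ξ) ∧
    (∀ r : ℕ → ℝ, (∀ n, 0 < r n) → Tendsto r atTop atTop →
      (∀ n t ω, (ξ' n t ω).1 (levelsUpTo S (r n))ᶜ = 0) →
      (∀ n, CondUniformRel (P' n) (r n) (ξ' n) (Ξ' n)) →
      ∃ Ξ : ℝ≥0 → Ω → LocMeasure h,
        IsProcess Ξ ∧ FDDConverges P' Ξ' P Ξ ∧ CondPoissonRel P ξ Ξ) := by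
  constructor
  · intro hP
    exact LevelApproximation.exists_limit ⟨h_nonneg, h_le_one, h_pos, hξ', hΞ', hξ, hconv,
      fun K hK δ hδ η hη => Eventually.of_forall fun n t =>
        (hP n).levelSandwich h_nonneg h_le_one (hξ' n) (hΞ' n) t hK hδ hη⟩
  · intro r _ hr _ hU
    refine LevelApproximation.exists_limit ⟨h_nonneg, h_le_one, h_pos, hξ', hΞ', hξ, hconv,
      fun K hK δ hδ η hη => ?_⟩
    -- The limit `1 + η` exceeds `1`, so the slack condition of the uniform sandwich holds for all
    -- large `n`.
    have hlim : Tendsto (fun n => (1 + η) * (1 - (K + δ) / r n)) atTop (𝓝 ((1 + η) * (1 - 0))) :=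
      ((hr.const_div_atTop (K + δ)).const_sub 1).const_mul (1 + η)
    filter_upwards [hr.eventually_gt_atTop (K + δ),
      hlim.eventually (lt_mem_nhds (by linarith : 1 < (1 + η) * (1 - 0)))] with n h1 h2 t
    exact (hU n).levelSandwich h_nonneg h_le_one (hξ' n) (hΞ' n) t hK hδ h1 h2.le
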